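/- **Theorem (Formal Separatrix).** Write $\mathbf q=(q_1,q_2)$, $\mathbf p=(p_1,p_2)$ for the coordinates of $\mathbb C^4$, let $I_1=q_2p_1-q_1p_2$, $I_2=\tfrac12(q_1^2+q_2^2)$, $I_3=\tfrac12(p_1^2+p_2^2)$, and let $$H=-I_1+I_2+\eta I_3^2+F,\qquad \eta\in\mathbb C\setminus\{0\},$$ where $F$ is a bounded analytic function on an open neighbourhood of the origin in $\mathbb C^4$ whose Taylor series at $0$ contains only monomials of order at least $5$, each $q_i$ being counted with order $2$ and each $p_i$ with order $1$. Let $X_H=(\partial H/\partial\mathbf p,-\partial H/\partial\mathbf q)$ and $\mathcal D=\partial_\varphi+\partial_\tau$, and let $\mathsf T$ be the space of trigonometric polynomials in $\varphi$ with complex coefficients. Writing $f_{ijkl}$ for the Taylor coefficient of $F$ at $q_1^iq_2^jp_1^kp_2^l$, put $$\alpha=\tfrac14\left(3f_{0130}+f_{0112}-f_{1021}-3f_{1003}\right),\qquad \beta=\tfrac14\left(3f_{1030}+f_{1012}+f_{0121}+3f_{0103}\right),$$ the coefficients of $I_1I_3$ and of $(q_1p_1+q_2p_2)I_3$ in the average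 of $F$ over the simultaneous rotations of $\mathbf q$ and $\mathbf p$. Then: 1. $\alpha$ is the normal form coefficient $a_{1,1}$ of $H$: if a formal near identity symplectic change of coordinates $\Phi$ brings $H$ to the form $H\circ\Phi=-I_1+I_2+\sum_{l+k\ge2}a_{l,k}I_1^lI_3^k$, then $a_{1,1}=\alpha$. 2. For each $\kappa\in\mathbb C$ with $\kappa^2=-2/\eta$, the equation $\mathcal D\mathbf\Gamma=X_H(\mathbf\Gamma)$ has a non-zero formal solution of the form $$\hat{\mathbf\Gamma}=\left(\tau^{-2}\hat\Gamma_1,\ \tau^{-2}\hat\Gamma_2,\ \tau^{-1}\hat\Gamma_3,\ \tau^{-1}\hat\Gamma_4\right)^T,\qquad \hat\Gamma_i\in\mathsf T[[\tau^{-1}]],\tag{$*$}$$ with $$\begin{aligned} \hat\Gamma_1&=\kappa\cos\varphi+\tfrac{\kappa}{\eta}\left(\alpha\sin\varphi+\beta\cos\varphi\right)\tau^{-1}+\cdots,& \hat\Gamma_2&=\kappa\sin\varphi+\tfrac{\kappa}{\eta}\left(-\alpha\cos\varphi+\beta\sin\varphi\right)\tau^{-1}+\cdots,\\ \hat\Gamma_3&=\kappa\cos\varphi+\tfrac{\kappa\alpha}{\eta}\sin\varphi\,\tau^{-1}+\cdots,&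 \hat\Gamma_4&=\kappa\sin\varphi-\tfrac{\kappa\alpha}{\eta}\cos\varphi\,\tau^{-1}+\cdots, \end{aligned}$$ where the dots stand for higher order terms in $\tau^{-1}$. Moreover, for every non-zero formal solution $\tilde{\mathbf\Gamma}$ of the same equation having the form $(*)$ there is $(\varphi_0,\tau_0)\in\mathbb C^2$ such that $\tilde{\mathbf\Gamma}(\varphi,\tau)=\hat{\mathbf\Gamma}(\varphi+\varphi_0,\tau+\tau_0)$. -/

import Mathlib

namespace FormalSeparatrix

noncomputable section

/-! Coordinates on `ℂ⁴`: index `0, 1, 2, 3` stands for `q₁, q₂, p₁, p₂`. -/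

/-- The orders of the four variables: `q₁, q₂` have order `2`, `p₁, p₂` have order `1`. -/
def wt : Fin 4 → ℕ := ![2, 2, 1, 1]

/-- The `i`-th partial derivative of a function on `ℂ⁴`. -/
def partialDeriv (i : Fin 4) (F : (Fin 4 → ℂ) → ℂ) : (Fin 4 → ℂ) → ℂ :=
  fun z => fderiv ℂ F z (Pi.single i 1)

/-- The Taylor series at the origin: the coefficient at the multi-index `m` is
`(∂₀^{m₀} ∂₁^{m₁} ∂₂^{m₂} ∂₃^{m₃} F)(0) / m!`. -/
def taylorSeries (F : (Fin 4 → ℂ) → ℂ) : MvPowerSeries (Fin 4) ℂ := fun m =>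
  ((partialDeriv 0)^[m 0] ((partialDeriv 1)^[m 1]
    ((partialDeriv 2)^[m 2] ((partialDeriv 3)^[m 3] F)))) 0 /
      ((∏ i, (m i).factorial : ℕ) : ℂ)

/-- `I₁ = q₂ p₁ - q₁ p₂`. -/
def I₁ : MvPowerSeries (Fin 4) ℂ :=
  MvPowerSeries.X 1 * MvPowerSeries.X 2 - MvPowerSeries.X 0 * MvPowerSeries.X 3

/-- `I₂ = (q₁² + q₂²) / 2`. -/
def I₂ : MvPowerSeries (Fin 4) ℂ :=
  MvPowerSeries.C (1 / 2 : ℂ) * (MvPowerSeries.X 0 ^ 2 + MvPowerSeries.X 1 ^ 2)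

/-- `I₃ = (p₁² + p₂²) / 2`. -/
def I₃ : MvPowerSeries (Fin 4) ℂ :=
  MvPowerSeries.C (1 / 2 : ℂ) * (MvPowerSeries.X 2 ^ 2 + MvPowerSeries.X 3 ^ 2)

/-- The Taylor series of the Hamiltonian `H = -I₁ + I₂ + η I₃² + F`, where `f` is the Taylor
series of `F`. -/
def hamiltonian (η : ℂ) (f : MvPowerSeries (Fin 4) ℂ) : MvPowerSeries (Fin 4) ℂ :=
  -I₁ + I₂ + MvPowerSeries.C η * I₃ ^ 2 + f

/-- The Hamiltonian vector field `X_H = (∂H/∂p, -∂H/∂q)`. -/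
def hamVectorField (H : MvPowerSeries (Fin 4) ℂ) : Fin 4 → MvPowerSeries (Fin 4) ℂ :=
  ![MvPowerSeries.pderiv ℂ 2 H, MvPowerSeries.pderiv ℂ 3 H,
    -MvPowerSeries.pderiv ℂ 0 H, -MvPowerSeries.pderiv ℂ 1 H]

/-! Formal series in `τ⁻¹` whose coefficients are functions of `φ ∈ ℂ`: the variable
`PowerSeries.X` stands for `τ⁻¹`. -/

/-- Trigonometric polynomials with complex coefficients. -/
def IsTrigPoly (f : ℂ → ℂ) : Prop :=
  ∃ (n : ℕ) (a b : ℕ → ℂ), ∀ φ : ℂ,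
    f φ = a 0 + ∑ k ∈ Finset.Icc 1 n, a k * Complex.cos (k * φ)
      + ∑ k ∈ Finset.Icc 1 n, b k * Complex.sin (k * φ)

/-- Four formal series in `τ⁻¹` all of whose coefficients are trigonometric polynomials. -/
def HasTrigCoeffs (G : Fin 4 → PowerSeries (ℂ → ℂ)) : Prop :=
  ∀ i n, IsTrigPoly (PowerSeries.coeff n (G i))

/-- The vector `(τ⁻² G₁, τ⁻² G₂, τ⁻¹ G₃, τ⁻¹ G₄)`. -/
def ofHat (G : Fin 4 → PowerSeries (ℂ → ℂ)) : Fin 4 → PowerSeries (ℂ → ℂ) :=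
  fun i => PowerSeries.X ^ wt i * G i

/-- The derivative `∂_φ`, coefficient by coefficient. -/
def dPhi (g : PowerSeries (ℂ → ℂ)) : PowerSeries (ℂ → ℂ) :=
  PowerSeries.mk fun n => deriv (PowerSeries.coeff n g)

/-- The derivative `∂_τ`: with `s = τ⁻¹` it is `-s² d/ds`. -/
def dTau (g : PowerSeries (ℂ → ℂ)) : PowerSeries (ℂ → ℂ) :=
  -(PowerSeries.X ^ 2 * PowerSeries.derivative (ℂ → ℂ) g)

/-- `Γ` solves `(∂_φ + ∂_τ) Γ = X_H(Γ)` formally. -/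
def IsFormalSolution (H : MvPowerSeries (Fin 4) ℂ) (Γ : Fin 4 → PowerSeries (ℂ → ℂ)) : Prop :=
  ∀ i, dPhi (Γ i) + dTau (Γ i) = MvPowerSeries.subst Γ (hamVectorField H i)

/-- The translate `g(φ + φ₀, τ + τ₀)`: the coefficients are shifted by `φ₀`, and for `s = τ⁻¹`
one substitutes `(τ + τ₀)⁻¹ = s ∑ₖ (-τ₀ s)ᵏ`. -/
def translate (φ₀ τ₀ : ℂ) (g : PowerSeries (ℂ → ℂ)) : PowerSeries (ℂ → ℂ) :=
  PowerSeries.subst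
    (PowerSeries.X * PowerSeries.mk (fun k => fun _ : ℂ => (-τ₀) ^ k) : PowerSeries (ℂ → ℂ))
    (PowerSeries.mk fun n => fun φ : ℂ => PowerSeries.coeff n g (φ + φ₀))

/-! The normal form of the Hamiltonian. -/

/-- The formal series `-I₁ + I₂ + ∑_{l+k≥2} a_{l,k} I₁ˡ I₃ᵏ`. -/
def normalForm (a : ℕ → ℕ → ℂ) : MvPowerSeries (Fin 4) ℂ :=
  -I₁ + I₂ + MvPowerSeries.subst ![I₁, I₃]
    ((fun m => if 2 ≤ m 0 + m 1 then a (m 0) (m 1) else 0) : MvPowerSeries (Fin 2) ℂ)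

/-- The matrix of the standard symplectic form `dq ∧ dp`. -/
def symplJ : Matrix (Fin 4) (Fin 4) (MvPowerSeries (Fin 4) ℂ) :=
  !![0, 0, 1, 0; 0, 0, 0, 1; -1, 0, 0, 0; 0, -1, 0, 0]

/-- The Jacobian matrix of a formal map. -/
def jacobian (Φ : Fin 4 → MvPowerSeries (Fin 4) ℂ) :
    Matrix (Fin 4) (Fin 4) (MvPowerSeries (Fin 4) ℂ) :=
  Matrix.of fun i j => MvPowerSeries.pderiv ℂ j (Φ i)

/-- `Φ` is a formal near identity symplectic change of coordinates that brings `H` to the normal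
form with coefficients `a`. -/
structure IsNormalization (H : MvPowerSeries (Fin 4) ℂ) (Φ : Fin 4 → MvPowerSeries (Fin 4) ℂ)
    (a : ℕ → ℕ → ℂ) : Prop where
  near_id : ∀ (i : Fin 4) (m : Fin 4 →₀ ℕ), m.degree < 2 →
    MvPowerSeries.coeff m (Φ i) = MvPowerSeries.coeff m (MvPowerSeries.X i)
  symplectic : (jacobian Φ).transpose * symplJ * jacobian Φ = symplJ
  normal : MvPowerSeries.subst Φ H = normalForm a

/-- The multi-index `(m₀, m₁, m₂, m₃)`. -/
def multiIndex (m₀ m₁ m₂ m₃ : ℕ) : Fin 4 →₀ ℕ :=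
  Finsupp.equivFunOnFinite.symm ![m₀, m₁, m₂, m₃]

/-- The coefficient of `I₁ I₃` in the average of `f` over the rotations `(q, p) ↦ (R q, R p)`. -/
def coeffI₁I₃ (f : MvPowerSeries (Fin 4) ℂ) : ℂ :=
  (3 * MvPowerSeries.coeff (multiIndex 0 1 3 0) f + MvPowerSeries.coeff (multiIndex 0 1 1 2) f
    - MvPowerSeries.coeff (multiIndex 1 0 2 1) f
    - 3 * MvPowerSeries.coeff (multiIndex 1 0 0 3) f) / 4

/-- The coefficient of `(q₁ p₁ + q₂ p₂) I₃` in the average of `f` over the rotations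
`(q, p) ↦ (R q, R p)`. -/
def coeffQPI₃ (f : MvPowerSeries (Fin 4) ℂ) : ℂ :=
  (3 * MvPowerSeries.coeff (multiIndex 1 0 3 0) f + MvPowerSeries.coeff (multiIndex 1 0 1 2) f
    + MvPowerSeries.coeff (multiIndex 0 1 2 1) f
    + 3 * MvPowerSeries.coeff (multiIndex 0 1 0 3) f) / 4

end

end FormalSeparatrix

/-! # The formal separatrix

Only the Taylor series `f` of `F` enters the statement, and only through the fact that all of its
monomials have weighted degree at least `5`.

**The formal solution.** The quadratic part `-I₁` of the Hamiltonian generates the simultaneous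
rotation of `q` and `p`, so the equation is written in a frame that rotates with `φ` (`rot`): with
`x₀, x₁` the components of `τ² q`, and `x₂, x₃` those of `τ p`, along `(cos φ, sin φ)` and
`(-sin φ, cos φ)`, it takes the form `residual η A x = 0`, where `A` is the contribution of `F`. The weights make `A` *causal*: its
coefficient of order `n + 2` in `τ⁻¹` only involves coefficients of `x` of order at most `n`.
Changing the coefficient of order `K ≥ 1` of `x` by `y` changes the equation at order `K` by
`∂_φ y` and at order `K + 1` by `-linPart y`, besides another derivative (`residual_add`). Since
`∂_φ` has the constants as kernel and the functions of mean value zero as image, the oscillating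
part of `y` is determined by the equation at order `K`, and its mean value by the mean value of the
equation at order `K + 1`. With leading coefficients `(c, d)`, where `c² + d² = κ²`, the operator
`linPart` splits into a radial part of determinant `(K - 1) (K + 4)` and a tangential part of
determinant `K (K + 3)`. Hence it is invertible for `K ≥ 2`, while for `K = 1` it has a
one-dimensional radial kernel and cokernel.

* Existence: the obstruction at `K = 1` vanishes because of the mean values of the lowest order
  terms of `A` (`mean_rotForce`), which depend on `f` through `α` and `β` only. They are also
  what determines the terms of first order (`solvesTo_initialSeries`).
* Uniqueness: a solution is determined by its leading coefficients `(c, d)` and the radial part of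
  the mean values at order one (`residual_unique`). The translations `φ₀` and `τ₀` act transitively
  on these two data (`exists_translate`), because `(c, d)` can be written as `κ (cos φ₀, sin φ₀)`.

**The normal form coefficient.** The terms of degree three in `H ∘ Φ = -I₁ + I₂ + ⋯`, together with
the bracket relations that express that `Φ` is symplectic, force enough quadratic terms of `Φ` to
vanish (`IsNormalization.coeff_pp`, `IsNormalization.coeff_qp`) for `Φ` to act trivially on the
terms of weighted degree `5` of `f`. The coefficients of `q₂ p₁³`, `q₂ p₁ p₂²`, `q₁ p₁² p₂` and
`q₁ p₂³` in the normal form equation, combined with the weights of the definition of `α`, then leave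
`a₁₁ = α`, as the remaining contributions of `Φ` cancel by the bracket relations.
-/

namespace FormalSeparatrix

noncomputable section

/-! ### Trigonometric polynomials -/

/-- The exponential `φ ↦ exp (i k φ)`. -/
def expMode (k : ℤ) : ℂ → ℂ := fun φ => Complex.exp (k * φ * Complex.I)

theorem expMode_mul (k l : ℤ) : expMode k * expMode l = expMode (k + l) := by
  funext φ
  simp only [expMode, Pi.mul_apply, ← Complex.exp_add]
  congr 1
  push_cast
  ring

theorem expMode_zero : expMode 0 = 1 := by
  funext φ
  simp [expMode]

/-- The algebra of trigonometric polynomials, as the linear span of the exponentials. -/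
def Trig : Subalgebra ℂ (ℂ → ℂ) :=
  (Submodule.span ℂ (Set.range expMode)).toSubalgebra
    (by rw [← expMode_zero]; exact Submodule.subset_span ⟨0, rfl⟩)
    (by
      intro f g hf hg
      have := Submodule.mul_mem_mul hf hg
      rw [Submodule.span_mul_span] at this
      refine Submodule.span_mono ?_ this
      rintro _ ⟨_, ⟨k, rfl⟩, _, ⟨l, rfl⟩, rfl⟩
      exact ⟨k + l, (expMode_mul k l).symm⟩)

theorem expMode_mem (k : ℤ) : expMode k ∈ Trig :=
  Submodule.subset_span ⟨k, rfl⟩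

/-- Induction on trigonometric polynomials, for predicates on functions. -/
theorem trig_induction {p : (ℂ → ℂ) → Prop} (h0 : ∀ k, p (expMode k)) (hz : p 0)
    (hadd : ∀ f ∈ Trig, ∀ g ∈ Trig, p f → p g → p (f + g))
    (hsmul : ∀ (c : ℂ), ∀ f ∈ Trig, p f → p (c • f)) (f : ℂ → ℂ) (hf : f ∈ Trig) : p f := by
  refine Submodule.span_induction (p := fun f _ => p f) ?_ hz ?_ ?_ hf
  · rintro _ ⟨k, rfl⟩
    exact h0 k
  · intro x y hx hy
    exact hadd x hx y hy
  · intro a x hx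
    exact hsmul a x hx

theorem hasDerivAt_expMode (k : ℤ) (φ : ℂ) :
    HasDerivAt (expMode k) (k * Complex.I * expMode k φ) φ := by
  have h : HasDerivAt (fun φ : ℂ => k * φ * Complex.I) (k * 1 * Complex.I) φ :=
    ((hasDerivAt_id φ).const_mul _).mul_const _
  have := h.cexp
  rw [mul_comm, ← mul_one (k : ℂ)]
  exact this

theorem differentiable_of_mem_trig (f : ℂ → ℂ) (hf : f ∈ Trig) : Differentiable ℂ f := by
  refine trig_induction (fun k φ => (hasDerivAt_expMode k φ).differentiableAt) ?_ ?_ ?_ f hf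
  · exact differentiable_const 0
  · exact fun f _ g _ hf hg => hf.add hg
  · exact fun c f _ hf => hf.const_smul c

theorem deriv_mem_trig (f : ℂ → ℂ) (hf : f ∈ Trig) : deriv f ∈ Trig := by
  refine trig_induction (p := fun f => deriv f ∈ Trig) ?_ ?_ ?_ ?_ f hf
  · intro k
    have : deriv (expMode k) = ((k : ℂ) * Complex.I) • expMode k := by
      funext φ
      rw [(hasDerivAt_expMode k φ).deriv, Pi.smul_apply, smul_eq_mul]
    rw [this]
    exact Trig.smul_mem (expMode_mem k) _
  · have : deriv (0 : ℂ → ℂ) = 0 := by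
      funext φ
      exact deriv_const φ 0
    rw [this]
    exact Trig.zero_mem
  · intro f hf g hg h1 h2
    have : deriv (f + g) = deriv f + deriv g := by
      funext φ
      exact deriv_add (differentiable_of_mem_trig f hf φ) (differentiable_of_mem_trig g hg φ)
    rw [this]
    exact Trig.add_mem h1 h2
  · intro c f hf h1
    have : deriv (c • f) = c • deriv f := by
      funext φ
      exact deriv_const_smul c (differentiable_of_mem_trig f hf φ)
    rw [this]
    exact Trig.smul_mem h1 c

theorem periodic_of_mem_trig (f : ℂ → ℂ) (hf : f ∈ Trig) : f (2 * Real.pi) = f 0 := by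
  refine trig_induction (p := fun f => f (2 * Real.pi) = f 0) ?_ rfl ?_ ?_ f hf
  · intro k
    simp only [expMode]
    have : (k : ℂ) * (2 * Real.pi) * Complex.I = k * (2 * Real.pi * Complex.I) := by ring
    rw [this, Complex.exp_int_mul_two_pi_mul_I]
    simp
  · intro f _ g _ h1 h2
    simp only [Pi.add_apply, h1, h2]
  · intro c f _ h1
    simp only [Pi.smul_apply, h1]

namespace Trig

/-- The derivative of trigonometric polynomials. -/
def D : Trig →ₗ[ℂ] Trig where
  toFun f := ⟨deriv f.1, deriv_mem_trig f.1 f.2⟩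
  map_add' f g := by
    apply Subtype.ext
    funext φ
    exact deriv_add (differentiable_of_mem_trig _ f.2 φ) (differentiable_of_mem_trig _ g.2 φ)
  map_smul' c f := by
    apply Subtype.ext
    funext φ
    exact deriv_const_smul c (differentiable_of_mem_trig _ f.2 φ)

theorem coe_D (f : Trig) : ((D f : Trig) : ℂ → ℂ) = deriv (f : ℂ → ℂ) := rfl

theorem D_mul (f g : Trig) : D (f * g) = D f * g + f * D g := by
  apply Subtype.ext
  funext φ
  exact deriv_mul (differentiable_of_mem_trig _ f.2 φ) (differentiable_of_mem_trig _ g.2 φ)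

theorem D_algebraMap (c : ℂ) : D (algebraMap ℂ Trig c) = 0 := by
  apply Subtype.ext
  funext φ
  exact deriv_const φ c

theorem intervalIntegrable (f : Trig) :
    IntervalIntegrable (fun x : ℝ => f.1 x) MeasureTheory.volume 0 (2 * Real.pi) := by
  apply Continuous.intervalIntegrable
  exact (differentiable_of_mem_trig _ f.2).continuous.comp Complex.continuous_ofReal

/-- The mean value of a trigonometric polynomial over a period. -/
def mean : Trig →ₗ[ℂ] ℂ where
  toFun f := (2 * Real.pi : ℂ)⁻¹ * ∫ x : ℝ in (0)..(2 * Real.pi), f.1 x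
  map_add' f g := by
    rw [← mul_add, ← intervalIntegral.integral_add (intervalIntegrable f) (intervalIntegrable g)]
    rfl
  map_smul' c f := by
    have : ∫ x : ℝ in (0)..(2 * Real.pi), (c • f).1 x
        = c * ∫ x : ℝ in (0)..(2 * Real.pi), f.1 x := by
      rw [← intervalIntegral.integral_const_mul]
      rfl
    rw [this, RingHom.id_apply, smul_eq_mul]
    ring

theorem mean_algebraMap (c : ℂ) : mean (algebraMap ℂ Trig c) = c := by
  change (2 * Real.pi : ℂ)⁻¹ * ∫ x : ℝ in (0)..(2 * Real.pi), c = c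
  rw [intervalIntegral.integral_const]
  have : (Real.pi : ℂ) ≠ 0 := by exact_mod_cast Real.pi_ne_zero
  simp only [sub_zero, Complex.real_smul]
  push_cast
  field_simp

theorem mean_D (f : Trig) : mean (D f) = 0 := by
  change (2 * Real.pi : ℂ)⁻¹ * ∫ x : ℝ in (0)..(2 * Real.pi), deriv f.1 x = 0
  have h : ∀ x ∈ Set.uIcc (0 : ℝ) (2 * Real.pi),
      HasDerivAt (fun y : ℝ => f.1 y) (deriv f.1 x) x := fun x _ =>
    ((differentiable_of_mem_trig _ f.2) (x : ℂ)).hasDerivAt.comp_ofReal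
  rw [intervalIntegral.integral_eq_sub_of_hasDerivAt h (intervalIntegrable (D f))]
  have := periodic_of_mem_trig _ f.2
  push_cast
  rw [this, sub_self, mul_zero]

theorem eq_algebraMap_mean_of_D_eq_zero (f : Trig) (h : D f = 0) :
    f = algebraMap ℂ Trig (mean f) := by
  have hc : f = algebraMap ℂ Trig (f.1 0) := by
    apply Subtype.ext
    funext φ
    exact is_const_of_deriv_eq_zero (differentiable_of_mem_trig _ f.2)
      (fun x => congrFun (congrArg Subtype.val h) x) φ 0
  have : mean f = f.1 0 := by
    conv_lhs => rw [hc]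
    exact mean_algebraMap _
  rw [this]
  exact hc

/-- A trigonometric polynomial of mean value zero is a derivative: the only exponential without a
primitive in `Trig` is the constant. -/
theorem exists_primitive (f : Trig) (h : mean f = 0) : ∃ g, D g = f := by
  have key : ∃ (c : ℂ) (g : Trig), f = algebraMap ℂ Trig c + D g := by
    obtain ⟨f, hf⟩ := f
    have : ∃ (c : ℂ) (g : Trig), f = fun φ => c + deriv g.1 φ := by
      refine trig_induction (p := fun f => ∃ (c : ℂ) (g : Trig), f = fun φ => c + deriv g.1 φ)
        ?_ ?_ ?_ ?_ f hf
      · intro k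
        rcases eq_or_ne k 0 with rfl | hk
        · refine ⟨1, 0, ?_⟩
          funext φ
          rw [expMode_zero]
          simp [show deriv (0 : ℂ → ℂ) φ = 0 from deriv_const φ 0]
        · refine ⟨0, ((k : ℂ) * Complex.I)⁻¹ • ⟨expMode k, expMode_mem k⟩, ?_⟩
          funext φ
          have h1 : deriv (((k : ℂ) * Complex.I)⁻¹ • expMode k) φ
              = ((k : ℂ) * Complex.I)⁻¹ • deriv (expMode k) φ :=
            deriv_const_smul _ (differentiable_of_mem_trig _ (expMode_mem k) φ)
          have hk' : (k : ℂ) ≠ 0 := by exact_mod_cast hk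
          have hI := Complex.I_ne_zero
          change _ = 0 + deriv (((k : ℂ) * Complex.I)⁻¹ • expMode k) φ
          rw [h1, (hasDerivAt_expMode k φ).deriv, smul_eq_mul]
          field_simp
          ring
      · exact ⟨0, 0, by funext φ; simp [show deriv (0 : ℂ → ℂ) φ = 0 from deriv_const φ 0]⟩
      · rintro _ _ _ _ ⟨c, g, rfl⟩ ⟨c', g', rfl⟩
        refine ⟨c + c', g + g', ?_⟩
        funext φ
        have := congrFun (congrArg Subtype.val (D.map_add g g')) φ
        simp only [coe_D] at this
        rw [this]
        simp only [Pi.add_apply, Subalgebra.coe_add, coe_D]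
        ring
      · rintro a _ _ ⟨c, g, rfl⟩
        refine ⟨a * c, a • g, ?_⟩
        funext φ
        have := congrFun (congrArg Subtype.val (D.map_smul a g)) φ
        simp only [coe_D] at this
        rw [this]
        simp only [Pi.smul_apply, Subalgebra.coe_smul, coe_D, smul_eq_mul]
        ring
    obtain ⟨c, g, hg⟩ := this
    exact ⟨c, g, Subtype.ext hg⟩
  obtain ⟨c, g, hg⟩ := key
  have : mean f = c := by
    rw [hg, map_add, mean_D, mean_algebraMap, add_zero]
  refine ⟨g, ?_⟩
  rw [hg, ← this, h, map_zero, zero_add]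

end Trig

theorem cos_eq_expMode (k : ℕ) :
    (fun φ : ℂ => Complex.cos (k * φ)) = (1 / 2 : ℂ) • (expMode k + expMode (-k)) := by
  funext φ
  simp only [expMode, Complex.cos, Pi.smul_apply, Pi.add_apply, smul_eq_mul]
  push_cast
  ring_nf

theorem sin_eq_expMode (k : ℕ) :
    (fun φ : ℂ => Complex.sin (k * φ)) = (Complex.I / 2 : ℂ) • (expMode (-k) - expMode k) := by
  funext φ
  simp only [expMode, Complex.sin, Pi.smul_apply, Pi.sub_apply, smul_eq_mul]
  push_cast
  ring_nf

theorem cos_mem_trig (k : ℕ) : (fun φ : ℂ => Complex.cos (k * φ)) ∈ Trig := by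
  rw [cos_eq_expMode]
  exact Trig.smul_mem (Trig.add_mem (expMode_mem _) (expMode_mem _)) _

theorem sin_mem_trig (k : ℕ) : (fun φ : ℂ => Complex.sin (k * φ)) ∈ Trig := by
  rw [sin_eq_expMode]
  exact Trig.smul_mem (Trig.sub_mem (expMode_mem _) (expMode_mem _)) _

theorem isTrigPoly_expMode (k : ℤ) : IsTrigPoly (expMode k) := by
  have h : ∀ (n : ℕ) (ε : ℂ),
      ∃ (m : ℕ) (a b : ℕ → ℂ), ∀ φ : ℂ,
        Complex.cos (n * φ) + ε * Complex.I * Complex.sin (n * φ) =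
        a 0 + ∑ j ∈ Finset.Icc 1 m, a j * Complex.cos (j * φ)
          + ∑ j ∈ Finset.Icc 1 m, b j * Complex.sin (j * φ) := by
    intro n ε
    rcases Nat.eq_zero_or_pos n with rfl | hn
    · exact ⟨0, fun _ => 1, 0, fun φ => by simp⟩
    · refine ⟨n, fun j => if j = n then 1 else 0, fun j => if j = n then ε * Complex.I else 0, ?_⟩
      intro φ
      have h1 : n ∈ Finset.Icc 1 n := by simp; omega
      simp [Finset.sum_ite_eq', ite_mul, h1, hn.ne]
  obtain ⟨n, rfl | rfl⟩ := k.eq_nat_or_neg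
  · obtain ⟨m, a, b, hab⟩ := h n 1
    refine ⟨m, a, b, fun φ => ?_⟩
    rw [← hab, expMode, Complex.exp_mul_I]
    push_cast
    ring
  · obtain ⟨m, a, b, hab⟩ := h n (-1)
    refine ⟨m, a, b, fun φ => ?_⟩
    rw [← hab, expMode, Complex.exp_mul_I]
    push_cast
    rw [neg_mul, Complex.cos_neg, Complex.sin_neg]
    ring

/-- The sums in a trigonometric polynomial may be extended with zero coefficients, which allows two
of them to be added. -/
theorem IsTrigPoly.exists_uniform {f : ℂ → ℂ} (hf : IsTrigPoly f) :
    ∃ (n : ℕ) (a b : ℕ → ℂ), ∀ N, n ≤ N → ∀ φ : ℂ,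
      f φ = a 0 + ∑ k ∈ Finset.Icc 1 N, a k * Complex.cos (k * φ)
        + ∑ k ∈ Finset.Icc 1 N, b k * Complex.sin (k * φ) := by
  obtain ⟨n, a, b, h⟩ := hf
  refine ⟨n, fun k => if k ≤ n then a k else 0, fun k => if k ≤ n then b k else 0, ?_⟩
  intro N hN φ
  have key : ∀ (c : ℕ → ℂ) (u : ℕ → ℂ), ∑ k ∈ Finset.Icc 1 N, (if k ≤ n then c k else 0) * u k
      = ∑ k ∈ Finset.Icc 1 n, c k * u k := by
    intro c u
    rw [← Finset.sum_subset (Finset.Icc_subset_Icc_right hN)]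
    · refine Finset.sum_congr rfl fun k hk => ?_
      rw [if_pos (Finset.mem_Icc.1 hk).2]
    · intro k hk hk'
      rw [if_neg, zero_mul]
      intro hkn
      exact hk' (Finset.mem_Icc.2 ⟨(Finset.mem_Icc.1 hk).1, hkn⟩)
  simp only [key, Nat.zero_le, if_true]
  exact h φ

theorem mem_trig_iff (f : ℂ → ℂ) : f ∈ Trig ↔ IsTrigPoly f := by
  constructor
  · refine trig_induction (fun k => isTrigPoly_expMode k) ⟨0, 0, 0, fun φ => by simp⟩ ?_ ?_ f
    · intro f _ g _ hf hg
      obtain ⟨n, a, b, h⟩ := hf.exists_uniform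
      obtain ⟨n', a', b', h'⟩ := hg.exists_uniform
      refine ⟨max n n', a + a', b + b', fun φ => ?_⟩
      rw [Pi.add_apply, h _ (le_max_left n n'), h' _ (le_max_right n n')]
      simp only [Pi.add_apply, add_mul, Finset.sum_add_distrib]
      ring
    · rintro c f _ ⟨n, a, b, h⟩
      refine ⟨n, c • a, c • b, fun φ => ?_⟩
      simp only [Pi.smul_apply, smul_eq_mul, h φ, mul_add, Finset.mul_sum, mul_assoc]
  · rintro ⟨n, a, b, h⟩
    have : f = algebraMap ℂ (ℂ → ℂ) (a 0)
        + ∑ k ∈ Finset.Icc 1 n, a k • (fun φ : ℂ => Complex.cos (k * φ))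
        + ∑ k ∈ Finset.Icc 1 n, b k • (fun φ : ℂ => Complex.sin (k * φ)) := by
      funext φ
      rw [h φ]
      simp [Finset.sum_apply]
    rw [this]
    refine Trig.add_mem (Trig.add_mem (Trig.algebraMap_mem _) ?_) ?_
    · exact Trig.sum_mem fun k _ => Trig.smul_mem (cos_mem_trig k) _
    · exact Trig.sum_mem fun k _ => Trig.smul_mem (sin_mem_trig k) _

section FormalSolution

open PowerSeries

/-! ### The equation in the rotating frame -/

/-- The derivative `∂_φ` of a formal series with trigonometric coefficients. -/
def dT (g : PowerSeries Trig) : PowerSeries Trig :=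
  PowerSeries.mk fun n => Trig.D (PowerSeries.coeff n g)

@[simp] theorem coeff_dT (n : ℕ) (g : Trig⟦X⟧) : coeff n (dT g) = Trig.D (coeff n g) := by
  simp [dT]

theorem constantCoeff_dT (g : Trig⟦X⟧) : constantCoeff (dT g) = Trig.D (constantCoeff g) := by
  rw [← coeff_zero_eq_constantCoeff_apply, coeff_dT, coeff_zero_eq_constantCoeff_apply]

theorem dT_add (f g : Trig⟦X⟧) : dT (f + g) = dT f + dT g := by
  ext1 n
  simp

theorem dT_X_pow_mul (K : ℕ) (g : Trig⟦X⟧) : dT (X ^ K * g) = X ^ K * dT g := by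
  ext1 n
  simp only [coeff_dT, coeff_X_pow_mul']
  split_ifs <;> simp

/-- Constants as formal series. -/
abbrev cst (c : ℂ) : Trig⟦X⟧ := C (algebraMap ℂ Trig c)

/-- The equation in the frame that rotates with `φ`, written as `residual η A x = 0`. The unknowns
`x 0, x 1` are the components of `τ² q` along `(cos φ, sin φ)` and `(-sin φ, cos φ)`, and
`x 2, x 3` those of `τ p`; the term `A x` stands for the contribution of `F`. -/
def residual (η : ℂ) (A : (Fin 4 → Trig⟦X⟧) → Fin 4 → Trig⟦X⟧) (x : Fin 4 → Trig⟦X⟧) :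
    Fin 4 → Trig⟦X⟧ :=
  ![dT (x 0) - X * (2 * x 0 + X * derivative Trig (x 0))
      - X * cst η * ((x 2 ^ 2 + x 3 ^ 2) * x 2) - A x 0,
    dT (x 1) - X * (2 * x 1 + X * derivative Trig (x 1))
      - X * cst η * ((x 2 ^ 2 + x 3 ^ 2) * x 3) - A x 1,
    dT (x 2) - X * (x 2 + X * derivative Trig (x 2)) + X * x 0 - A x 2,
    dT (x 3) - X * (x 3 + X * derivative Trig (x 3)) + X * x 1 - A x 3]

/-- The term `A` involves the unknowns with a delay of two orders in `τ⁻¹`. -/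
def Causal (A : (Fin 4 → Trig⟦X⟧) → Fin 4 → Trig⟦X⟧) : Prop :=
  ∀ (x y : Fin 4 → Trig⟦X⟧) (K : ℕ), (∀ i, X ^ K ∣ y i - x i) →
    ∀ i, X ^ (K + 2) ∣ A y i - A x i

/-- The linear operator by which a change of the `K`-th coefficient acts on the equation of order
`K + 1`, when the leading coefficients of `x 2, x 3` are `c, d`. -/
def linPart {V : Type*} [AddCommGroup V] [Module ℂ V] (η c d : ℂ) (K : ℕ) (y : Fin 4 → V) :
    Fin 4 → V :=
  ![((K : ℂ) + 2) • y 0 + (η * (3 * c ^ 2 + d ^ 2)) • y 2 + (η * (2 * c * d)) • y 3,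
    ((K : ℂ) + 2) • y 1 + (η * (2 * c * d)) • y 2 + (η * (c ^ 2 + 3 * d ^ 2)) • y 3,
    ((K : ℂ) + 1) • y 2 - y 0,
    ((K : ℂ) + 1) • y 3 - y 1]

theorem mean_linPart (η c d : ℂ) (K : ℕ) (y : Fin 4 → Trig) (i : Fin 4) :
    Trig.mean (linPart η c d K y i) = linPart η c d K (fun j => Trig.mean (y j)) i := by
  fin_cases i <;> simp [linPart]

theorem X_mul_derivative_X_pow_mul (K : ℕ) (g : Trig⟦X⟧) :
    X * derivative Trig (X ^ K * g) = X ^ K * ((K : Trig⟦X⟧) * g + X * derivative Trig g) := by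
  rw [Derivation.leibniz, derivative_pow, derivative_X, smul_eq_mul, smul_eq_mul]
  rcases K with _ | K
  · simp
  · simp only [Nat.add_sub_cancel]
    ring

theorem smul_eq_algebraMap_mul (a : ℂ) (t : Trig) : a • t = algebraMap ℂ Trig a * t :=
  Algebra.smul_def a t

/-- The expansion behind `residual_add`, with an explicit remainder `R`. -/
theorem residual_add_aux {η : ℂ} {A : (Fin 4 → Trig⟦X⟧) → Fin 4 → Trig⟦X⟧} (hA : Causal A)
    (x y : Fin 4 → Trig⟦X⟧) (K : ℕ) (hK : 1 ≤ K) (c d : ℂ)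
    (hc : coeff 0 (x 2) = algebraMap ℂ Trig c) (hd : coeff 0 (x 3) = algebraMap ℂ Trig d)
    (i : Fin 4) :
    ∃ R : Trig⟦X⟧, residual η A (fun j => x j + X ^ K * y j) i
        = residual η A x i + X ^ K * dT (y i) - X ^ (K + 1) * R ∧
      coeff 0 R = linPart η c d K (fun j => coeff 0 (y j)) i := by
  obtain ⟨N, rfl⟩ : ∃ N, K = N + 1 := ⟨K - 1, by omega⟩
  have hx' : ∀ j, X ^ (N + 1) ∣ (fun j => x j + X ^ (N + 1) * y j) j - x j := fun j =>
    ⟨y j, by ring⟩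
  obtain ⟨S, hS⟩ := hA x _ (N + 1) hx' i
  have hAS : A (fun j => x j + X ^ (N + 1) * y j) i = A x i + X ^ (N + 1 + 2) * S := by
    rw [← hS]; ring
  have hder : ∀ j, X * derivative Trig (x j + X ^ (N + 1) * y j)
      = X * derivative Trig (x j)
        + X ^ (N + 1) * (((N + 1 : ℕ) : Trig⟦X⟧) * y j + X * derivative Trig (y j)) := by
    intro j
    rw [map_add, mul_add, X_mul_derivative_X_pow_mul]
  have hc' : constantCoeff (x 2) = algebraMap ℂ Trig c := by
    rw [← hc, coeff_zero_eq_constantCoeff_apply]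
  have hd' : constantCoeff (x 3) = algebraMap ℂ Trig d := by
    rw [← hd, coeff_zero_eq_constantCoeff_apply]
  have s2 : constantCoeff (2 : Trig⟦X⟧) = 2 := map_ofNat _ 2
  have s3 : constantCoeff (3 : Trig⟦X⟧) = 3 := map_ofNat _ 3
  have a2 : algebraMap ℂ Trig 2 = 2 := map_ofNat _ 2
  have a3 : algebraMap ℂ Trig 3 = 3 := map_ofNat _ 3
  fin_cases i
  · refine ⟨2 * y 0 + (((N + 1 : ℕ) : Trig⟦X⟧) * y 0 + X * derivative Trig (y 0))
      + cst η * ((3 * x 2 ^ 2 + x 3 ^ 2) * y 2 + 2 * x 2 * x 3 * y 3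
        + X ^ (N + 1) * (3 * x 2 * y 2 ^ 2 + x 2 * y 3 ^ 2 + 2 * x 3 * y 2 * y 3)
        + X ^ (N + 1) * X ^ (N + 1) * (y 2 ^ 3 + y 3 ^ 2 * y 2)) + X * S, ?_, ?_⟩
    · simp only [residual, Fin.zero_eta, Matrix.cons_val_zero] at hAS ⊢
      rw [hAS, hder, dT_add, dT_X_pow_mul]
      ring
    · simp [linPart, hc', hd', smul_eq_algebraMap_mul, s2, s3, a2, a3]
      ring
  · refine ⟨2 * y 1 + (((N + 1 : ℕ) : Trig⟦X⟧) * y 1 + X * derivative Trig (y 1))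
      + cst η * ((x 2 ^ 2 + 3 * x 3 ^ 2) * y 3 + 2 * x 2 * x 3 * y 2
        + X ^ (N + 1) * (3 * x 3 * y 3 ^ 2 + x 3 * y 2 ^ 2 + 2 * x 2 * y 2 * y 3)
        + X ^ (N + 1) * X ^ (N + 1) * (y 3 ^ 3 + y 2 ^ 2 * y 3)) + X * S, ?_, ?_⟩
    · simp only [residual, Fin.mk_one, Matrix.cons_val_one, Matrix.cons_val_zero] at hAS ⊢
      rw [hAS, hder, dT_add, dT_X_pow_mul]
      ring
    · simp [linPart, hc', hd', smul_eq_algebraMap_mul, s2, s3, a2, a3]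
      ring
  · refine ⟨y 2 + (((N + 1 : ℕ) : Trig⟦X⟧) * y 2 + X * derivative Trig (y 2)) - y 0 + X * S,
      ?_, ?_⟩
    · simp only [residual, Fin.reduceFinMk, Matrix.cons_val] at hAS ⊢
      rw [hAS, hder, dT_add, dT_X_pow_mul]
      ring
    · simp [linPart, smul_eq_algebraMap_mul, a2]
      ring
  · refine ⟨y 3 + (((N + 1 : ℕ) : Trig⟦X⟧) * y 3 + X * derivative Trig (y 3)) - y 1 + X * S,
      ?_, ?_⟩
    · simp only [residual, Fin.reduceFinMk, Matrix.cons_val] at hAS ⊢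
      rw [hAS, hder, dT_add, dT_X_pow_mul]
      ring
    · simp [linPart, smul_eq_algebraMap_mul, a2]
      ring

/-- The effect on the residual of a change of the unknowns from order `K` on: it is the derivative
at order `K`, and the operator `linPart` appears at order `K + 1`. -/
theorem residual_add {η : ℂ} {A : (Fin 4 → Trig⟦X⟧) → Fin 4 → Trig⟦X⟧} (hA : Causal A)
    (x y : Fin 4 → Trig⟦X⟧) (K : ℕ) (hK : 1 ≤ K) (c d : ℂ)
    (hc : coeff 0 (x 2) = algebraMap ℂ Trig c) (hd : coeff 0 (x 3) = algebraMap ℂ Trig d)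
    (i : Fin 4) :
    (∀ k < K, coeff k (residual η A (fun j => x j + X ^ K * y j) i)
        = coeff k (residual η A x i)) ∧
    coeff K (residual η A (fun j => x j + X ^ K * y j) i)
        = coeff K (residual η A x i) + Trig.D (coeff 0 (y i)) ∧
    coeff (K + 1) (residual η A (fun j => x j + X ^ K * y j) i)
        = coeff (K + 1) (residual η A x i) + Trig.D (coeff 1 (y i))
          - linPart η c d K (fun j => coeff 0 (y j)) i := by
  obtain ⟨R, h1, h2⟩ := residual_add_aux (η := η) hA x y K hK c d hc hd i
  rw [h1, ← h2]
  refine ⟨fun k hk => ?_, ?_, ?_⟩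
  · simp only [map_sub, map_add, coeff_X_pow_mul']
    rw [if_neg (by omega), if_neg (by omega), add_zero, sub_zero]
  · simp only [map_sub, map_add, coeff_X_pow_mul']
    rw [if_pos le_rfl, if_neg (by omega), Nat.sub_self, coeff_dT, sub_zero]
  · simp only [map_sub, map_add, coeff_X_pow_mul']
    rw [if_pos (by omega), if_pos le_rfl, Nat.sub_self, coeff_dT, Nat.add_sub_cancel_left]

/-! ### Solutions order by order -/

/-- `x` solves the equation up to order `K`, and the equation of order `K + 1` is not obstructed by
the mean values. -/
structure SolvesTo (η κ : ℂ) (A : (Fin 4 → Trig⟦X⟧) → Fin 4 → Trig⟦X⟧) (K : ℕ)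
    (x : Fin 4 → Trig⟦X⟧) : Prop where
  lead2 : coeff 0 (x 2) = algebraMap ℂ Trig κ
  lead3 : coeff 0 (x 3) = algebraMap ℂ Trig 0
  solves : ∀ k ≤ K, ∀ i, coeff k (residual η A x i) = 0
  mean_eq : ∀ i, Trig.mean (coeff (K + 1) (residual η A x i)) = 0

/-- From order two on the mean values are not resonant: the radial and tangential parts have the
determinants `(K + 2) (K + 1) - 6 = (K - 1) (K + 4)` and `(K + 2) (K + 1) - 2 = K (K + 3)`. -/
theorem linPart_surjective {η κ : ℂ} (h : η * κ ^ 2 = -2) (K : ℕ) (hK : 2 ≤ K) (b : Fin 4 → ℂ) :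
    ∃ m : Fin 4 → ℂ, ∀ i, linPart η κ 0 K m i = b i := by
  have h1 : ((K : ℂ) + 2) * (K + 1) - 6 ≠ 0 := by
    have : ((K : ℂ) + 2) * (K + 1) - 6 = ((K - 1 : ℕ) : ℂ) * ((K + 4 : ℕ) : ℂ) := by
      rw [Nat.cast_sub (by omega)]
      push_cast
      ring
    rw [this]
    exact mul_ne_zero (Nat.cast_ne_zero.2 (by omega)) (Nat.cast_ne_zero.2 (by omega))
  have h2 : ((K : ℂ) + 2) * (K + 1) - 2 ≠ 0 := by
    have : ((K : ℂ) + 2) * (K + 1) - 2 = (K : ℂ) * ((K + 3 : ℕ) : ℂ) := by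
      push_cast
      ring
    rw [this]
    exact mul_ne_zero (Nat.cast_ne_zero.2 (by omega)) (Nat.cast_ne_zero.2 (by omega))
  obtain ⟨u, hu⟩ : ∃ u, (((K : ℂ) + 2) * (K + 1) - 6) * u = b 0 + (K + 2) * b 2 :=
    ⟨_, mul_div_cancel₀ _ h1⟩
  obtain ⟨v, hv⟩ : ∃ v, (((K : ℂ) + 2) * (K + 1) - 2) * v = b 1 + (K + 2) * b 3 :=
    ⟨_, mul_div_cancel₀ _ h2⟩
  refine ⟨![(K + 1) * u - b 2, (K + 1) * v - b 3, u, v], fun i => ?_⟩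
  fin_cases i <;> simp [linPart]
  · linear_combination hu + 3 * u * h
  · linear_combination hv + v * h

/-- One more order: the new coefficient has its oscillating part chosen to solve the equation of order
`K + 1`, and its mean value to remove the obstruction at order `K + 2`. -/
theorem SolvesTo.step {η κ : ℂ} (h : η * κ ^ 2 = -2)
    {A : (Fin 4 → Trig⟦X⟧) → Fin 4 → Trig⟦X⟧} (hA : Causal A) {K : ℕ} (hK : 1 ≤ K)
    {x : Fin 4 → Trig⟦X⟧} (hx : SolvesTo η κ A K x) :
    ∃ x', SolvesTo η κ A (K + 1) x' ∧ ∀ i, X ^ (K + 1) ∣ x' i - x i := by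
  have hprim : ∀ i, ∃ g, Trig.D g = -coeff (K + 1) (residual η A x i) := fun i =>
    Trig.exists_primitive _ (by rw [map_neg, hx.mean_eq i, neg_zero])
  choose g hg using hprim
  obtain ⟨m, hm⟩ := linPart_surjective h (K + 1) (by omega)
    (fun i => Trig.mean (coeff (K + 1 + 1) (residual η A x i)))
  set t : Fin 4 → Trig := fun i => g i + algebraMap ℂ Trig (m i - Trig.mean (g i)) with ht
  have hmt : ∀ i, Trig.mean (t i) = m i := by
    intro i
    simp only [ht, map_add, Trig.mean_algebraMap]
    ring
  have hDt : ∀ i, Trig.D (t i) = -coeff (K + 1) (residual η A x i) := by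
    intro i
    simp only [ht, map_add, Trig.D_algebraMap, hg, add_zero]
  have key := residual_add (η := η) hA x (fun i => C (t i)) (K + 1) (by omega) κ 0
    hx.lead2 hx.lead3
  refine ⟨fun i => x i + X ^ (K + 1) * C (t i), ⟨?_, ?_, ?_, ?_⟩, fun i => ⟨C (t i), by ring⟩⟩
  · simp only [map_add, coeff_X_pow_mul']
    rw [if_neg (by omega), hx.lead2, add_zero]
  · simp only [map_add, coeff_X_pow_mul']
    rw [if_neg (by omega), hx.lead3, add_zero]
  · intro k hk i
    rcases Nat.lt_or_eq_of_le hk with hk | rfl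
    · rw [(key i).1 k hk]
      exact hx.solves k (by omega) i
    · rw [(key i).2.1, coeff_zero_C, hDt, add_neg_cancel]
  · intro i
    rw [(key i).2.2, map_sub, map_add, Trig.mean_D, mean_linPart]
    simp only [coeff_zero_C, hmt, hm]
    ring

/-- A solution of the equation up to the resonant first order extends to all orders. -/
theorem SolvesTo.exists_solution {η κ : ℂ} (h : η * κ ^ 2 = -2)
    {A : (Fin 4 → Trig⟦X⟧) → Fin 4 → Trig⟦X⟧} (hA : Causal A)
    {x : Fin 4 → Trig⟦X⟧} (hx : SolvesTo η κ A 1 x) :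
    ∃ x', (∀ i, residual η A x' i = 0) ∧ ∀ i, X ^ 2 ∣ x' i - x i := by
  have hstep : ∀ (n : ℕ) (z : {z // SolvesTo η κ A (n + 1) z}),
      ∃ z' : {z // SolvesTo η κ A (n + 1 + 1) z}, ∀ i, X ^ (n + 2) ∣ z'.1 i - z.1 i := by
    intro n z
    obtain ⟨z', h1, h2⟩ := z.2.step h hA (by omega)
    exact ⟨⟨z', h1⟩, h2⟩
  choose next hnext using hstep
  let seq : ∀ n, {z // SolvesTo η κ A (n + 1) z} := fun n =>
    Nat.rec (motive := fun n => {z // SolvesTo η κ A (n + 1) z}) ⟨x, hx⟩ (fun n z => next n z) n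
  have hseq : ∀ n i, X ^ (n + 2) ∣ (seq (n + 1)).1 i - (seq n).1 i := fun n i =>
    hnext n (seq n) i
  have hstab : ∀ k n i, k ≤ n + 1 → ∀ m, n ≤ m →
      coeff k ((seq m).1 i) = coeff k ((seq n).1 i) := by
    intro k n i hk m hm
    induction m, hm using Nat.le_induction with
    | base => rfl
    | succ m hm ih =>
      rw [← ih, ← sub_eq_zero, ← map_sub]
      exact X_pow_dvd_iff.1 (hseq m i) k (by omega)
  let y : Fin 4 → Trig⟦X⟧ := fun i => PowerSeries.mk fun k => coeff k ((seq k).1 i)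
  have hy : ∀ n i, X ^ (n + 2) ∣ y i - (seq n).1 i := by
    intro n i
    rw [X_pow_dvd_iff]
    intro k hk
    simp only [y, map_sub, coeff_mk]
    rw [sub_eq_zero]
    rcases le_total k n with hkn | hkn
    · exact (hstab k k i (by omega) n hkn).symm
    · exact hstab k n i (by omega) k hkn
  refine ⟨y, fun i => ?_, fun i => hy 0 i⟩
  ext1 n
  choose z hz using fun i => hy n i
  have hyz : y = fun i => (seq n).1 i + X ^ (n + 2) * z i := by
    funext i
    rw [← hz]
    ring
  rw [hyz, (residual_add hA _ z (n + 2) (by omega) κ 0 (seq n).2.lead2 (seq n).2.lead3 i).1 n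
    (by omega), (seq n).2.solves n (by omega) i, map_zero]

/-! ### Uniqueness of solutions -/

/-- The kernel of `linPart` is trivial, apart from the radial direction for `K = 1`. -/
theorem linPart_eq_zero {η c d : ℂ} (h : η * (c ^ 2 + d ^ 2) = -2) (K : ℕ) (hK : 1 ≤ K)
    (m : Fin 4 → ℂ) (hm : ∀ i, linPart η c d K m i = 0)
    (hr : K = 1 → c * m 2 + d * m 3 = 0) (i : Fin 4) : m i = 0 := by
  have e0 := hm 0
  have e1 := hm 1
  have e2 := hm 2
  have e3 := hm 3
  simp only [linPart, Matrix.cons_val, smul_eq_mul] at e0 e1 e2 e3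
  have hrad : ((K : ℂ) - 1) * (K + 4) * (c * m 2 + d * m 3) = 0 := by
    linear_combination c * e0 + d * e1 + (K + 2) * (c * e2 + d * e3)
      - 3 * (c * m 2 + d * m 3) * h
  have htan : (K : ℂ) * (K + 3) * (c * m 3 - d * m 2) = 0 := by
    linear_combination c * e1 - d * e0 + (K + 2) * (c * e3 - d * e2)
      - (c * m 3 - d * m 2) * h
  have hK0 : (K : ℂ) ≠ 0 := Nat.cast_ne_zero.2 (by omega)
  have hK3 : (K : ℂ) + 3 ≠ 0 := by exact_mod_cast (by omega : K + 3 ≠ 0)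
  have hK4 : (K : ℂ) + 4 ≠ 0 := by exact_mod_cast (by omega : K + 4 ≠ 0)
  have ht : c * m 3 - d * m 2 = 0 :=
    (mul_eq_zero.1 htan).resolve_left (mul_ne_zero hK0 hK3)
  have hrr : c * m 2 + d * m 3 = 0 := by
    rcases eq_or_ne K 1 with hK1 | hK1
    · exact hr hK1
    · have : (K : ℂ) - 1 ≠ 0 := by
        rw [sub_ne_zero]
        exact_mod_cast hK1
      exact (mul_eq_zero.1 hrad).resolve_left (mul_ne_zero this hK4)
  have hm2 : m 2 = 0 := by
    linear_combination (-1 / 2 : ℂ) * m 2 * (-h) - η / 2 * (c * hrr - d * ht)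
  have hm3 : m 3 = 0 := by
    linear_combination (-1 / 2 : ℂ) * m 3 * (-h) - η / 2 * (d * hrr + c * ht)
  have hm0 : m 0 = 0 := by linear_combination (K + 1) * hm2 - e2
  have hm1 : m 1 = 0 := by linear_combination (K + 1) * hm3 - e3
  fin_cases i <;> assumption

/-- If two solutions agree below order `K ≥ 1`, their difference at order `K` is constant and lies
in the kernel of `linPart`. -/
theorem linPart_mean_of_dvd {η : ℂ} {A : (Fin 4 → Trig⟦X⟧) → Fin 4 → Trig⟦X⟧} (hA : Causal A)
    {x y : Fin 4 → Trig⟦X⟧} (hx : ∀ i, residual η A x i = 0)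
    {K : ℕ} (hK : 1 ≤ K) {c d : ℂ}
    (hc : coeff 0 (x 2) = algebraMap ℂ Trig c) (hd : coeff 0 (x 3) = algebraMap ℂ Trig d)
    (hy : ∀ i, residual η A (fun j => x j + X ^ K * y j) i = 0) :
    (∀ i, coeff 0 (y i) = algebraMap ℂ Trig (Trig.mean (coeff 0 (y i)))) ∧
      ∀ i, linPart η c d K (fun j => Trig.mean (coeff 0 (y j))) i = 0 := by
  have key := residual_add (η := η) hA x y K hK c d hc hd
  constructor
  · intro i
    have := (key i).2.1
    rw [hx, hy, map_zero, zero_add] at this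
    exact Trig.eq_algebraMap_mean_of_D_eq_zero _ this.symm
  · intro i
    have := congrArg Trig.mean (key i).2.2
    rw [hx, hy, map_zero, zero_add, map_zero, map_sub, Trig.mean_D, mean_linPart, zero_sub,
      eq_comm, neg_eq_zero] at this
    exact this

theorem eq_of_forall_X_pow_dvd {f g : Trig⟦X⟧} (h : ∀ K, 1 ≤ K → X ^ K ∣ f - g) : f = g := by
  rw [← sub_eq_zero]
  ext1 n
  rw [map_zero]
  exact X_pow_dvd_iff.1 (h (n + 1) (by omega)) n (by omega)

/-- A solution is determined by its leading coefficients and the radial mean of the next ones. -/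
theorem residual_unique {η : ℂ} {A : (Fin 4 → Trig⟦X⟧) → Fin 4 → Trig⟦X⟧} (hA : Causal A)
    {x x' : Fin 4 → Trig⟦X⟧} (hx : ∀ i, residual η A x i = 0)
    (hx' : ∀ i, residual η A x' i = 0) {c d : ℂ} (h : η * (c ^ 2 + d ^ 2) = -2)
    (hc : coeff 0 (x 2) = algebraMap ℂ Trig c) (hd : coeff 0 (x 3) = algebraMap ℂ Trig d)
    (h0 : ∀ i, coeff 0 (x' i) = coeff 0 (x i))
    (h1 : c * Trig.mean (coeff 1 (x' 2)) + d * Trig.mean (coeff 1 (x' 3))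
      = c * Trig.mean (coeff 1 (x 2)) + d * Trig.mean (coeff 1 (x 3))) : x' = x := by
  have hall : ∀ K, 1 ≤ K → ∀ i, X ^ K ∣ x' i - x i := by
    intro K hK
    induction K, hK using Nat.le_induction with
    | base =>
      intro i
      rw [X_pow_dvd_iff]
      intro m hm
      obtain rfl : m = 0 := by omega
      rw [map_sub, h0, sub_self]
    | succ K hK ih =>
      choose y hy using ih
      have hxy : x' = fun j => x j + X ^ K * y j := by
        funext j
        rw [← hy]
        ring
      rw [hxy] at hx'
      obtain ⟨k1, k2⟩ := linPart_mean_of_dvd hA hx hK hc hd hx'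
      have hz := linPart_eq_zero h K hK _ k2 (by
        rintro rfl
        have e : ∀ j, coeff 1 (x' j) = coeff 1 (x j) + coeff 0 (y j) := by
          intro j
          rw [hxy]
          simp only [map_add, coeff_X_pow_mul', le_refl, if_true, Nat.sub_self]
        rw [e, e, map_add, map_add] at h1
        linear_combination h1)
      intro i
      rw [hy i, pow_succ]
      refine mul_dvd_mul_left _ (X_dvd_iff.2 ?_)
      rw [← coeff_zero_eq_constantCoeff_apply, k1 i, hz i, map_zero]
  funext i
  exact eq_of_forall_X_pow_dvd fun K hK => hall K hK i

/-- The leading coefficients of a non-zero solution are constants with `c² + d² = -2 / η`; the other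
root `c = d = 0` of the equation of lowest order only leads to the zero solution. -/
theorem residual_leading {η : ℂ} {A : (Fin 4 → Trig⟦X⟧) → Fin 4 → Trig⟦X⟧}
    (hA : Causal A) (hA0 : ∀ i, A 0 i = 0)
    {x : Fin 4 → Trig⟦X⟧} (hx : ∀ i, residual η A x i = 0) (hne : x ≠ 0) :
    ∃ c d : ℂ, η * (c ^ 2 + d ^ 2) = -2 ∧
      coeff 0 (x 0) = algebraMap ℂ Trig c ∧ coeff 0 (x 1) = algebraMap ℂ Trig d ∧
      coeff 0 (x 2) = algebraMap ℂ Trig c ∧ coeff 0 (x 3) = algebraMap ℂ Trig d := by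
  have hA2 : ∀ i, ∃ S, A x i = X ^ 2 * S := by
    intro i
    obtain ⟨S, hS⟩ := hA 0 x 0 (fun i => by simp) i
    exact ⟨S, by rw [← sub_zero (A x i), ← hA0 i, hS]⟩
  have hAc0 : ∀ i, constantCoeff (A x i) = 0 := by
    intro i
    obtain ⟨S, hS⟩ := hA2 i
    rw [← coeff_zero_eq_constantCoeff_apply, hS, coeff_X_pow_mul', if_neg (by omega)]
  have hAc1 : ∀ i, coeff 1 (A x i) = 0 := by
    intro i
    obtain ⟨S, hS⟩ := hA2 i
    rw [hS, coeff_X_pow_mul', if_neg (by omega)]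
  have hD : ∀ i, Trig.D (coeff 0 (x i)) = 0 := by
    intro i
    have := congrArg (coeff 0) (hx i)
    fin_cases i <;> simpa [residual, hAc0, mul_assoc, constantCoeff_dT] using this
  have hm := fun i => Trig.eq_algebraMap_mean_of_D_eq_zero _ (hD i)
  set a := Trig.mean (coeff 0 (x 0))
  set b := Trig.mean (coeff 0 (x 1))
  set c := Trig.mean (coeff 0 (x 2)) with hc
  set d := Trig.mean (coeff 0 (x 3)) with hd
  have l0 : constantCoeff (x 0) = algebraMap ℂ Trig a := by
    rw [← coeff_zero_eq_constantCoeff_apply]; exact hm 0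
  have l1 : constantCoeff (x 1) = algebraMap ℂ Trig b := by
    rw [← coeff_zero_eq_constantCoeff_apply]; exact hm 1
  have l2 : constantCoeff (x 2) = algebraMap ℂ Trig c := by
    rw [← coeff_zero_eq_constantCoeff_apply]; exact hm 2
  have l3 : constantCoeff (x 3) = algebraMap ℂ Trig d := by
    rw [← coeff_zero_eq_constantCoeff_apply]; exact hm 3
  have hX : ∀ f : Trig⟦X⟧, coeff 1 (X * f) = constantCoeff f := fun f => by
    rw [← zero_add 1, coeff_succ_X_mul, coeff_zero_eq_constantCoeff_apply]
  have hmean : ∀ (f : Trig⟦X⟧) (r : ℂ), constantCoeff f = algebraMap ℂ Trig r →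
      Trig.mean (constantCoeff f) = r := fun f r hf => by rw [hf, Trig.mean_algebraMap]
  have s2 : constantCoeff (2 : Trig⟦X⟧) = algebraMap ℂ Trig 2 := by
    rw [map_ofNat, map_ofNat]
  have e0 : 2 * a + η * ((c ^ 2 + d ^ 2) * c) = 0 := by
    have := congrArg (fun f => Trig.mean (coeff 1 f)) (hx 0)
    simp only [residual, Matrix.cons_val, map_sub, hAc1, coeff_dT, Trig.mean_D, mul_assoc X, hX,
      map_zero] at this
    rw [hmean _ (2 * a) (by simp [l0, s2]),
      hmean _ (η * ((c ^ 2 + d ^ 2) * c)) (by simp [l2, l3])] at this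
    linear_combination -this
  have e1 : 2 * b + η * ((c ^ 2 + d ^ 2) * d) = 0 := by
    have := congrArg (fun f => Trig.mean (coeff 1 f)) (hx 1)
    simp only [residual, Matrix.cons_val, map_sub, hAc1, coeff_dT, Trig.mean_D, mul_assoc X, hX,
      map_zero] at this
    rw [hmean _ (2 * b) (by simp [l1, s2]),
      hmean _ (η * ((c ^ 2 + d ^ 2) * d)) (by simp [l2, l3])] at this
    linear_combination -this
  have e2 : c = a := by
    have := congrArg (fun f => Trig.mean (coeff 1 f)) (hx 2)
    simp only [residual, Matrix.cons_val, map_sub, hAc1, coeff_dT, Trig.mean_D, hX,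
      map_add, map_mul, l0, l2, constantCoeff_X,
      zero_mul, add_zero, map_zero, Trig.mean_algebraMap] at this
    linear_combination -this
  have e3 : d = b := by
    have := congrArg (fun f => Trig.mean (coeff 1 f)) (hx 3)
    simp only [residual, Matrix.cons_val, map_sub, hAc1, coeff_dT, Trig.mean_D, hX,
      map_add, map_mul, l1, l3, constantCoeff_X,
      zero_mul, add_zero, map_zero, Trig.mean_algebraMap] at this
    linear_combination -this
  by_cases h : η * (c ^ 2 + d ^ 2) = -2
  · refine ⟨c, d, h, ?_, ?_, hm 2, hm 3⟩
    · rw [e2]; exact hm 0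
    · rw [e3]; exact hm 1
  -- With vanishing leading coefficients `linPart` is invertible at every order, so that `x = 0`.
  · exfalso
    apply hne
    have h' : η * (c ^ 2 + d ^ 2) + 2 ≠ 0 := fun h0 => h (by linear_combination h0)
    have hc0 : c = 0 := (mul_eq_zero.1 (show (η * (c ^ 2 + d ^ 2) + 2) * c = 0 by
      linear_combination e0 + 2 * e2)).resolve_left h'
    have hd0 : d = 0 := (mul_eq_zero.1 (show (η * (c ^ 2 + d ^ 2) + 2) * d = 0 by
      linear_combination e1 + 2 * e3)).resolve_left h'
    have hlead : ∀ i, coeff 0 (x i) = 0 := by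
      intro i
      rw [hm i]
      have : Trig.mean (coeff 0 (x i)) = 0 := by
        fin_cases i
        · exact e2.symm.trans hc0
        · exact e3.symm.trans hd0
        · exact hc0
        · exact hd0
      rw [this, map_zero]
    have h00 : ∀ i, residual η A 0 i = 0 := by
      intro i
      have hdT : dT 0 = 0 := by
        ext1 n
        simp
      fin_cases i <;> simp [residual, hA0, hdT]
    have hall : ∀ K, 1 ≤ K → ∀ i, X ^ K ∣ x i - (0 : Fin 4 → Trig⟦X⟧) i := by
      intro K hK
      induction K, hK using Nat.le_induction with
      | base =>
        intro i
        rw [X_pow_dvd_iff]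
        intro m hm
        obtain rfl : m = 0 := by omega
        rw [map_sub, hlead]
        simp
      | succ K hK ih =>
        choose y hy using ih
        have hxy : x = fun j => (0 : Fin 4 → Trig⟦X⟧) j + X ^ K * y j := by
          funext j
          rw [← hy]
          ring
        rw [hxy] at hx
        obtain ⟨k1, k2⟩ := linPart_mean_of_dvd (c := 0) (d := 0) hA h00 hK
          (by simp) (by simp) hx
        have hz : ∀ i, Trig.mean (coeff 0 (y i)) = 0 := by
          have f0 := k2 0
          have f1 := k2 1
          have f2 := k2 2
          have f3 := k2 3
          simp only [linPart, Matrix.cons_val, smul_eq_mul] at f0 f1 f2 f3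
          have hK2 : (K : ℂ) + 2 ≠ 0 := by exact_mod_cast (by omega : K + 2 ≠ 0)
          have hK1 : (K : ℂ) + 1 ≠ 0 := by exact_mod_cast (by omega : K + 1 ≠ 0)
          have z0 : Trig.mean (coeff 0 (y 0)) = 0 :=
            (mul_eq_zero.1 (by linear_combination f0 : ((K : ℂ) + 2) * _ = 0)).resolve_left hK2
          have z1 : Trig.mean (coeff 0 (y 1)) = 0 :=
            (mul_eq_zero.1 (by linear_combination f1 : ((K : ℂ) + 2) * _ = 0)).resolve_left hK2
          have z2 : Trig.mean (coeff 0 (y 2)) = 0 :=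
            (mul_eq_zero.1 (by linear_combination f2 + z0 :
              ((K : ℂ) + 1) * _ = 0)).resolve_left hK1
          have z3 : Trig.mean (coeff 0 (y 3)) = 0 :=
            (mul_eq_zero.1 (by linear_combination f3 + z1 :
              ((K : ℂ) + 1) * _ = 0)).resolve_left hK1
          intro i
          fin_cases i <;> assumption
        intro i
        rw [hy i, pow_succ]
        refine mul_dvd_mul_left _ (X_dvd_iff.2 ?_)
        rw [← coeff_zero_eq_constantCoeff_apply, k1 i, hz i, map_zero]
    funext i
    exact eq_of_forall_X_pow_dvd fun K hK => hall K hK i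

/-! ### Substitution and the weights -/

/-- The weighted degree of a monomial. -/
def wdeg (m : Fin 4 →₀ ℕ) : ℕ := ∑ i, wt i * m i

/-- All monomials of `h` have weighted degree at least `w`. -/
def WeightGE (w : ℕ) (h : MvPowerSeries (Fin 4) ℂ) : Prop :=
  ∀ m, MvPowerSeries.coeff m h ≠ 0 → w ≤ wdeg m

theorem wt_pos (i : Fin 4) : 0 < wt i := by
  fin_cases i <;> simp [wt]

section General

variable {S : Type*} [CommRing S]

/-- The vector `(s² g₀, s² g₁, s g₂, s g₃)` over any coefficient ring. -/
def weighted (g : Fin 4 → S⟦X⟧) : Fin 4 → S⟦X⟧ := fun i => X ^ wt i * g i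

theorem hasSubst_weighted (g : Fin 4 → S⟦X⟧) : MvPowerSeries.HasSubst (weighted g) := by
  apply MvPowerSeries.hasSubst_of_constantCoeff_zero
  intro i
  change PowerSeries.constantCoeff (weighted g i) = 0
  simp [weighted, (wt_pos i).ne']

variable [Algebra ℂ S]

theorem coeff_subst_weighted (g : Fin 4 → S⟦X⟧) (h : MvPowerSeries (Fin 4) ℂ) (n : ℕ) :
    coeff n (MvPowerSeries.subst (weighted g) h : S⟦X⟧) =
      ∑ᶠ m, MvPowerSeries.coeff m h • coeff n (X ^ wdeg m * ∏ i, g i ^ m i) := by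
  refine (MvPowerSeries.coeff_subst (hasSubst_weighted g) h _).trans ?_
  refine finsum_congr fun m => ?_
  congr 2
  rw [Finsupp.prod_fintype _ _ (fun i => pow_zero _)]
  simp only [weighted, mul_pow, ← pow_mul, Finset.prod_mul_distrib, Finset.prod_pow_eq_pow_sum,
    wdeg]

/-- Substitution in a series of weight at least `w` delays the dependence on the unknowns by `w`. -/
theorem X_pow_dvd_subst_sub {w K : ℕ} {h : MvPowerSeries (Fin 4) ℂ} (hh : WeightGE w h)
    {g g' : Fin 4 → S⟦X⟧} (hg : ∀ i, X ^ K ∣ g' i - g i) :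
    (X ^ (w + K) : S⟦X⟧) ∣
      (MvPowerSeries.subst (weighted g') h : S⟦X⟧) - MvPowerSeries.subst (weighted g) h := by
  rw [X_pow_dvd_iff]
  intro n hn
  rw [map_sub, sub_eq_zero, coeff_subst_weighted, coeff_subst_weighted]
  refine finsum_congr fun m => ?_
  rcases eq_or_ne (MvPowerSeries.coeff m h) 0 with h0 | h0
  · rw [h0, zero_smul, zero_smul]
  · congr 1
    rw [← sub_eq_zero, ← map_sub, ← mul_sub]
    have hd : (X ^ K : S⟦X⟧) ∣ ∏ i, g' i ^ m i - ∏ i, g i ^ m i := by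
      rw [← Ideal.mem_span_singleton, ← Ideal.Quotient.eq, map_prod, map_prod]
      refine Finset.prod_congr rfl fun i _ => ?_
      rw [map_pow, map_pow]
      congr 1
      rw [Ideal.Quotient.eq, Ideal.mem_span_singleton]
      exact hg i
    have := mul_dvd_mul_left (X ^ wdeg m : S⟦X⟧) hd
    rw [← pow_add] at this
    exact X_pow_dvd_iff.1 this n (lt_of_lt_of_le hn (Nat.add_le_add_right (hh m h0) K))

theorem X_pow_dvd_subst {w : ℕ} {h : MvPowerSeries (Fin 4) ℂ} (hh : WeightGE w h)
    (g : Fin 4 → S⟦X⟧) :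
    (X ^ w : S⟦X⟧) ∣ (MvPowerSeries.subst (weighted g) h : S⟦X⟧) := by
  rw [X_pow_dvd_iff]
  intro n hn
  rw [coeff_subst_weighted]
  refine finsum_eq_zero_of_forall_eq_zero fun m => ?_
  rcases eq_or_ne (MvPowerSeries.coeff m h) 0 with h0 | h0
  · rw [h0, zero_smul]
  · rw [coeff_X_pow_mul', if_neg (by have := hh m h0; omega), smul_zero]

/-- Substitution commutes with homomorphisms of the coefficient algebras. -/
theorem map_subst_algHom {S' : Type*} [CommRing S'] [Algebra ℂ S'] (ι : S →ₐ[ℂ] S')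
    {a : Fin 4 → S⟦X⟧} (ha : MvPowerSeries.HasSubst a) (h : MvPowerSeries (Fin 4) ℂ) :
    PowerSeries.map (ι : S →+* S') (MvPowerSeries.subst a h : S⟦X⟧)
      = MvPowerSeries.subst (fun i => PowerSeries.map (ι : S →+* S') (a i)) h := by
  change MvPowerSeries.map (ι : S →+* S') (MvPowerSeries.subst a h) = MvPowerSeries.subst
    (fun i => MvPowerSeries.map (ι : S →+* S') (a i)) h
  refine MvPowerSeries.ext fun n => ?_
  have hι : ∀ r : S, (ι : S →+* S') r = (ι : S →+* S').toAddMonoidHom r := fun _ => rfl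
  have hb : MvPowerSeries.HasSubst fun i => MvPowerSeries.map (ι : S →+* S') (a i) := ha.map _
  refine Eq.trans ?_ (MvPowerSeries.coeff_subst hb h n).symm
  rw [MvPowerSeries.coeff_map, MvPowerSeries.coeff_subst ha, hι,
    AddMonoidHom.map_finsum _ (MvPowerSeries.coeff_subst_finite ha _ _)]
  refine finsum_congr fun d => ?_
  rw [← hι, Algebra.smul_def, map_mul, Algebra.smul_def]
  congr 1
  · exact ι.commutes _
  · rw [← MvPowerSeries.coeff_map]
    simp only [Finsupp.prod, map_prod, map_pow]

end General

theorem WeightGE.pderiv {w : ℕ} {h : MvPowerSeries (Fin 4) ℂ} (hh : WeightGE w h) (i : Fin 4) :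
    WeightGE (w - wt i) (MvPowerSeries.pderiv ℂ i h) := by
  intro m hm
  rw [MvPowerSeries.coeff_pderiv] at hm
  have h1 := hh _ (left_ne_zero_of_mul hm)
  have h2 : wdeg (m + Finsupp.single i 1) = wdeg m + wt i := by
    simp only [wdeg, Finsupp.add_apply, mul_add, Finset.sum_add_distrib]
    congr 1
    rw [Finset.sum_eq_single i]
    · simp
    · intro j _ hj
      simp [hj.symm]
    · simp
  omega

theorem WeightGE.neg {w : ℕ} {h : MvPowerSeries (Fin 4) ℂ} (hh : WeightGE w h) :
    WeightGE w (-h) := by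
  intro m hm
  rw [map_neg] at hm
  exact hh m (neg_ne_zero.1 hm)

theorem WeightGE.hamVectorField {f : MvPowerSeries (Fin 4) ℂ} (hf : WeightGE 5 f) (i : Fin 4) :
    WeightGE (wt i + 2) (hamVectorField f i) := by
  fin_cases i
  · exact hf.pderiv 2
  · exact hf.pderiv 3
  · exact (hf.pderiv 0).neg
  · exact (hf.pderiv 1).neg

/-! ### The contribution of the perturbation -/

/-- The `i`-th component of the vector field of `f` along the weighted vector `g`, divided by
`s ^ wt i`. -/
def force (f : MvPowerSeries (Fin 4) ℂ) (g : Fin 4 → Trig⟦X⟧) (i : Fin 4) : Trig⟦X⟧ :=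
  PowerSeries.mk fun n =>
    coeff (n + wt i) (MvPowerSeries.subst (weighted g) (hamVectorField f i) : Trig⟦X⟧)

theorem X_pow_mul_force {f : MvPowerSeries (Fin 4) ℂ} (hf : WeightGE 5 f)
    (g : Fin 4 → Trig⟦X⟧) (i : Fin 4) :
    X ^ wt i * force f g i = MvPowerSeries.subst (weighted g) (hamVectorField f i) := by
  ext1 n
  rw [coeff_X_pow_mul']
  split_ifs with hn
  · rw [force, coeff_mk, Nat.sub_add_cancel hn]
  · exact (X_pow_dvd_iff.1 (X_pow_dvd_subst (hf.hamVectorField i) g) n (by omega)).symm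

theorem X_pow_dvd_force_sub {f : MvPowerSeries (Fin 4) ℂ} (hf : WeightGE 5 f)
    {g g' : Fin 4 → Trig⟦X⟧} {K : ℕ} (hg : ∀ i, X ^ K ∣ g' i - g i) (i : Fin 4) :
    X ^ (K + 2) ∣ force f g' i - force f g i := by
  rw [X_pow_dvd_iff]
  intro n hn
  have := X_pow_dvd_iff.1 (X_pow_dvd_subst_sub (hf.hamVectorField i) hg) (n + wt i) (by omega)
  rw [map_sub] at this ⊢
  rw [force, force, coeff_mk, coeff_mk]
  exact this

/-! ### The rotating frame -/

/-- The trigonometric polynomial `cos φ`. -/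
def cosT : Trig := ⟨fun φ => Complex.cos φ, by simpa using cos_mem_trig 1⟩

/-- The trigonometric polynomial `sin φ`. -/
def sinT : Trig := ⟨fun φ => Complex.sin φ, by simpa using sin_mem_trig 1⟩

theorem D_cosT : Trig.D cosT = -sinT := by
  apply Subtype.ext
  funext φ
  exact congrFun Complex.deriv_cos' φ

theorem D_sinT : Trig.D sinT = cosT := by
  apply Subtype.ext
  funext φ
  exact congrFun Complex.deriv_sin φ

theorem cosT_sq_add_sinT_sq : cosT ^ 2 + sinT ^ 2 = 1 := by
  apply Subtype.ext
  funext φ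
  exact Complex.cos_sq_add_sin_sq φ

/-- The vector with components `x 0, x 1` and `x 2, x 3` along `(cos φ, sin φ)` and
`(-sin φ, cos φ)`. -/
def rot (x : Fin 4 → Trig⟦X⟧) : Fin 4 → Trig⟦X⟧ :=
  ![C cosT * x 0 - C sinT * x 1, C sinT * x 0 + C cosT * x 1,
    C cosT * x 2 - C sinT * x 3, C sinT * x 2 + C cosT * x 3]

/-- The inverse of `rot`. -/
def unrot (g : Fin 4 → Trig⟦X⟧) : Fin 4 → Trig⟦X⟧ :=
  ![C cosT * g 0 + C sinT * g 1, -(C sinT * g 0) + C cosT * g 1,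
    C cosT * g 2 + C sinT * g 3, -(C sinT * g 2) + C cosT * g 3]

theorem C_cosT_sq : (C cosT : Trig⟦X⟧) ^ 2 = 1 - C sinT ^ 2 := by
  rw [eq_sub_iff_add_eq, ← map_pow, ← map_pow, ← map_add, cosT_sq_add_sinT_sq, map_one]

theorem unrot_rot (x : Fin 4 → Trig⟦X⟧) : unrot (rot x) = x := by
  funext i
  fin_cases i <;> simp only [unrot, rot, Fin.zero_eta, Fin.mk_one, Fin.reduceFinMk, Matrix.cons_val]
  · linear_combination x 0 * C_cosT_sq
  · linear_combination x 1 * C_cosT_sq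
  · linear_combination x 2 * C_cosT_sq
  · linear_combination x 3 * C_cosT_sq

theorem rot_unrot (x : Fin 4 → Trig⟦X⟧) : rot (unrot x) = x := by
  funext i
  fin_cases i <;> simp only [unrot, rot, Fin.zero_eta, Fin.mk_one, Fin.reduceFinMk, Matrix.cons_val]
  · linear_combination x 0 * C_cosT_sq
  · linear_combination x 1 * C_cosT_sq
  · linear_combination x 2 * C_cosT_sq
  · linear_combination x 3 * C_cosT_sq

theorem dvd_rot_sub {a : Trig⟦X⟧} {x y : Fin 4 → Trig⟦X⟧} (h : ∀ i, a ∣ y i - x i) (i : Fin 4) :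
    a ∣ rot y i - rot x i := by
  choose z hz using h
  have : ∀ i, y i = x i + a * z i := fun i => by rw [← hz]; ring
  refine ⟨rot z i, ?_⟩
  fin_cases i <;>
    simp only [rot, Fin.zero_eta, Fin.mk_one, Fin.reduceFinMk, Matrix.cons_val, this] <;> ring

theorem dvd_unrot_sub {a : Trig⟦X⟧} {x y : Fin 4 → Trig⟦X⟧} (h : ∀ i, a ∣ y i - x i)
    (i : Fin 4) : a ∣ unrot y i - unrot x i := by
  choose z hz using h
  have : ∀ i, y i = x i + a * z i := fun i => by rw [← hz]; ring
  refine ⟨unrot z i, ?_⟩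
  fin_cases i <;>
    simp only [unrot, Fin.zero_eta, Fin.mk_one, Fin.reduceFinMk, Matrix.cons_val, this] <;> ring

/-- The contribution of the perturbation in the rotating frame. -/
def rotForce (f : MvPowerSeries (Fin 4) ℂ) (x : Fin 4 → Trig⟦X⟧) : Fin 4 → Trig⟦X⟧ :=
  unrot (force f (rot x))

theorem causal_rotForce {f : MvPowerSeries (Fin 4) ℂ} (hf : WeightGE 5 f) :
    Causal (rotForce f) := fun _ _ _ h i =>
  dvd_unrot_sub (fun j => X_pow_dvd_force_sub hf (dvd_rot_sub h) j) i

theorem rotForce_zero {f : MvPowerSeries (Fin 4) ℂ} (hf : WeightGE 5 f) (i : Fin 4) :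
    rotForce f 0 i = 0 := by
  have hr : rot 0 = 0 := by
    funext i
    fin_cases i <;> simp [rot]
  have hF : ∀ i, force f 0 i = 0 := by
    intro i
    ext1 n
    rw [force, coeff_mk, coeff_subst_weighted, map_zero]
    refine finsum_eq_zero_of_forall_eq_zero fun m => ?_
    rcases eq_or_ne (MvPowerSeries.coeff m (hamVectorField f i)) 0 with h0 | h0
    · rw [h0, zero_smul]
    · have hw := hf.hamVectorField i m h0
      have : ∃ j, m j ≠ 0 := by
        by_contra! hc
        simp [wdeg, hc] at hw
      obtain ⟨j, hj⟩ := this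
      rw [Finset.prod_eq_zero (Finset.mem_univ j) (by simp [hj])]
      simp
  unfold rotForce
  rw [hr]
  fin_cases i <;> simp [unrot, hF]

theorem dT_C_mul (t : Trig) (g : Trig⟦X⟧) : dT (C t * g) = C (Trig.D t) * g + C t * dT g := by
  ext1 n
  simp [Trig.D_mul]

theorem dT_sub (f g : Trig⟦X⟧) : dT (f - g) = dT f - dT g := by
  ext1 n
  simp

/-- The equation in the fixed frame, for the rescaled unknowns. -/
def fixedResidual (η : ℂ) (f : MvPowerSeries (Fin 4) ℂ) (g : Fin 4 → Trig⟦X⟧) :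
    Fin 4 → Trig⟦X⟧ :=
  ![dT (g 0) + g 1 - X * (2 * g 0 + X * derivative Trig (g 0))
      - X * cst η * ((g 2 ^ 2 + g 3 ^ 2) * g 2) - force f g 0,
    dT (g 1) - g 0 - X * (2 * g 1 + X * derivative Trig (g 1))
      - X * cst η * ((g 2 ^ 2 + g 3 ^ 2) * g 3) - force f g 1,
    dT (g 2) + g 3 - X * (g 2 + X * derivative Trig (g 2)) + X * g 0 - force f g 2,
    dT (g 3) - g 2 - X * (g 3 + X * derivative Trig (g 3)) + X * g 1 - force f g 3]

theorem derivative_C_mul (t : Trig) (g : Trig⟦X⟧) :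
    derivative Trig (C t * g) = C t * derivative Trig g := by
  rw [Derivation.leibniz, derivative_C, smul_zero, add_zero, smul_eq_mul]

/-- The rotation turns the equation in the rotating frame into the one in the fixed frame. -/
theorem fixedResidual_rot (η : ℂ) (f : MvPowerSeries (Fin 4) ℂ) (x : Fin 4 → Trig⟦X⟧) :
    fixedResidual η f (rot x) = rot (residual η (rotForce f) x) := by
  have hsq : rot x 2 ^ 2 + rot x 3 ^ 2 = x 2 ^ 2 + x 3 ^ 2 := by
    simp only [rot, Matrix.cons_val]
    linear_combination (x 2 ^ 2 + x 3 ^ 2) * C_cosT_sq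
  have hF : rot (rotForce f x) = force f (rot x) := rot_unrot _
  have hF0 := congrFun hF 0
  have hF1 := congrFun hF 1
  have hF2 := congrFun hF 2
  have hF3 := congrFun hF 3
  have e0 : rot x 0 = C cosT * x 0 - C sinT * x 1 := rfl
  have e1 : rot x 1 = C sinT * x 0 + C cosT * x 1 := rfl
  have e2 : rot x 2 = C cosT * x 2 - C sinT * x 3 := rfl
  have e3 : rot x 3 = C sinT * x 2 + C cosT * x 3 := rfl
  funext i
  fin_cases i <;>
    simp only [fixedResidual, Fin.zero_eta, Fin.mk_one, Fin.reduceFinMk, Matrix.cons_val, hsq] <;>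
    simp only [e0, e1, e2, e3, ← hF0, ← hF1, ← hF2, ← hF3, dT_add, dT_sub, dT_C_mul, D_cosT,
      D_sinT, map_add, map_sub, map_neg, derivative_C_mul] <;>
    simp only [rot, residual, Matrix.cons_val] <;> ring

/-! ### The equation for formal series of functions -/

/-- A formal series with trigonometric coefficients, as a formal series of functions. -/
def toFuns (g : Trig⟦X⟧) : PowerSeries (ℂ → ℂ) := PowerSeries.map (Trig.val : Trig →+* (ℂ → ℂ)) g

theorem coeff_toFuns (n : ℕ) (g : Trig⟦X⟧) : coeff n (toFuns g) = (coeff n g : Trig).1 := by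
  simp [toFuns]

theorem toFuns_injective : Function.Injective toFuns := by
  intro f g h
  ext1 n
  apply Subtype.ext
  rw [← coeff_toFuns, h, coeff_toFuns]

theorem dPhi_toFuns (g : Trig⟦X⟧) : dPhi (toFuns g) = toFuns (dT g) := by
  ext1 n
  rw [dPhi, coeff_mk, coeff_toFuns, coeff_toFuns, coeff_dT, Trig.coe_D]

theorem derivative_toFuns (g : Trig⟦X⟧) :
    derivative (ℂ → ℂ) (toFuns g) = toFuns (derivative Trig g) := by
  ext1 n
  rw [coeff_derivative, coeff_toFuns, coeff_toFuns, coeff_derivative]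
  rfl

theorem toFuns_mul (f g : Trig⟦X⟧) : toFuns (f * g) = toFuns f * toFuns g := map_mul _ _ _

theorem toFuns_add (f g : Trig⟦X⟧) : toFuns (f + g) = toFuns f + toFuns g := map_add _ _ _

theorem toFuns_neg (f : Trig⟦X⟧) : toFuns (-f) = -toFuns f := map_neg _ _

theorem toFuns_X_pow (k : ℕ) : toFuns (X ^ k) = X ^ k := by
  rw [toFuns, map_pow, map_X]

theorem ofHat_toFuns (g : Fin 4 → Trig⟦X⟧) :
    ofHat (fun i => toFuns (g i)) = fun i => toFuns (weighted g i) := by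
  funext i
  rw [ofHat, weighted, toFuns_mul, toFuns_X_pow]

theorem dTau_toFuns (g : Trig⟦X⟧) :
    dTau (toFuns g) = toFuns (-(X ^ 2 * derivative Trig g)) := by
  rw [dTau, derivative_toFuns, toFuns_neg, toFuns_mul, toFuns_X_pow]

theorem subst_C_mul {a : Fin 4 → Trig⟦X⟧} (ha : MvPowerSeries.HasSubst a) (r : ℂ)
    (h : MvPowerSeries (Fin 4) ℂ) :
    (MvPowerSeries.subst a (MvPowerSeries.C r * h) : Trig⟦X⟧)
      = cst r * MvPowerSeries.subst a h := by
  rw [← MvPowerSeries.smul_eq_C_mul, MvPowerSeries.subst_smul ha]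
  ext1 n
  rw [PowerSeries.coeff_smul, PowerSeries.coeff_C_mul, Algebra.smul_def]

theorem hamVectorField_hamiltonian (η : ℂ) (f : MvPowerSeries (Fin 4) ℂ) :
    hamVectorField (hamiltonian η f) =
      ![-MvPowerSeries.X 1 + MvPowerSeries.C η *
          ((MvPowerSeries.X 2 ^ 2 + MvPowerSeries.X 3 ^ 2) * MvPowerSeries.X 2)
          + hamVectorField f 0,
        MvPowerSeries.X 0 + MvPowerSeries.C η *
          ((MvPowerSeries.X 2 ^ 2 + MvPowerSeries.X 3 ^ 2) * MvPowerSeries.X 3)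
          + hamVectorField f 1,
        -MvPowerSeries.X 3 - MvPowerSeries.X 0 + hamVectorField f 2,
        MvPowerSeries.X 2 - MvPowerSeries.X 1 + hamVectorField f 3] := by
  have hhalf : (MvPowerSeries.C (2⁻¹ : ℂ) : MvPowerSeries (Fin 4) ℂ) * 2 = 1 := by
    rw [← map_ofNat MvPowerSeries.C 2, ← map_mul]
    norm_num
  have hX : ∀ i j : Fin 4, MvPowerSeries.pderiv ℂ i (MvPowerSeries.X j)
      = if i = j then 1 else 0 := fun i j => by
    rw [MvPowerSeries.pderiv_X, Pi.single_apply]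
    simp [eq_comm]
  funext i
  fin_cases i <;>
    simp [hamVectorField, hamiltonian, I₁, I₂, I₃, Derivation.leibniz, hX,
      Derivation.leibniz_pow]
  · left
    linear_combination (MvPowerSeries.C (2⁻¹ : ℂ) * 2 + 1) *
      ((MvPowerSeries.X 2 ^ 2 + MvPowerSeries.X 3 ^ 2) * MvPowerSeries.X 2) * hhalf
  · left
    linear_combination (MvPowerSeries.C (2⁻¹ : ℂ) * 2 + 1) *
      ((MvPowerSeries.X 2 ^ 2 + MvPowerSeries.X 3 ^ 2) * MvPowerSeries.X 3) * hhalf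
  · linear_combination -MvPowerSeries.X 0 * hhalf
  · linear_combination -MvPowerSeries.X 1 * hhalf

/-- For the weighted unknowns `fixedResidual` is the defect in the equation `𝒟 Γ = X_H(Γ)`, divided by
`s ^ wt i`. -/
theorem X_pow_mul_fixedResidual (η : ℂ) {f : MvPowerSeries (Fin 4) ℂ} (hf : WeightGE 5 f)
    (g : Fin 4 → Trig⟦X⟧) (i : Fin 4) :
    X ^ wt i * fixedResidual η f g i = dT (weighted g i) - X ^ 2 * derivative Trig (weighted g i)
      - MvPowerSeries.subst (weighted g) (hamVectorField (hamiltonian η f) i) := by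
  have ha := hasSubst_weighted g
  have hfo := X_pow_mul_force hf g
  have hder : ∀ i, X ^ 2 * derivative Trig (weighted g i)
      = X ^ (wt i + 1) * ((wt i : Trig⟦X⟧) * g i + X * derivative Trig (g i)) := by
    intro i
    have := X_mul_derivative_X_pow_mul (wt i) (g i)
    rw [weighted, pow_two, mul_assoc, this]
    ring
  have hd : ∀ i, dT (weighted g i) = X ^ wt i * dT (g i) := fun i => dT_X_pow_mul _ _
  have hS : ∀ p : MvPowerSeries (Fin 4) ℂ, (MvPowerSeries.subst (weighted g) p : Trig⟦X⟧)
      = MvPowerSeries.substAlgHom ha p := fun p => by rw [MvPowerSeries.substAlgHom_apply]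
  have hC : ∀ (r : ℂ) (p : MvPowerSeries (Fin 4) ℂ), MvPowerSeries.substAlgHom ha
      (MvPowerSeries.C r * p) = cst r * MvPowerSeries.substAlgHom ha p := fun r p => by
    rw [← hS, ← hS]
    exact subst_C_mul ha r p
  have h0 := hfo 0
  have h1 := hfo 1
  have h2 := hfo 2
  have h3 := hfo 3
  rw [hd, hder, hamVectorField_hamiltonian]
  rw [hS] at h0 h1 h2 h3 ⊢
  fin_cases i <;>
    simp only [fixedResidual, Fin.zero_eta, Fin.mk_one, Fin.reduceFinMk, Matrix.cons_val,
      map_add, map_sub, map_neg, hC, map_mul, map_pow, MvPowerSeries.substAlgHom_X, ← h0, ← h1,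
      ← h2, ← h3] <;>
    simp only [weighted, wt, Matrix.cons_val] <;> push_cast <;> ring

theorem fixedResidual_eq_zero_iff (η : ℂ) {f : MvPowerSeries (Fin 4) ℂ} (hf : WeightGE 5 f)
    (g : Fin 4 → Trig⟦X⟧) (i : Fin 4) : fixedResidual η f g i = 0 ↔
      dT (weighted g i) - X ^ 2 * derivative Trig (weighted g i)
        = MvPowerSeries.subst (weighted g) (hamVectorField (hamiltonian η f) i) := by
  rw [← sub_eq_zero (b := MvPowerSeries.subst _ _), ← X_pow_mul_fixedResidual η hf]
  constructor
  · intro h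
    rw [h, mul_zero]
  · intro h
    ext1 n
    have := congrArg (coeff (n + wt i)) h
    rwa [coeff_X_pow_mul, map_zero] at this

/-- A series with trigonometric coefficients solves the equation exactly if its rescaled residual
vanishes. -/
theorem isFormalSolution_toFuns_iff (η : ℂ) {f : MvPowerSeries (Fin 4) ℂ} (hf : WeightGE 5 f)
    (g : Fin 4 → Trig⟦X⟧) :
    IsFormalSolution (hamiltonian η f) (ofHat fun i => toFuns (g i)) ↔
      ∀ i, fixedResidual η f g i = 0 := by
  refine forall_congr' fun i => ?_
  have hsub : MvPowerSeries.subst (ofHat fun i => toFuns (g i))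
      (hamVectorField (hamiltonian η f) i) = toFuns (MvPowerSeries.subst (weighted g)
      (hamVectorField (hamiltonian η f) i)) := by
    rw [ofHat_toFuns]
    exact (map_subst_algHom Trig.val (hasSubst_weighted g) _).symm
  rw [hsub, ofHat_toFuns, dPhi_toFuns, dTau_toFuns, ← toFuns_add, toFuns_injective.eq_iff,
    ← sub_eq_add_neg, fixedResidual_eq_zero_iff η hf]

theorem rot_eq_zero_iff (x : Fin 4 → Trig⟦X⟧) : (∀ i, rot x i = 0) ↔ ∀ i, x i = 0 := by
  constructor
  · intro h i
    have h' : rot x = 0 := funext h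
    rw [← unrot_rot x, h']
    fin_cases i <;> simp [unrot]
  · intro h i
    fin_cases i <;> simp [rot, h]

theorem isFormalSolution_rot_iff (η : ℂ) {f : MvPowerSeries (Fin 4) ℂ} (hf : WeightGE 5 f)
    (x : Fin 4 → Trig⟦X⟧) :
    IsFormalSolution (hamiltonian η f) (ofHat fun i => toFuns (rot x i)) ↔
      ∀ i, residual η (rotForce f) x i = 0 := by
  rw [isFormalSolution_toFuns_iff η hf, fixedResidual_rot, rot_eq_zero_iff]

/-- Every vector of series with trigonometric coefficients arises from the rotating frame. -/
theorem HasTrigCoeffs.exists_rot {G : Fin 4 → PowerSeries (ℂ → ℂ)} (hG : HasTrigCoeffs G) :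
    ∃ x : Fin 4 → Trig⟦X⟧, G = fun i => toFuns (rot x i) := by
  refine ⟨unrot fun i => PowerSeries.mk fun n =>
    ⟨coeff n (G i), (mem_trig_iff _).2 (hG i n)⟩, ?_⟩
  funext i
  ext1 n
  rw [rot_unrot, coeff_toFuns, coeff_mk]

theorem hasTrigCoeffs_toFuns (g : Fin 4 → Trig⟦X⟧) : HasTrigCoeffs fun i => toFuns (g i) := by
  intro i n
  rw [coeff_toFuns]
  exact (mem_trig_iff _).1 (coeff n (g i)).2

/-! ### Mean values of monomials in `cos φ` and `sin φ` -/

/-- The mean value of `cos^a φ sin^b φ`. -/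
def trigMoment (a b : ℕ) : ℂ := Trig.mean (cosT ^ a * sinT ^ b)

theorem Trig.D_pow_succ (f : Trig) (n : ℕ) :
    Trig.D (f ^ (n + 1)) = ((n : ℂ) + 1) • (f ^ n * Trig.D f) := by
  induction n with
  | zero => simp
  | succ n ih =>
    rw [pow_succ, Trig.D_mul, ih, smul_eq_algebraMap_mul, smul_eq_algebraMap_mul]
    push_cast
    ring

/-- Integration by parts, from `(cos^(a+1) φ sin^(b+1) φ)'`. -/
theorem trigMoment_rec (a b : ℕ) :
    ((b : ℂ) + 1) * trigMoment (a + 2) b = (a + 1) * trigMoment a (b + 2) := by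
  have h := Trig.mean_D (cosT ^ (a + 1) * sinT ^ (b + 1))
  have e : Trig.D (cosT ^ (a + 1) * sinT ^ (b + 1))
      = ((b : ℂ) + 1) • (cosT ^ (a + 2) * sinT ^ b)
        - ((a : ℂ) + 1) • (cosT ^ a * sinT ^ (b + 2)) := by
    rw [Trig.D_mul, Trig.D_pow_succ, Trig.D_pow_succ, D_cosT, D_sinT, smul_mul_assoc,
      mul_smul_comm]
    have h1 : cosT ^ (a + 1) * (sinT ^ b * cosT) = cosT ^ (a + 2) * sinT ^ b := by ring
    have h2 : cosT ^ a * -sinT * sinT ^ (b + 1) = -(cosT ^ a * sinT ^ (b + 2)) := by ring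
    rw [h1, h2, smul_neg]
    ring
  rw [e, map_sub, map_smul, map_smul, smul_eq_mul, smul_eq_mul] at h
  exact sub_eq_zero.1 h

theorem trigMoment_one_left (b : ℕ) : trigMoment 1 b = 0 := by
  have h := Trig.mean_D (sinT ^ (b + 1))
  rw [Trig.D_pow_succ, D_sinT, map_smul, smul_eq_mul] at h
  have hb : (b : ℂ) + 1 ≠ 0 := by exact_mod_cast (by omega : b + 1 ≠ 0)
  rw [trigMoment, pow_one, mul_comm]
  exact (mul_eq_zero.1 h).resolve_left hb

theorem trigMoment_one_right (a : ℕ) : trigMoment a 1 = 0 := by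
  have h := Trig.mean_D (cosT ^ (a + 1))
  have e : cosT ^ a * -sinT = -(cosT ^ a * sinT) := by ring
  rw [Trig.D_pow_succ, D_cosT, e, map_smul, smul_eq_mul, map_neg, mul_neg, neg_eq_zero] at h
  have ha : (a : ℂ) + 1 ≠ 0 := by exact_mod_cast (by omega : a + 1 ≠ 0)
  rw [trigMoment, pow_one]
  exact (mul_eq_zero.1 h).resolve_left ha

theorem trigMoment_odd_left (k b : ℕ) : trigMoment (2 * k + 1) b = 0 := by
  induction k generalizing b with
  | zero => exact trigMoment_one_left b
  | succ k ih =>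
    have h := trigMoment_rec (2 * k + 1) b
    rw [ih, mul_zero] at h
    have hb : (b : ℂ) + 1 ≠ 0 := by exact_mod_cast (by omega : b + 1 ≠ 0)
    exact (mul_eq_zero.1 h).resolve_left hb

theorem trigMoment_odd_right (a k : ℕ) : trigMoment a (2 * k + 1) = 0 := by
  induction k generalizing a with
  | zero => exact trigMoment_one_right a
  | succ k ih =>
    have h := trigMoment_rec a (2 * k + 1)
    rw [ih, mul_zero] at h
    have ha : (a : ℂ) + 1 ≠ 0 := by exact_mod_cast (by omega : a + 1 ≠ 0)
    exact (mul_eq_zero.1 h.symm).resolve_left ha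

theorem trigMoment_add (a b : ℕ) :
    trigMoment (a + 2) b + trigMoment a (b + 2) = trigMoment a b := by
  rw [trigMoment, trigMoment, trigMoment, ← map_add]
  congr 1
  linear_combination cosT ^ a * sinT ^ b * cosT_sq_add_sinT_sq

theorem trigMoment_zero_zero : trigMoment 0 0 = 1 := by
  have := Trig.mean_algebraMap 1
  rw [map_one] at this
  rw [trigMoment, pow_zero, pow_zero, mul_one, this]

theorem trigMoment_two_two : trigMoment 2 2 = 1 / 8 := by
  have h1 := trigMoment_rec 0 0
  have h2 := trigMoment_add 0 0
  have h3 := trigMoment_add 2 0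
  have h4 := trigMoment_rec 2 0
  rw [trigMoment_zero_zero] at h2
  norm_num at h1 h2 h3 h4
  linear_combination (1 / 4 : ℂ) * h3 - (1 / 4 : ℂ) * h4 + (1 / 8 : ℂ) * h2 + (1 / 8 : ℂ) * h1

theorem trigMoment_four_zero : trigMoment 4 0 = 3 / 8 := by
  have h4 := trigMoment_rec 2 0
  rw [trigMoment_two_two] at h4
  norm_num at h4
  exact h4

theorem trigMoment_zero_four : trigMoment 0 4 = 3 / 8 := by
  have h4 := trigMoment_rec 0 2
  rw [trigMoment_two_two] at h4
  norm_num at h4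
  exact h4.symm

/-! ### The lowest order of the force -/

/-- The exponents of the monomials of weighted degree `w ≤ 4`. -/
def exponents (w : ℕ) : Finset (ℕ × ℕ × ℕ × ℕ) :=
  (Finset.range 3 ×ˢ Finset.range 3 ×ˢ Finset.range 5 ×ˢ Finset.range 5).filter
    fun e => 2 * e.1 + 2 * e.2.1 + e.2.2.1 + e.2.2.2 = w

theorem wdeg_eq (m : Fin 4 →₀ ℕ) : wdeg m = 2 * m 0 + 2 * m 1 + m 2 + m 3 := by
  simp [wdeg, Fin.sum_univ_four, wt]

@[simp] theorem multiIndex_apply_zero (a b c d : ℕ) : multiIndex a b c d 0 = a := rfl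
@[simp] theorem multiIndex_apply_one (a b c d : ℕ) : multiIndex a b c d 1 = b := rfl
@[simp] theorem multiIndex_apply_two (a b c d : ℕ) : multiIndex a b c d 2 = c := rfl
@[simp] theorem multiIndex_apply_three (a b c d : ℕ) : multiIndex a b c d 3 = d := rfl

theorem eq_multiIndex (m : Fin 4 →₀ ℕ) : m = multiIndex (m 0) (m 1) (m 2) (m 3) := by
  ext i
  fin_cases i <;> rfl

/-- The lowest order of a substitution only involves the leading coefficients of the unknowns. -/
theorem coeff_subst_weighted_lowest {w : ℕ} (hw : w ≤ 4) {h : MvPowerSeries (Fin 4) ℂ}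
    (hh : WeightGE w h) (g : Fin 4 → Trig⟦X⟧) :
    coeff w (MvPowerSeries.subst (weighted g) h : Trig⟦X⟧) =
      ∑ e ∈ exponents w, MvPowerSeries.coeff (multiIndex e.1 e.2.1 e.2.2.1 e.2.2.2) h •
        (coeff 0 (g 0) ^ e.1 * coeff 0 (g 1) ^ e.2.1 * coeff 0 (g 2) ^ e.2.2.1
          * coeff 0 (g 3) ^ e.2.2.2) := by
  rw [coeff_subst_weighted]
  have hinj : Set.InjOn (fun e : ℕ × ℕ × ℕ × ℕ => multiIndex e.1 e.2.1 e.2.2.1 e.2.2.2)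
      (exponents w) := by
    rintro ⟨a, b, c, d⟩ _ ⟨a', b', c', d'⟩ _ h
    have h0 := DFunLike.congr_fun h 0
    have h1 := DFunLike.congr_fun h 1
    have h2 := DFunLike.congr_fun h 2
    have h3 := DFunLike.congr_fun h 3
    simp only [multiIndex_apply_zero, multiIndex_apply_one, multiIndex_apply_two,
      multiIndex_apply_three] at h0 h1 h2 h3
    subst h0 h1 h2 h3
    rfl
  rw [finsum_eq_sum_of_support_subset (s := (exponents w).image
    fun e => multiIndex e.1 e.2.1 e.2.2.1 e.2.2.2), Finset.sum_image hinj]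
  · refine Finset.sum_congr rfl fun e he => ?_
    congr 1
    have hwe : wdeg (multiIndex e.1 e.2.1 e.2.2.1 e.2.2.2) = w := by
      rw [wdeg_eq]
      exact (Finset.mem_filter.1 he).2
    rw [hwe, coeff_X_pow_mul', if_pos le_rfl, Nat.sub_self, Fin.prod_univ_four]
    simp
  · intro m hm
    have hm' : MvPowerSeries.coeff m h ≠ 0 := fun h0 => hm (by simp [h0])
    have h1 := hh m hm'
    have h2 : wdeg m ≤ w := by
      by_contra hlt
      exact hm (by simp only; rw [coeff_X_pow_mul', if_neg (by omega), smul_zero])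
    rw [Finset.coe_image]
    refine ⟨(m 0, m 1, m 2, m 3), ?_, (eq_multiIndex m).symm⟩
    rw [wdeg_eq] at h1 h2
    simp only [exponents, Finset.coe_filter, Finset.mem_product, Finset.mem_range,
      Set.mem_ofPred_eq]
    omega

theorem exponents_three : exponents 3 = {(1, 0, 1, 0), (1, 0, 0, 1), (0, 1, 1, 0), (0, 1, 0, 1),
    (0, 0, 3, 0), (0, 0, 2, 1), (0, 0, 1, 2), (0, 0, 0, 3)} := by
  decide

theorem exponents_four : exponents 4 = {(2, 0, 0, 0), (1, 1, 0, 0), (0, 2, 0, 0), (1, 0, 2, 0),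
    (1, 0, 1, 1), (1, 0, 0, 2), (0, 1, 2, 0), (0, 1, 1, 1), (0, 1, 0, 2), (0, 0, 4, 0),
    (0, 0, 3, 1), (0, 0, 2, 2), (0, 0, 1, 3), (0, 0, 0, 4)} := by
  decide

/-- The mean value of the lowest order term against a monomial in `cos φ`, `sin φ`, along the
leading term `κ (cos φ, sin φ, cos φ, sin φ)`. -/
theorem mean_mul_coeff_subst_lowest {w : ℕ} (hw : w ≤ 4) {h : MvPowerSeries (Fin 4) ℂ}
    (hh : WeightGE w h) {g : Fin 4 → Trig⟦X⟧} {κ : ℂ}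
    (h0 : coeff 0 (g 0) = algebraMap ℂ Trig κ * cosT)
    (h1 : coeff 0 (g 1) = algebraMap ℂ Trig κ * sinT)
    (h2 : coeff 0 (g 2) = algebraMap ℂ Trig κ * cosT)
    (h3 : coeff 0 (g 3) = algebraMap ℂ Trig κ * sinT) (k l : ℕ) :
    Trig.mean (cosT ^ k * sinT ^ l * coeff w (MvPowerSeries.subst (weighted g) h : Trig⟦X⟧)) =
      ∑ e ∈ exponents w, MvPowerSeries.coeff (multiIndex e.1 e.2.1 e.2.2.1 e.2.2.2) h *
        κ ^ (e.1 + e.2.1 + e.2.2.1 + e.2.2.2)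
          * trigMoment (e.1 + e.2.2.1 + k) (e.2.1 + e.2.2.2 + l) := by
  rw [coeff_subst_weighted_lowest hw hh, Finset.mul_sum, map_sum]
  refine Finset.sum_congr rfl fun e _ => ?_
  have : cosT ^ k * sinT ^ l * (MvPowerSeries.coeff (multiIndex e.1 e.2.1 e.2.2.1 e.2.2.2) h •
        (coeff 0 (g 0) ^ e.1 * coeff 0 (g 1) ^ e.2.1 * coeff 0 (g 2) ^ e.2.2.1
          * coeff 0 (g 3) ^ e.2.2.2))
      = (MvPowerSeries.coeff (multiIndex e.1 e.2.1 e.2.2.1 e.2.2.2) h *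
          κ ^ (e.1 + e.2.1 + e.2.2.1 + e.2.2.2)) •
        (cosT ^ (e.1 + e.2.2.1 + k) * sinT ^ (e.2.1 + e.2.2.2 + l)) := by
    rw [h0, h1, h2, h3, smul_eq_algebraMap_mul, smul_eq_algebraMap_mul, map_mul, map_pow]
    ring
  rw [this, map_smul, smul_eq_mul, trigMoment]

theorem multiIndex_add_single (a b c d : ℕ) :
    multiIndex a b c d + Finsupp.single 0 1 = multiIndex (a + 1) b c d ∧
    multiIndex a b c d + Finsupp.single 1 1 = multiIndex a (b + 1) c d ∧
    multiIndex a b c d + Finsupp.single 2 1 = multiIndex a b (c + 1) d ∧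
    multiIndex a b c d + Finsupp.single 3 1 = multiIndex a b c (d + 1) := by
  refine ⟨?_, ?_, ?_, ?_⟩ <;> ext i <;> fin_cases i <;> simp [multiIndex]

theorem coeff_pderiv_zero (f : MvPowerSeries (Fin 4) ℂ) (a b c d : ℕ) :
    MvPowerSeries.coeff (multiIndex a b c d) (MvPowerSeries.pderiv ℂ 0 f)
      = MvPowerSeries.coeff (multiIndex (a + 1) b c d) f * (a + 1) := by
  rw [MvPowerSeries.coeff_pderiv, (multiIndex_add_single a b c d).1, multiIndex_apply_zero]

theorem coeff_pderiv_one (f : MvPowerSeries (Fin 4) ℂ) (a b c d : ℕ) :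
    MvPowerSeries.coeff (multiIndex a b c d) (MvPowerSeries.pderiv ℂ 1 f)
      = MvPowerSeries.coeff (multiIndex a (b + 1) c d) f * (b + 1) := by
  rw [MvPowerSeries.coeff_pderiv, (multiIndex_add_single a b c d).2.1, multiIndex_apply_one]

theorem coeff_pderiv_two (f : MvPowerSeries (Fin 4) ℂ) (a b c d : ℕ) :
    MvPowerSeries.coeff (multiIndex a b c d) (MvPowerSeries.pderiv ℂ 2 f)
      = MvPowerSeries.coeff (multiIndex a b (c + 1) d) f * (c + 1) := by
  rw [MvPowerSeries.coeff_pderiv, (multiIndex_add_single a b c d).2.2.1, multiIndex_apply_two]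

theorem coeff_pderiv_three (f : MvPowerSeries (Fin 4) ℂ) (a b c d : ℕ) :
    MvPowerSeries.coeff (multiIndex a b c d) (MvPowerSeries.pderiv ℂ 3 f)
      = MvPowerSeries.coeff (multiIndex a b c (d + 1)) f * (d + 1) := by
  rw [MvPowerSeries.coeff_pderiv, (multiIndex_add_single a b c d).2.2.2, multiIndex_apply_three]

theorem trigMoment_values :
    trigMoment 1 0 = 0 ∧ trigMoment 0 1 = 0 ∧ trigMoment 3 0 = 0 ∧ trigMoment 2 1 = 0 ∧
    trigMoment 1 2 = 0 ∧ trigMoment 0 3 = 0 ∧ trigMoment 3 1 = 0 ∧ trigMoment 1 3 = 0 ∧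
    trigMoment 5 0 = 0 ∧ trigMoment 4 1 = 0 ∧ trigMoment 3 2 = 0 ∧ trigMoment 2 3 = 0 ∧
    trigMoment 1 4 = 0 ∧ trigMoment 0 5 = 0 :=
  ⟨trigMoment_odd_left 0 0, trigMoment_odd_right 0 0, trigMoment_odd_left 1 0,
    trigMoment_odd_right 2 0, trigMoment_odd_left 0 2, trigMoment_odd_right 0 1,
    trigMoment_odd_left 1 1, trigMoment_odd_left 0 3, trigMoment_odd_left 2 0,
    trigMoment_odd_right 4 0, trigMoment_odd_left 1 2, trigMoment_odd_right 2 1,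
    trigMoment_odd_left 0 4, trigMoment_odd_right 0 2⟩

/-- The mean values of the lowest order of the force: only the rotational average
`α I₁ I₃ + β (q₁ p₁ + q₂ p₂) I₃` of the terms of weighted degree `5` contributes. -/
theorem mean_rotForce {f : MvPowerSeries (Fin 4) ℂ} (hf : WeightGE 5 f) {x : Fin 4 → Trig⟦X⟧}
    {κ : ℂ} (h0 : coeff 0 (x 0) = algebraMap ℂ Trig κ) (h1 : coeff 0 (x 1) = 0)
    (h2 : coeff 0 (x 2) = algebraMap ℂ Trig κ) (h3 : coeff 0 (x 3) = 0) :
    Trig.mean (coeff 2 (rotForce f x 0)) = 3 / 2 * coeffQPI₃ f * κ ^ 3 ∧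
    Trig.mean (coeff 2 (rotForce f x 1)) = -1 / 2 * coeffI₁I₃ f * κ ^ 3 ∧
    Trig.mean (coeff 2 (rotForce f x 2)) = -1 / 2 * coeffQPI₃ f * κ ^ 3 ∧
    Trig.mean (coeff 2 (rotForce f x 3)) = -1 / 2 * coeffI₁I₃ f * κ ^ 3 := by
  have g0 : coeff 0 (rot x 0) = algebraMap ℂ Trig κ * cosT := by
    simp only [rot, Matrix.cons_val, map_sub, coeff_C_mul, h0, h1]
    ring
  have g1 : coeff 0 (rot x 1) = algebraMap ℂ Trig κ * sinT := by
    simp only [rot, Matrix.cons_val, map_add, coeff_C_mul, h0, h1]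
    ring
  have g2 : coeff 0 (rot x 2) = algebraMap ℂ Trig κ * cosT := by
    simp only [rot, Matrix.cons_val, map_sub, coeff_C_mul, h2, h3]
    ring
  have g3 : coeff 0 (rot x 3) = algebraMap ℂ Trig κ * sinT := by
    simp only [rot, Matrix.cons_val, map_add, coeff_C_mul, h2, h3]
    ring
  have key := fun (i : Fin 4) (hw : wt i + 2 ≤ 4) => mean_mul_coeff_subst_lowest
    hw (hf.hamVectorField i) g0 g1 g2 g3
  have c0 : ∀ i, coeff 2 (force f (rot x) i) = coeff (wt i + 2)
      (MvPowerSeries.subst (weighted (rot x)) (hamVectorField f i) : Trig⟦X⟧) := fun i => by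
    rw [force, coeff_mk, add_comm]
  obtain ⟨m1, m2, m3, m4, m5, m6, m7, m8, m9, m10, m11, m12, m13, m14⟩ := trigMoment_values
  have m15 := trigMoment_two_two
  have m16 := trigMoment_four_zero
  have m17 := trigMoment_zero_four
  have k0c := key 0 le_rfl 1 0
  have k0s := key 0 le_rfl 0 1
  have k1c := key 1 le_rfl 1 0
  have k1s := key 1 le_rfl 0 1
  have k2c := key 2 (by decide) 1 0
  have k2s := key 2 (by decide) 0 1
  have k3c := key 3 (by decide) 1 0
  have k3s := key 3 (by decide) 0 1
  simp only [← c0, pow_zero, pow_one, mul_one, one_mul] at k0c k0s k1c k1s k2c k2s k3c k3s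
  have ew0 : exponents (wt 0 + 2) = _ := exponents_four
  have ew1 : exponents (wt 1 + 2) = _ := exponents_four
  have ew2 : exponents (wt 2 + 2) = _ := exponents_three
  have ew3 : exponents (wt 3 + 2) = _ := exponents_three
  rw [ew0] at k0c k0s
  rw [ew1] at k1c k1s
  rw [ew2] at k2c k2s
  rw [ew3] at k3c k3s
  simp [hamVectorField, coeff_pderiv_zero, coeff_pderiv_one, coeff_pderiv_two, coeff_pderiv_three,
    m3, m4, m5, m6, m7, m8, m9, m10, m11, m12, m13, m14, m15, m16, m17]
    at k0c k0s k1c k1s k2c k2s k3c k3s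
  refine ⟨?_, ?_, ?_, ?_⟩ <;>
    simp only [rotForce, unrot, Matrix.cons_val, map_add, map_neg, coeff_C_mul, k0c, k0s, k1c, k1s,
      k2c, k2s, k3c, k3s, coeffI₁I₃, coeffQPI₃] <;> ring

/-! ### The first two orders -/

theorem dT_C (t : Trig) : dT (C t) = C (Trig.D t) := by
  ext1 n
  rw [coeff_dT, coeff_C, coeff_C]
  split_ifs <;> simp

/-- The first two orders of the formal separatrix in the rotating frame. -/
def initialSeries (κ a b : ℂ) : Fin 4 → Trig⟦X⟧ :=
  ![cst κ + X * cst b, X * cst a, cst κ, X * cst a]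

/-- The resonance at first order is not obstructed: in the radial direction the mean values of the
contribution of `f` are compatible. -/
theorem solvesTo_initialSeries {η κ : ℂ} (h : η * κ ^ 2 = -2) {f : MvPowerSeries (Fin 4) ℂ}
    (hf : WeightGE 5 f) :
    SolvesTo η κ (rotForce f) 1
      (initialSeries κ (κ ^ 3 / 2 * coeffI₁I₃ f) (-(κ ^ 3 / 2 * coeffQPI₃ f))) := by
  set a := κ ^ 3 / 2 * coeffI₁I₃ f with ha
  set b := -(κ ^ 3 / 2 * coeffQPI₃ f) with hb
  set x := initialSeries κ a b with hx
  have x0 : x 0 = cst κ + X * cst b := rfl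
  have x1 : x 1 = X * cst a := rfl
  have x2 : x 2 = cst κ := rfl
  have x3 : x 3 = X * cst a := rfl
  have hF := mean_rotForce hf (x := x) (κ := κ) (by simp [x0]) (by simp [x1]) (by simp [x2])
    (by simp [x3])
  obtain ⟨F0, F1, F2, F3⟩ := hF
  have hA2 : ∀ i, X ^ 2 ∣ rotForce f x i := by
    intro i
    have := causal_rotForce hf 0 x 0 (fun i => by simp) i
    rwa [rotForce_zero hf, sub_zero] at this
  have hA0 : ∀ i, coeff 0 (rotForce f x i) = 0 := fun i => X_pow_dvd_iff.1 (hA2 i) 0 (by omega)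
  have hA1 : ∀ i, coeff 1 (rotForce f x i) = 0 := fun i => X_pow_dvd_iff.1 (hA2 i) 1 (by omega)
  have hd : ∀ c : ℂ, dT (cst c) = 0 := fun c => by rw [dT_C, Trig.D_algebraMap, map_zero]
  have hdX : ∀ c : ℂ, dT (X * cst c) = 0 := fun c => by
    have := dT_X_pow_mul 1 (cst c)
    rwa [pow_one, hd, mul_zero] at this
  have hder : ∀ c : ℂ, derivative Trig (X * cst c) = cst c := fun c => by
    rw [Derivation.leibniz, derivative_C, derivative_X]
    simp
  have two : (2 : Trig⟦X⟧) = cst 2 := by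
    rw [cst, map_ofNat, map_ofNat]
  have hκ : cst η * cst κ ^ 2 = -2 := by
    rw [two, ← map_pow, ← map_pow, ← map_mul, ← map_mul, h, map_neg, map_neg]
  -- the residual is a polynomial in `X` up to the contribution of `f`
  have r0 : residual η (rotForce f) x 0 = X ^ 2 * cst (-3 * b) - X ^ 3 * cst (η * a ^ 2 * κ)
      - rotForce f x 0 := by
    have e : residual η (rotForce f) x 0 = dT (x 0) - X * (2 * x 0 + X * derivative Trig (x 0))
      - X * cst η * ((x 2 ^ 2 + x 3 ^ 2) * x 2) - rotForce f x 0 := rfl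
    have three : cst (-3 * b) = -3 * cst b := by
      rw [cst, map_mul, map_mul, map_neg, map_neg, map_ofNat, map_ofNat]
    rw [e, x0, x2, x3, dT_add, hd, hdX, map_add, derivative_C, hder, three]
    simp only [cst, map_mul, map_pow]
    linear_combination (-X * cst κ) * hκ
  have r1 : residual η (rotForce f) x 1 = X ^ 2 * cst (-a) - X ^ 4 * cst (η * a ^ 3)
      - rotForce f x 1 := by
    have e : residual η (rotForce f) x 1 = dT (x 1) - X * (2 * x 1 + X * derivative Trig (x 1))
      - X * cst η * ((x 2 ^ 2 + x 3 ^ 2) * x 3) - rotForce f x 1 := rfl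
    rw [e, x1, x2, x3, hdX, hder]
    simp only [cst, map_mul, map_pow, map_neg]
    linear_combination (-X ^ 2 * cst a) * hκ
  have r2 : residual η (rotForce f) x 2 = X ^ 2 * cst b - rotForce f x 2 := by
    have e : residual η (rotForce f) x 2 = dT (x 2) - X * (x 2 + X * derivative Trig (x 2))
      + X * x 0 - rotForce f x 2 := rfl
    rw [e, x0, x2, hd, derivative_C]
    ring
  have r3 : residual η (rotForce f) x 3 = X ^ 2 * cst (-a) - rotForce f x 3 := by
    have e : residual η (rotForce f) x 3 = dT (x 3) - X * (x 3 + X * derivative Trig (x 3))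
      + X * x 1 - rotForce f x 3 := rfl
    rw [e, x1, x3, hdX, hder]
    simp only [cst, map_neg]
    ring
  refine ⟨by simp [x2], by simp [x3], ?_, ?_⟩
  · intro k hk i
    obtain rfl | rfl : k = 0 ∨ k = 1 := by omega
    · fin_cases i <;> simp only [Fin.zero_eta, Fin.mk_one, Fin.reduceFinMk, r0, r1, r2, r3,
        map_sub, hA0, coeff_X_pow_mul'] <;> norm_num
    · fin_cases i <;> simp only [Fin.zero_eta, Fin.mk_one, Fin.reduceFinMk, r0, r1, r2, r3,
        map_sub, hA1, coeff_X_pow_mul'] <;> norm_num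
  · intro i
    fin_cases i <;> simp only [Fin.zero_eta, Fin.mk_one, Fin.reduceFinMk, r0, r1, r2, r3,
      map_sub, F0, F1, F2, F3, coeff_X_pow_mul', Nat.reduceAdd, Nat.reduceLeDiff, if_true,
      if_false, le_refl, Nat.sub_self, coeff_zero_C, Trig.mean_algebraMap, map_zero, ha, hb] <;>
      ring

/-! ### Translations -/

theorem shift_mem_trig (φ₀ : ℂ) (f : ℂ → ℂ) (hf : f ∈ Trig) : (fun φ => f (φ + φ₀)) ∈ Trig := by
  refine trig_induction (p := fun f => (fun φ => f (φ + φ₀)) ∈ Trig) ?_ Trig.zero_mem ?_ ?_ f hf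
  · intro k
    have : (fun φ => expMode k (φ + φ₀)) = expMode k φ₀ • expMode k := by
      funext φ
      simp only [expMode, Pi.smul_apply, smul_eq_mul, ← Complex.exp_add]
      congr 1
      ring
    rw [this]
    exact Trig.smul_mem (expMode_mem k) _
  · exact fun f _ g _ hf hg => Trig.add_mem hf hg
  · exact fun c f _ hf => Trig.smul_mem hf c

/-- The shift `f ↦ f (φ + φ₀)` of trigonometric polynomials. -/
def shiftT (φ₀ : ℂ) : Trig →ₐ[ℂ] Trig where
  toFun f := ⟨fun φ => f.1 (φ + φ₀), shift_mem_trig φ₀ f.1 f.2⟩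
  map_one' := rfl
  map_mul' _ _ := rfl
  map_zero' := rfl
  map_add' _ _ := rfl
  commutes' _ := rfl

theorem D_shiftT (φ₀ : ℂ) (f : Trig) : Trig.D (shiftT φ₀ f) = shiftT φ₀ (Trig.D f) := by
  apply Subtype.ext
  funext φ
  exact deriv_comp_add_const f.1 φ₀ φ

/-- The inverse of `1 + τ₀ s`, so that `(τ + τ₀)⁻¹ = s * geom τ₀` for `s = τ⁻¹`. -/
def geom (τ₀ : ℂ) : ℂ⟦X⟧ := PowerSeries.mk fun k => (-τ₀) ^ k

theorem geom_mul (τ₀ : ℂ) : geom τ₀ * (1 + C τ₀ * X) = 1 := by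
  ext n
  rcases n with _ | n
  · simp [geom]
  · rw [mul_add, mul_one, map_add, ← mul_assoc, coeff_succ_mul_X, mul_comm, coeff_C_mul]
    simp only [geom, coeff_mk, coeff_one]
    rw [if_neg (by omega)]
    ring

theorem derivative_X_mul_geom (τ₀ : ℂ) : derivative ℂ (X * geom τ₀) = geom τ₀ ^ 2 := by
  have h := congrArg (derivative ℂ) (geom_mul τ₀)
  have h1 := geom_mul τ₀
  simp only [Derivation.leibniz, map_add, derivative_C, derivative_X, derivative_one,
    smul_eq_mul, zero_add, mul_one] at h ⊢
  linear_combination (geom τ₀ * X) * h - (geom τ₀ + X * derivative ℂ (geom τ₀)) * h1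

/-- The geometric series with coefficients in `Trig`. -/
def geomT (τ₀ : ℂ) : Trig⟦X⟧ := PowerSeries.map (algebraMap ℂ Trig) (geom τ₀)

theorem map_algebraMap_derivative (p : ℂ⟦X⟧) :
    derivative Trig (PowerSeries.map (algebraMap ℂ Trig) p)
      = PowerSeries.map (algebraMap ℂ Trig) (derivative ℂ p) := by
  ext1 n
  simp [coeff_derivative]

theorem X_mul_geomT (τ₀ : ℂ) :
    X * geomT τ₀ = PowerSeries.map (algebraMap ℂ Trig) (X * geom τ₀) := by
  rw [map_mul, map_X, geomT]

theorem derivative_X_mul_geomT (τ₀ : ℂ) : derivative Trig (X * geomT τ₀) = geomT τ₀ ^ 2 := by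
  have := map_algebraMap_derivative (X * geom τ₀)
  rwa [derivative_X_mul_geom, map_mul, map_X, map_pow] at this

theorem hasSubst_geomT (τ₀ : ℂ) : HasSubst (X * geomT τ₀) :=
  HasSubst.of_constantCoeff_zero' (by simp)

/-- The translation by `(φ₀, τ₀)` of series with trigonometric coefficients. -/
def translateT (φ₀ τ₀ : ℂ) (g : Trig⟦X⟧) : Trig⟦X⟧ :=
  PowerSeries.subst (X * geomT τ₀) (PowerSeries.map (shiftT φ₀ : Trig →+* Trig) g)

theorem translate_toFuns (φ₀ τ₀ : ℂ) (g : Trig⟦X⟧) :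
    translate φ₀ τ₀ (toFuns g) = toFuns (translateT φ₀ τ₀ g) := by
  have h1 : PowerSeries.map (Trig.val : Trig →+* (ℂ → ℂ)) (X * geomT τ₀)
      = X * PowerSeries.mk (fun k => fun _ : ℂ => (-τ₀) ^ k) := by
    rw [map_mul, map_X]
    congr 1
  have h2 : (PowerSeries.mk fun n => fun φ : ℂ => coeff n (toFuns g) (φ + φ₀))
      = PowerSeries.map (Trig.val : Trig →+* (ℂ → ℂ))
          (PowerSeries.map (shiftT φ₀ : Trig →+* Trig) g) := by
    ext1 n
    rw [coeff_mk, coeff_map, coeff_map, coeff_toFuns]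
    rfl
  rw [translate, h2, ← h1]
  exact (PowerSeries.map_subst (hasSubst_geomT τ₀) _).symm

theorem translateT_eq (φ₀ τ₀ : ℂ) (g : Trig⟦X⟧) : translateT φ₀ τ₀ g
    = PowerSeries.substAlgHom (R := Trig) (hasSubst_geomT τ₀)
      (PowerSeries.map (shiftT φ₀ : Trig →+* Trig) g) := by
  rw [translateT, ← PowerSeries.coe_substAlgHom (hasSubst_geomT τ₀)]

theorem translateT_mul (φ₀ τ₀ : ℂ) (f g : Trig⟦X⟧) :
    translateT φ₀ τ₀ (f * g) = translateT φ₀ τ₀ f * translateT φ₀ τ₀ g := by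
  simp only [translateT_eq, map_mul]

theorem translateT_add (φ₀ τ₀ : ℂ) (f g : Trig⟦X⟧) :
    translateT φ₀ τ₀ (f + g) = translateT φ₀ τ₀ f + translateT φ₀ τ₀ g := by
  simp only [translateT_eq, map_add]

theorem translateT_sub (φ₀ τ₀ : ℂ) (f g : Trig⟦X⟧) :
    translateT φ₀ τ₀ (f - g) = translateT φ₀ τ₀ f - translateT φ₀ τ₀ g := by
  simp only [translateT_eq, map_sub]

theorem translateT_pow (φ₀ τ₀ : ℂ) (f : Trig⟦X⟧) (n : ℕ) :
    translateT φ₀ τ₀ (f ^ n) = translateT φ₀ τ₀ f ^ n := by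
  simp only [translateT_eq, map_pow]

theorem translateT_X (φ₀ τ₀ : ℂ) : translateT φ₀ τ₀ X = X * geomT τ₀ := by
  rw [translateT, map_X, PowerSeries.subst_X (hasSubst_geomT τ₀)]

theorem translateT_C (φ₀ τ₀ : ℂ) (t : Trig) : translateT φ₀ τ₀ (C t) = C (shiftT φ₀ t) := by
  rw [translateT, map_C, PowerSeries.subst_C]
  rfl

theorem dT_translateT (φ₀ τ₀ : ℂ) (g : Trig⟦X⟧) :
    dT (translateT φ₀ τ₀ g) = translateT φ₀ τ₀ (dT g) := by
  ext1 n
  have hc : ∀ d : ℕ, coeff n ((X * geomT τ₀) ^ d)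
      = algebraMap ℂ Trig (coeff n ((X * geom τ₀) ^ d)) := by
    intro d
    rw [X_mul_geomT, ← map_pow, coeff_map]
  have hD : ∀ t : Trig, Trig.D t = (Trig.D : Trig →ₗ[ℂ] Trig).toAddMonoidHom t := fun _ => rfl
  rw [coeff_dT, translateT, translateT, coeff_subst' (hasSubst_geomT τ₀),
    coeff_subst' (hasSubst_geomT τ₀), hD,
    AddMonoidHom.map_finsum _ (coeff_subst_finite' (hasSubst_geomT τ₀) _ _)]
  refine finsum_congr fun d => ?_
  rw [← hD, hc, smul_eq_mul, smul_eq_mul, Trig.D_mul, Trig.D_algebraMap, mul_zero, add_zero,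
    coeff_map, coeff_map, coeff_dT]
  congr 1
  exact D_shiftT φ₀ _

theorem derivative_translateT (φ₀ τ₀ : ℂ) (g : Trig⟦X⟧) :
    X ^ 2 * derivative Trig (translateT φ₀ τ₀ g)
      = translateT φ₀ τ₀ (X ^ 2 * derivative Trig g) := by
  have h1 : PowerSeries.map (shiftT φ₀ : Trig →+* Trig) (derivative Trig g)
      = derivative Trig (PowerSeries.map (shiftT φ₀ : Trig →+* Trig) g) := by
    ext1 n
    simp [coeff_derivative]
  rw [translateT_mul, translateT_pow, translateT_X]
  conv_rhs => rw [translateT, h1]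
  rw [translateT, derivative_subst (hasSubst_geomT τ₀), derivative_X_mul_geomT]
  ring

theorem translateT_subst (φ₀ τ₀ : ℂ) {a : Fin 4 → Trig⟦X⟧} (ha : MvPowerSeries.HasSubst a)
    (h : MvPowerSeries (Fin 4) ℂ) :
    translateT φ₀ τ₀ (MvPowerSeries.subst a h)
      = MvPowerSeries.subst (fun i => translateT φ₀ τ₀ (a i)) h := by
  rw [translateT, map_subst_algHom (shiftT φ₀) ha]
  have ha' : MvPowerSeries.HasSubst
      (fun i => PowerSeries.map (shiftT φ₀ : Trig →+* Trig) (a i)) := ha.map _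
  exact MvPowerSeries.subst_comp_subst_apply ha' (hasSubst_geomT τ₀).const h

/-- The translation of the rescaled unknowns. -/
def translateHat (φ₀ τ₀ : ℂ) (g : Fin 4 → Trig⟦X⟧) : Fin 4 → Trig⟦X⟧ := fun i =>
  geomT τ₀ ^ wt i * translateT φ₀ τ₀ (g i)

theorem weighted_translateHat (φ₀ τ₀ : ℂ) (g : Fin 4 → Trig⟦X⟧) :
    weighted (translateHat φ₀ τ₀ g) = fun i => translateT φ₀ τ₀ (weighted g i) := by
  funext i
  rw [weighted, weighted, translateHat, translateT_mul, translateT_pow, translateT_X, mul_pow]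
  ring

/-- Translates of solutions are solutions. -/
theorem fixedResidual_translateHat {η : ℂ} {f : MvPowerSeries (Fin 4) ℂ} (hf : WeightGE 5 f)
    {g : Fin 4 → Trig⟦X⟧} (hg : ∀ i, fixedResidual η f g i = 0) (φ₀ τ₀ : ℂ) (i : Fin 4) :
    fixedResidual η f (translateHat φ₀ τ₀ g) i = 0 := by
  rw [fixedResidual_eq_zero_iff η hf, weighted_translateHat, dT_translateT,
    derivative_translateT, ← translateT_sub, (fixedResidual_eq_zero_iff η hf g i).1 (hg i),
    translateT_subst φ₀ τ₀ (hasSubst_weighted g)]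

theorem coeff_zero_mul' (f g : Trig⟦X⟧) : coeff 0 (f * g) = coeff 0 f * coeff 0 g := by
  simp

theorem coeff_zero_translateT (φ₀ τ₀ : ℂ) (g : Trig⟦X⟧) :
    coeff 0 (translateT φ₀ τ₀ g) = shiftT φ₀ (coeff 0 g) := by
  conv_lhs => rw [eq_X_mul_shift_add_const g, translateT_add, translateT_mul, translateT_X,
    translateT_C]
  simp

theorem coeff_one_translateT (φ₀ τ₀ : ℂ) (g : Trig⟦X⟧) :
    coeff 1 (translateT φ₀ τ₀ g) = shiftT φ₀ (coeff 1 g) := by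
  have h1 : coeff 0 (geomT τ₀) = 1 := by simp [geomT, geom]
  conv_lhs => rw [eq_X_mul_shift_add_const g, translateT_add, translateT_mul, translateT_X,
    translateT_C]
  rw [map_add, mul_assoc, ← zero_add 1, coeff_succ_X_mul, coeff_zero_mul', h1,
    coeff_zero_translateT, coeff_C, if_neg (by omega), coeff_mk, one_mul, add_zero]

theorem coeff_zero_translateHat (φ₀ τ₀ : ℂ) (g : Fin 4 → Trig⟦X⟧) (i : Fin 4) :
    coeff 0 (translateHat φ₀ τ₀ g i) = shiftT φ₀ (coeff 0 (g i)) := by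
  have h0 : constantCoeff (geomT τ₀) = 1 := by
    rw [← coeff_zero_eq_constantCoeff_apply]
    simp [geomT, geom]
  rw [translateHat, coeff_zero_mul', coeff_zero_translateT, coeff_zero_eq_constantCoeff_apply,
    map_pow, h0, one_pow, one_mul]

theorem coeff_one_translateHat (φ₀ τ₀ : ℂ) (g : Fin 4 → Trig⟦X⟧) (i : Fin 4) (hi : wt i = 1) :
    coeff 1 (translateHat φ₀ τ₀ g i)
      = shiftT φ₀ (coeff 1 (g i)) - algebraMap ℂ Trig τ₀ * shiftT φ₀ (coeff 0 (g i)) := by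
  have h0 : coeff 0 (geomT τ₀) = 1 := by simp [geomT, geom]
  have h1 : coeff 1 (geomT τ₀) = -algebraMap ℂ Trig τ₀ := by simp [geomT, geom]
  rw [translateHat, hi, pow_one, coeff_one_mul]
  simp only [← coeff_zero_eq_constantCoeff_apply]
  rw [h0, h1, coeff_zero_translateT,
    coeff_one_translateT]
  ring

theorem shiftT_cosT (φ₀ : ℂ) : shiftT φ₀ cosT
    = algebraMap ℂ Trig (Complex.cos φ₀) * cosT - algebraMap ℂ Trig (Complex.sin φ₀) * sinT := by
  apply Subtype.ext
  funext φ
  change Complex.cos (φ + φ₀) = Complex.cos φ₀ * Complex.cos φ - Complex.sin φ₀ * Complex.sin φ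
  rw [Complex.cos_add]
  ring

theorem shiftT_sinT (φ₀ : ℂ) : shiftT φ₀ sinT
    = algebraMap ℂ Trig (Complex.sin φ₀) * cosT + algebraMap ℂ Trig (Complex.cos φ₀) * sinT := by
  apply Subtype.ext
  funext φ
  change Complex.sin (φ + φ₀) = Complex.sin φ₀ * Complex.cos φ + Complex.cos φ₀ * Complex.sin φ
  rw [Complex.sin_add]
  ring

/-- Complex polar coordinates, with `e^{iφ₀} = (c + i d) / κ`. -/
theorem exists_polar {κ c d : ℂ} (hκ : κ ≠ 0) (h : c ^ 2 + d ^ 2 = κ ^ 2) :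
    ∃ φ₀, κ * Complex.cos φ₀ = c ∧ κ * Complex.sin φ₀ = d := by
  have hmul : (c + d * Complex.I) * (c - d * Complex.I) = κ ^ 2 := by
    linear_combination h - d ^ 2 * Complex.I_sq
  have hne : (c + d * Complex.I) ≠ 0 := by
    intro h0
    rw [h0, zero_mul] at hmul
    exact pow_ne_zero 2 hκ hmul.symm
  set z := (c + d * Complex.I) / κ with hz
  have hz0 : z ≠ 0 := div_ne_zero hne hκ
  have e1 : Complex.exp (-Complex.I * Complex.log z * Complex.I) = z := by
    rw [show -Complex.I * Complex.log z * Complex.I = Complex.log z by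
      linear_combination (-Complex.log z) * Complex.I_sq, Complex.exp_log hz0]
  have hinv : z⁻¹ = (c - d * Complex.I) / κ := by
    rw [hz, inv_div, div_eq_div_iff hne hκ]
    linear_combination -hmul
  have e2 : Complex.exp (-(-Complex.I * Complex.log z) * Complex.I) = z⁻¹ := by
    rw [neg_mul, Complex.exp_neg, e1]
  have hI := Complex.I_sq
  refine ⟨-Complex.I * Complex.log z, ?_, ?_⟩
  · rw [Complex.cos, e1, e2, hinv, hz]
    field_simp
    ring
  · rw [Complex.sin, e1, e2, hinv, hz]
    field_simp
    linear_combination (-2 * d) * hI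

theorem translateHat_unrot_leading {κ : ℂ} {x : Fin 4 → Trig⟦X⟧}
    (h0 : ∀ i, coeff 0 (x i) = algebraMap ℂ Trig (![κ, 0, κ, 0] i)) (φ₀ τ₀ : ℂ) (i : Fin 4) :
    coeff 0 (unrot (translateHat φ₀ τ₀ (rot x)) i) = algebraMap ℂ Trig
      (![κ * Complex.cos φ₀, κ * Complex.sin φ₀, κ * Complex.cos φ₀, κ * Complex.sin φ₀] i) := by
  have g0 : coeff 0 (rot x 0) = algebraMap ℂ Trig κ * cosT := by
    simp only [rot, Matrix.cons_val, map_sub, coeff_C_mul, h0, map_zero]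
    ring
  have g1 : coeff 0 (rot x 1) = algebraMap ℂ Trig κ * sinT := by
    simp only [rot, Matrix.cons_val, map_add, coeff_C_mul, h0, map_zero]
    ring
  have g2 : coeff 0 (rot x 2) = algebraMap ℂ Trig κ * cosT := by
    simp only [rot, Matrix.cons_val, map_sub, coeff_C_mul, h0, map_zero]
    ring
  have g3 : coeff 0 (rot x 3) = algebraMap ℂ Trig κ * sinT := by
    simp only [rot, Matrix.cons_val, map_add, coeff_C_mul, h0, map_zero]
    ring
  have hs := cosT_sq_add_sinT_sq
  fin_cases i <;>
    simp only [unrot, Fin.zero_eta, Fin.mk_one, Fin.reduceFinMk, Matrix.cons_val, map_add, map_neg,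
      coeff_C_mul, coeff_zero_translateHat, g0, g1, g2, g3, map_mul, shiftT_cosT, shiftT_sinT,
      AlgHom.commutes]
  · linear_combination (algebraMap ℂ Trig κ * algebraMap ℂ Trig (Complex.cos φ₀)) * hs
  · linear_combination (algebraMap ℂ Trig κ * algebraMap ℂ Trig (Complex.sin φ₀)) * hs
  · linear_combination (algebraMap ℂ Trig κ * algebraMap ℂ Trig (Complex.cos φ₀)) * hs
  · linear_combination (algebraMap ℂ Trig κ * algebraMap ℂ Trig (Complex.sin φ₀)) * hs

/-- Every non-zero solution is a translate of a given solution with leading term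
`κ (cos φ, sin φ, cos φ, sin φ)`: `φ₀` is read off from the leading coefficients, and `τ₀` from
the radial mean of the next ones. -/
theorem exists_translate {η κ : ℂ} (hη : η ≠ 0) (h : η * κ ^ 2 = -2)
    {f : MvPowerSeries (Fin 4) ℂ} (hf : WeightGE 5 f) {x x' : Fin 4 → Trig⟦X⟧}
    (hx : ∀ i, residual η (rotForce f) x i = 0)
    (h0 : ∀ i, coeff 0 (x i) = algebraMap ℂ Trig (![κ, 0, κ, 0] i))
    (hx' : ∀ i, residual η (rotForce f) x' i = 0) (hne : x' ≠ 0) :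
    ∃ φ₀ τ₀, rot x' = translateHat φ₀ τ₀ (rot x) := by
  have hκ : κ ≠ 0 := by
    rintro rfl
    norm_num at h
  obtain ⟨c, d, hcd, l0, l1, l2, l3⟩ :=
    residual_leading (causal_rotForce hf) (rotForce_zero hf) hx' hne
  have hcd' : c ^ 2 + d ^ 2 = κ ^ 2 := mul_left_cancel₀ hη (hcd.trans h.symm)
  obtain ⟨φ₀, hc, hd⟩ := exists_polar hκ hcd'
  set g := rot x with hg
  -- the first order terms of the translate for `τ₀ = 0`
  let p : Trig := cosT * shiftT φ₀ (coeff 1 (g 2)) + sinT * shiftT φ₀ (coeff 1 (g 3))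
  let q : Trig := -(sinT * shiftT φ₀ (coeff 1 (g 2))) + cosT * shiftT φ₀ (coeff 1 (g 3))
  let τ₀ : ℂ := (c * Trig.mean p + d * Trig.mean q
    - (c * Trig.mean (coeff 1 (x' 2)) + d * Trig.mean (coeff 1 (x' 3)))) / κ ^ 2
  have hτ : τ₀ * κ ^ 2 = c * Trig.mean p + d * Trig.mean q
    - (c * Trig.mean (coeff 1 (x' 2)) + d * Trig.mean (coeff 1 (x' 3))) :=
    div_mul_cancel₀ _ (pow_ne_zero 2 hκ)
  have hlead := translateHat_unrot_leading h0 φ₀ τ₀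
  rw [hc, hd] at hlead
  set y := unrot (translateHat φ₀ τ₀ g) with hy
  have hry : rot y = translateHat φ₀ τ₀ g := rot_unrot _
  have hysol : ∀ i, residual η (rotForce f) y i = 0 := by
    rw [← rot_eq_zero_iff, ← fixedResidual_rot, hry]
    refine fun i => fixedResidual_translateHat hf ?_ φ₀ τ₀ i
    rw [hg, fixedResidual_rot, rot_eq_zero_iff]
    exact hx
  have hy2 : coeff 1 (y 2) = p - algebraMap ℂ Trig τ₀ * coeff 0 (y 2) := by
    simp only [hy, unrot, Matrix.cons_val, map_add, coeff_C_mul, coeff_zero_translateHat, p,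
      coeff_one_translateHat φ₀ τ₀ g 2 rfl, coeff_one_translateHat φ₀ τ₀ g 3 rfl]
    ring
  have hy3 : coeff 1 (y 3) = q - algebraMap ℂ Trig τ₀ * coeff 0 (y 3) := by
    simp only [hy, unrot, Matrix.cons_val, map_add, map_neg, coeff_C_mul,
      coeff_zero_translateHat, q,
      coeff_one_translateHat φ₀ τ₀ g 2 rfl, coeff_one_translateHat φ₀ τ₀ g 3 rfl]
    ring
  refine ⟨φ₀, τ₀, ?_⟩
  rw [← hry]
  congr 1
  refine residual_unique (causal_rotForce hf) hysol hx' hcd (hlead 2) (hlead 3) ?_ ?_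
  · intro i
    rw [hlead i]
    fin_cases i <;> assumption
  · rw [hy2, hy3, hlead 2, hlead 3]
    simp only [Matrix.cons_val, map_sub, ← map_mul, Trig.mean_algebraMap]
    linear_combination τ₀ * hcd' + hτ

/-! ### The formal separatrix -/

/-- The formal separatrix for a perturbation given by its Taylor series: existence, the first two
orders, and uniqueness up to translation. -/
theorem exists_formalSeparatrix {η : ℂ} (hη : η ≠ 0) {f : MvPowerSeries (Fin 4) ℂ}
    (hf : WeightGE 5 f) {κ : ℂ} (hκ : κ ^ 2 = -2 / η) :
    ∃ G : Fin 4 → PowerSeries (ℂ → ℂ),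
      HasTrigCoeffs G ∧
      IsFormalSolution (hamiltonian η f) (ofHat G) ∧
      ofHat G ≠ 0 ∧
      (∀ φ : ℂ,
        coeff 0 (G 0) φ = κ * Complex.cos φ ∧
        coeff 0 (G 1) φ = κ * Complex.sin φ ∧
        coeff 0 (G 2) φ = κ * Complex.cos φ ∧
        coeff 0 (G 3) φ = κ * Complex.sin φ) ∧
      (∀ φ : ℂ,
        coeff 1 (G 0) φ = κ / η * (coeffI₁I₃ f * Complex.sin φ + coeffQPI₃ f * Complex.cos φ) ∧
        coeff 1 (G 1) φ = κ / η * (-coeffI₁I₃ f * Complex.cos φ + coeffQPI₃ f * Complex.sin φ) ∧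
        coeff 1 (G 2) φ = κ / η * (coeffI₁I₃ f * Complex.sin φ) ∧
        coeff 1 (G 3) φ = κ / η * (-coeffI₁I₃ f * Complex.cos φ)) ∧
      ∀ G' : Fin 4 → PowerSeries (ℂ → ℂ),
        HasTrigCoeffs G' →
        IsFormalSolution (hamiltonian η f) (ofHat G') →
        ofHat G' ≠ 0 →
        ∃ φ₀ τ₀ : ℂ, ∀ i, ofHat G' i = translate φ₀ τ₀ (ofHat G i) := by
  have h : η * κ ^ 2 = -2 := by
    rw [hκ]
    field_simp
  have hκ0 : κ ≠ 0 := by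
    rintro rfl
    norm_num at h
  have ha : κ ^ 3 / 2 * coeffI₁I₃ f = -(κ / η * coeffI₁I₃ f) := by
    rw [pow_succ, hκ]
    field_simp
  have hb : -(κ ^ 3 / 2 * coeffQPI₃ f) = κ / η * coeffQPI₃ f := by
    rw [pow_succ, hκ]
    field_simp
  obtain ⟨x, hx, hxi⟩ := (solvesTo_initialSeries h hf).exists_solution h (causal_rotForce hf)
  rw [ha, hb] at hxi
  set a := κ / η * coeffI₁I₃ f with ha'
  set b := κ / η * coeffQPI₃ f with hb'
  have hc0 : ∀ i, coeff 0 (x i) = algebraMap ℂ Trig (![κ, 0, κ, 0] i) := by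
    intro i
    have := X_pow_dvd_iff.1 (hxi i) 0 (by omega)
    rw [map_sub, sub_eq_zero] at this
    rw [this]
    fin_cases i <;> simp [initialSeries]
  have hX : ∀ c : ℂ, coeff 1 (X * cst c) = algebraMap ℂ Trig c := fun c => by
    rw [← zero_add 1, coeff_succ_X_mul, coeff_zero_C]
  have hC : ∀ c : ℂ, coeff 1 (cst c) = 0 := fun c => by rw [coeff_C, if_neg (by omega)]
  have hc1 : ∀ i, coeff 1 (x i) = algebraMap ℂ Trig (![b, -a, 0, -a] i) := by
    intro i
    have := X_pow_dvd_iff.1 (hxi i) 1 (by omega)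
    rw [map_sub, sub_eq_zero] at this
    rw [this]
    fin_cases i <;> simp only [initialSeries, Fin.zero_eta, Fin.mk_one, Fin.reduceFinMk,
      Matrix.cons_val, map_add, hX, hC, map_zero, zero_add]
  -- the coefficients of `rot x` as functions
  have hrot : ∀ (n : ℕ) (u : Fin 4 → ℂ), (∀ i, coeff n (x i) = algebraMap ℂ Trig (u i)) →
      ∀ φ : ℂ,
        coeff n (toFuns (rot x 0)) φ = Complex.cos φ * u 0 - Complex.sin φ * u 1 ∧
        coeff n (toFuns (rot x 1)) φ = Complex.sin φ * u 0 + Complex.cos φ * u 1 ∧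
        coeff n (toFuns (rot x 2)) φ = Complex.cos φ * u 2 - Complex.sin φ * u 3 ∧
        coeff n (toFuns (rot x 3)) φ = Complex.sin φ * u 2 + Complex.cos φ * u 3 := by
    intro n u hu φ
    simp only [coeff_toFuns, rot, Matrix.cons_val, map_add, map_sub, coeff_C_mul, hu]
    exact ⟨rfl, rfl, rfl, rfl⟩
  have h0 := hrot 0 _ hc0
  have h1 := hrot 1 _ hc1
  simp only [Matrix.cons_val] at h0 h1
  refine ⟨fun i => toFuns (rot x i), hasTrigCoeffs_toFuns _,
    (isFormalSolution_rot_iff η hf x).2 hx, ?_, ?_, ?_, ?_⟩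
  · intro hzero
    have e1 : ofHat (fun i => toFuns (rot x i)) 2 = X * toFuns (rot x 2) := by
      simp [ofHat, wt]
    have e2 : (coeff 1 (X * toFuns (rot x 2)) : ℂ → ℂ) 0 = κ := by
      rw [← zero_add 1, coeff_succ_X_mul, (h0 0).2.2.1]
      simp
    rw [← e1, hzero] at e2
    exact hκ0 e2.symm
  · intro φ
    obtain ⟨e0, e1, e2, e3⟩ := h0 φ
    refine ⟨e0.trans ?_, e1.trans ?_, e2.trans ?_, e3.trans ?_⟩ <;> ring
  · intro φ
    obtain ⟨e0, e1, e2, e3⟩ := h1 φ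
    refine ⟨e0.trans ?_, e1.trans ?_, e2.trans ?_, e3.trans ?_⟩ <;> simp only [ha', hb'] <;> ring
  · intro G' hG' hsol hne
    obtain ⟨x', rfl⟩ := hG'.exists_rot
    have hx' := (isFormalSolution_rot_iff η hf x').1 hsol
    have hne' : x' ≠ 0 := by
      rintro rfl
      apply hne
      have hr := (rot_eq_zero_iff 0).2 fun i => rfl
      funext i
      rw [ofHat]
      simp only [hr, toFuns, map_zero, mul_zero]
      rfl
    obtain ⟨φ₀, τ₀, hφ⟩ := exists_translate hη h hf hx hc0 hx' hne'
    refine ⟨φ₀, τ₀, fun i => ?_⟩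
    have e1 := congrFun (ofHat_toFuns (rot x')) i
    have e2 := congrFun (ofHat_toFuns (rot x)) i
    rw [e1, e2, translate_toFuns, hφ, weighted_translateHat]

end FormalSolution

section NormalForm

open MvPowerSeries

/-! ### Coefficients of products -/

/-- The coefficients of a product as explicit sums, in a form that `simp` can expand. -/
theorem coeff_multiIndex_mul (f g : MvPowerSeries (Fin 4) ℂ) (a b c d : ℕ) :
    coeff (multiIndex a b c d) (f * g) =
      ∑ i ∈ Finset.range (a + 1), ∑ j ∈ Finset.range (b + 1), ∑ k ∈ Finset.range (c + 1),
        ∑ l ∈ Finset.range (d + 1), coeff (multiIndex i j k l) f *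
          coeff (multiIndex (a - i) (b - j) (c - k) (d - l)) g := by
  classical
  rw [coeff_mul]
  simp only [← Finset.sum_product']
  symm
  refine Finset.sum_nbij'
    (fun e => (multiIndex e.1 e.2.1 e.2.2.1 e.2.2.2,
      multiIndex (a - e.1) (b - e.2.1) (c - e.2.2.1) (d - e.2.2.2)))
    (fun p => (p.1 0, p.1 1, p.1 2, p.1 3)) ?_ ?_ ?_ ?_ ?_
  · rintro ⟨i, j, k, l⟩ h
    simp only [Finset.mem_product, Finset.mem_range] at h
    rw [Finset.HasAntidiagonal.mem_antidiagonal]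
    ext n
    fin_cases n <;> simp <;> omega
  · rintro ⟨p, q⟩ h
    rw [Finset.HasAntidiagonal.mem_antidiagonal] at h
    have h' := fun n => DFunLike.congr_fun h n
    have h0 := h' 0
    have h1 := h' 1
    have h2 := h' 2
    have h3 := h' 3
    simp only [Finsupp.add_apply, multiIndex_apply_zero, multiIndex_apply_one,
      multiIndex_apply_two, multiIndex_apply_three] at h0 h1 h2 h3
    simp only [Finset.mem_product, Finset.mem_range]
    omega
  · rintro ⟨i, j, k, l⟩ _
    rfl
  · rintro ⟨p, q⟩ h
    rw [Finset.HasAntidiagonal.mem_antidiagonal] at h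
    have h' := fun n => DFunLike.congr_fun h n
    have h0 := h' 0
    have h1 := h' 1
    have h2 := h' 2
    have h3 := h' 3
    simp only [Finsupp.add_apply, multiIndex_apply_zero, multiIndex_apply_one,
      multiIndex_apply_two, multiIndex_apply_three] at h0 h1 h2 h3
    refine Prod.ext (eq_multiIndex p).symm ?_
    ext n
    fin_cases n <;> simp <;> omega
  · rintro ⟨i, j, k, l⟩ _
    rfl

theorem multiIndex_eq_single_iff (a b c d : ℕ) (i : Fin 4) :
    multiIndex a b c d = Finsupp.single i 1 ↔
      a = (if i = 0 then 1 else 0) ∧ b = (if i = 1 then 1 else 0) ∧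
      c = (if i = 2 then 1 else 0) ∧ d = (if i = 3 then 1 else 0) := by
  rw [DFunLike.ext_iff]
  simp only [Fin.forall_fin_succ, Finsupp.single_apply]
  fin_cases i <;> simp [multiIndex]

theorem coeff_multiIndex_X (a b c d : ℕ) (i : Fin 4) :
    coeff (multiIndex a b c d) (X i : MvPowerSeries (Fin 4) ℂ) =
      if a = (if i = 0 then 1 else 0) ∧ b = (if i = 1 then 1 else 0) ∧
        c = (if i = 2 then 1 else 0) ∧ d = (if i = 3 then 1 else 0) then 1 else 0 := by
  classical
  rw [coeff_X]
  simp only [multiIndex_eq_single_iff]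

/-! ### Weighted orders -/

theorem weight_wt (m : Fin 4 →₀ ℕ) : Finsupp.weight wt m = wdeg m := by
  rw [Finsupp.weight_apply, Finsupp.sum_fintype _ _ (by simp)]
  simp only [wdeg, smul_eq_mul, mul_comm]

theorem le_weightedOrder_iff (h : MvPowerSeries (Fin 4) ℂ) (n : ℕ) :
    (n : ℕ∞) ≤ weightedOrder wt h ↔ ∀ m, wdeg m < n → coeff m h = 0 := by
  constructor
  · intro hn m hm
    refine coeff_eq_zero_of_lt_weightedOrder wt ?_
    rw [weight_wt]
    exact lt_of_lt_of_le (by exact_mod_cast hm) hn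
  · intro hm
    exact nat_le_weightedOrder wt fun m hlt => hm m (by rwa [weight_wt] at hlt)

theorem le_weightedOrder_mul' {v : Fin 4 → ℕ} {f g : MvPowerSeries (Fin 4) ℂ} {a b : ℕ}
    (hf : (a : ℕ∞) ≤ weightedOrder v f) (hg : (b : ℕ∞) ≤ weightedOrder v g) :
    ((a + b : ℕ) : ℕ∞) ≤ weightedOrder v (f * g) := by
  push_cast
  exact (add_le_add hf hg).trans (le_weightedOrder_mul v)

theorem le_weightedOrder_pow' {v : Fin 4 → ℕ} {f : MvPowerSeries (Fin 4) ℂ} {a : ℕ}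
    (hf : (a : ℕ∞) ≤ weightedOrder v f) (n : ℕ) :
    ((a * n : ℕ) : ℕ∞) ≤ weightedOrder v (f ^ n) := by
  induction n with
  | zero => simp
  | succ n ih =>
    rw [pow_succ, mul_add, mul_one]
    exact le_weightedOrder_mul' ih hf

theorem le_weightedOrder_add' {v : Fin 4 → ℕ} {f g : MvPowerSeries (Fin 4) ℂ} {a : ℕ}
    (hf : (a : ℕ∞) ≤ weightedOrder v f) (hg : (a : ℕ∞) ≤ weightedOrder v g) :
    (a : ℕ∞) ≤ weightedOrder v (f + g) :=
  (le_min hf hg).trans (min_weightedOrder_le_add v)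

theorem le_weightedOrder_sub' {v : Fin 4 → ℕ} {f g : MvPowerSeries (Fin 4) ℂ} {a : ℕ}
    (hf : (a : ℕ∞) ≤ weightedOrder v f) (hg : (a : ℕ∞) ≤ weightedOrder v g) :
    (a : ℕ∞) ≤ weightedOrder v (f - g) := by
  rw [sub_eq_add_neg]
  exact le_weightedOrder_add' hf (by rwa [weightedOrder_neg])

theorem le_weightedOrder_X (v : Fin 4 → ℕ) (i : Fin 4) :
    ((v i : ℕ) : ℕ∞) ≤ weightedOrder v (X i : MvPowerSeries (Fin 4) ℂ) := by
  rw [X_def, weightedOrder_monomial_of_ne_zero v one_ne_zero, Finsupp.weight_single]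
  simp

theorem le_weightedOrder_C_mul {v : Fin 4 → ℕ} {f : MvPowerSeries (Fin 4) ℂ} {a : ℕ} (r : ℂ)
    (hf : (a : ℕ∞) ≤ weightedOrder v f) : (a : ℕ∞) ≤ weightedOrder v (C r * f) := by
  rw [← smul_eq_C_mul]
  exact hf.trans (le_weightedOrder_smul v)

/-- `A` and `B` have weighted order at least `n` and agree in weighted order `n`. -/
def AgreeAt (n : ℕ) (A B : MvPowerSeries (Fin 4) ℂ) : Prop :=
  (n : ℕ∞) ≤ weightedOrder wt A ∧ (n : ℕ∞) ≤ weightedOrder wt B ∧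
    ((n + 1 : ℕ) : ℕ∞) ≤ weightedOrder wt (A - B)

theorem AgreeAt.mul {n k : ℕ} {A B A' B' : MvPowerSeries (Fin 4) ℂ} (h : AgreeAt n A B)
    (h' : AgreeAt k A' B') : AgreeAt (n + k) (A * A') (B * B') := by
  refine ⟨le_weightedOrder_mul' h.1 h'.1, le_weightedOrder_mul' h.2.1 h'.2.1, ?_⟩
  have e : A * A' - B * B' = A * (A' - B') - (A - B) * (-B') := by ring
  rw [e]
  refine le_weightedOrder_sub' (a := n + k + 1) (le_weightedOrder_mul' (b := k + 1) h.1 h'.2.2) ?_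
  have := le_weightedOrder_mul' h.2.2 (g := -B') (b := k) (by rw [weightedOrder_neg]; exact h'.2.1)
  rwa [show n + 1 + k = n + k + 1 by ring] at this

theorem AgreeAt.pow {n : ℕ} {A B : MvPowerSeries (Fin 4) ℂ} (h : AgreeAt n A B) (k : ℕ) :
    AgreeAt (n * k) (A ^ k) (B ^ k) := by
  induction k with
  | zero =>
    refine ⟨by simp, by simp, ?_⟩
    rw [pow_zero, pow_zero, sub_self, weightedOrder_zero]
    exact le_top
  | succ k ih =>
    rw [pow_succ, pow_succ, mul_add, mul_one]
    exact ih.mul h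

theorem AgreeAt.monomial {Φ : Fin 4 → MvPowerSeries (Fin 4) ℂ}
    (h : ∀ i, AgreeAt (wt i) (Φ i) (X i)) (k : Fin 4 →₀ ℕ) :
    AgreeAt (wdeg k) (k.prod fun i e => Φ i ^ e) (MvPowerSeries.monomial k 1) := by
  have hX : MvPowerSeries.monomial k (1 : ℂ) = ∏ i, (X i : MvPowerSeries (Fin 4) ℂ) ^ k i := by
    rw [monomial_one_eq, Finsupp.prod_fintype _ _ (fun i => pow_zero _)]
  rw [hX, Finsupp.prod_fintype _ _ (fun i => pow_zero _), wdeg, Fin.prod_univ_four,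
    Fin.prod_univ_four, Fin.sum_univ_four]
  exact ((((h 0).pow _).mul ((h 1).pow _)).mul ((h 2).pow _)).mul ((h 3).pow _)

/-- Substitution of series that do not lower the weights does not lower the weighted order. -/
theorem coeff_subst_eq_zero {Φ : Fin 4 → MvPowerSeries (Fin 4) ℂ} (hs : HasSubst Φ)
    (hΦ : ∀ i, (wt i : ℕ∞) ≤ weightedOrder wt (Φ i)) {w : ℕ} {f : MvPowerSeries (Fin 4) ℂ}
    (hf : WeightGE w f) (m : Fin 4 →₀ ℕ) (hm : wdeg m < w) : coeff m (subst Φ f) = 0 := by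
  rw [coeff_subst hs]
  refine finsum_eq_zero_of_forall_eq_zero fun k => ?_
  rcases eq_or_ne (coeff k f) 0 with h0 | h0
  · rw [h0, zero_smul]
  · have hk := hf k h0
    have hord : ((wdeg k : ℕ) : ℕ∞) ≤ weightedOrder wt (k.prod fun i e => Φ i ^ e) := by
      rw [Finsupp.prod_fintype _ _ (fun i => pow_zero _), wdeg, Fin.prod_univ_four,
        Fin.sum_univ_four]
      exact le_weightedOrder_mul' (le_weightedOrder_mul' (le_weightedOrder_mul'
        (le_weightedOrder_pow' (hΦ 0) _) (le_weightedOrder_pow' (hΦ 1) _))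
        (le_weightedOrder_pow' (hΦ 2) _)) (le_weightedOrder_pow' (hΦ 3) _)
    rw [(le_weightedOrder_iff _ _).1 hord m (by omega), smul_zero]

/-- Substitution of series that agree with the coordinates in lowest weighted order does not change
the lowest weighted order. -/
theorem coeff_subst_eq_coeff {Φ : Fin 4 → MvPowerSeries (Fin 4) ℂ} (hs : HasSubst Φ)
    (hΦ : ∀ i, AgreeAt (wt i) (Φ i) (X i)) {w : ℕ} {f : MvPowerSeries (Fin 4) ℂ}
    (hf : WeightGE w f) (m : Fin 4 →₀ ℕ) (hm : wdeg m = w) :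
    coeff m (subst Φ f) = coeff m f := by
  classical
  rw [coeff_subst hs, finsum_eq_single _ m]
  · have h := (AgreeAt.monomial hΦ m).2.2
    have h1 := (le_weightedOrder_iff _ _).1 h m (by omega)
    rw [map_sub, coeff_monomial_same, sub_eq_zero] at h1
    rw [h1, smul_eq_mul, mul_one]
  · intro k hk
    rcases eq_or_ne (coeff k f) 0 with h0 | h0
    · rw [h0, zero_smul]
    · have hw := hf k h0
      have h := (AgreeAt.monomial hΦ k).2.2
      have h1 := (le_weightedOrder_iff _ _).1 h m (by omega)
      rw [map_sub, coeff_monomial_ne hk.symm, sub_zero] at h1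
      rw [h1, smul_zero]

/-! ### The coefficients of the normal form -/

theorem hasSubst_invariants : HasSubst ![I₁, I₃] := by
  apply hasSubst_of_constantCoeff_zero
  intro i
  fin_cases i <;> simp [I₁, I₃]

theorem le_weightedOrder_I₁ (v : Fin 4 → ℕ) {a : ℕ} (h1 : v 1 + v 2 = a) (h2 : v 0 + v 3 = a) :
    (a : ℕ∞) ≤ weightedOrder v I₁ := by
  refine le_weightedOrder_sub' ?_ ?_
  · rw [← h1]
    exact le_weightedOrder_mul' (le_weightedOrder_X v 1) (le_weightedOrder_X v 2)
  · rw [← h2]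
    exact le_weightedOrder_mul' (le_weightedOrder_X v 0) (le_weightedOrder_X v 3)

theorem le_weightedOrder_I₃ (v : Fin 4 → ℕ) {a : ℕ} (h1 : v 2 * 2 = a) (h2 : v 3 * 2 = a) :
    (a : ℕ∞) ≤ weightedOrder v I₃ := by
  refine le_weightedOrder_C_mul _ (le_weightedOrder_add' ?_ ?_)
  · rw [← h1]
    exact le_weightedOrder_pow' (le_weightedOrder_X v 2) 2
  · rw [← h2]
    exact le_weightedOrder_pow' (le_weightedOrder_X v 3) 2

/-- The monomial `I₁ˡ I₃ᵏ` has no terms of degree below `2 l + 2 k`, nor of weighted degree below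
`3 l + 2 k`, nor of degree in `p` below `l + 2 k`. -/
theorem coeff_I₁_pow_mul_I₃_pow (l k a b c d : ℕ)
    (h : a + b + c + d < 2 * l + 2 * k ∨ 2 * a + 2 * b + c + d < 3 * l + 2 * k ∨
      c + d < l + 2 * k) :
    coeff (multiIndex a b c d) (I₁ ^ l * I₃ ^ k) = 0 := by
  rcases h with h | h | h
  · have h1 : ((2 * l + 2 * k : ℕ) : ℕ∞) ≤ weightedOrder (fun _ => 1) (I₁ ^ l * I₃ ^ k) :=
      le_weightedOrder_mul' (le_weightedOrder_pow' (le_weightedOrder_I₁ _ rfl rfl) l)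
        (le_weightedOrder_pow' (le_weightedOrder_I₃ _ rfl rfl) k)
    refine coeff_of_lt_order (lt_of_lt_of_le ?_ h1)
    rw [Finsupp.degree_eq_sum, Fin.sum_univ_four]
    exact_mod_cast h
  · have h1 : ((3 * l + 2 * k : ℕ) : ℕ∞) ≤ weightedOrder wt (I₁ ^ l * I₃ ^ k) :=
      le_weightedOrder_mul' (le_weightedOrder_pow' (le_weightedOrder_I₁ _ rfl rfl) l)
        (le_weightedOrder_pow' (le_weightedOrder_I₃ _ rfl rfl) k)
    refine (le_weightedOrder_iff _ _).1 h1 _ ?_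
    rw [wdeg_eq]
    exact h
  · have h1 : ((1 * l + 2 * k : ℕ) : ℕ∞) ≤ weightedOrder ![0, 0, 1, 1] (I₁ ^ l * I₃ ^ k) :=
      le_weightedOrder_mul' (le_weightedOrder_pow' (le_weightedOrder_I₁ _ rfl rfl) l)
        (le_weightedOrder_pow' (le_weightedOrder_I₃ _ rfl rfl) k)
    refine coeff_eq_zero_of_lt_weightedOrder _ (lt_of_lt_of_le ?_ h1)
    rw [Finsupp.weight_apply, Finsupp.sum_fintype _ _ (by simp), Fin.sum_univ_four]
    have : c + d < 1 * l + 2 * k := by omega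
    simpa using (by exact_mod_cast this : ((c + d : ℕ) : ℕ∞) < ((1 * l + 2 * k : ℕ) : ℕ∞))

theorem coeff_subst_invariants (g : MvPowerSeries (Fin 2) ℂ) (m : Fin 4 →₀ ℕ) :
    coeff m (subst ![I₁, I₃] g) = ∑ᶠ k, coeff k g • coeff m (I₁ ^ k 0 * I₃ ^ k 1) := by
  rw [coeff_subst hasSubst_invariants]
  refine finsum_congr fun k => ?_
  rw [Finsupp.prod_fintype _ _ (fun i => pow_zero _), Fin.prod_univ_two]
  simp

/-- The coefficients of the higher order part of the normal form, as a series in two variables. -/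
def normalFormCoeffs (a : ℕ → ℕ → ℂ) : MvPowerSeries (Fin 2) ℂ :=
  fun m => if 2 ≤ m 0 + m 1 then a (m 0) (m 1) else 0

theorem coeff_normalFormCoeffs (a : ℕ → ℕ → ℂ) (m : Fin 2 →₀ ℕ) :
    coeff m (normalFormCoeffs a) = if 2 ≤ m 0 + m 1 then a (m 0) (m 1) else 0 := rfl

theorem normalForm_eq (a : ℕ → ℕ → ℂ) :
    normalForm a = -I₁ + I₂ + subst ![I₁, I₃] (normalFormCoeffs a) := rfl

theorem coeff_normalFormTail_of_degree_lt (A : ℕ → ℕ → ℂ) (a b c d : ℕ) (h : a + b + c + d < 4) :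
    coeff (multiIndex a b c d) (subst ![I₁, I₃] (normalFormCoeffs A)) = 0 := by
  rw [coeff_subst_invariants]
  refine finsum_eq_zero_of_forall_eq_zero fun k => ?_
  rw [coeff_normalFormCoeffs]
  split_ifs with hk
  · rw [coeff_I₁_pow_mul_I₃_pow _ _ _ _ _ _ (Or.inl (by omega)), smul_zero]
  · rw [zero_smul]

/-- Among the monomials `I₁ˡ I₃ᵏ` with `l + k ≥ 2` only `I₁ I₃` contains terms `q p³`. -/
theorem coeff_normalFormTail (A : ℕ → ℕ → ℂ) (a b c d : ℕ) (h : a + b = 1) (h' : c + d = 3) :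
    coeff (multiIndex a b c d) (subst ![I₁, I₃] (normalFormCoeffs A))
      = A 1 1 * coeff (multiIndex a b c d) (I₁ * I₃) := by
  rw [coeff_subst_invariants, finsum_eq_single _ (Finsupp.single 0 1 + Finsupp.single 1 1)]
  · rw [coeff_normalFormCoeffs]
    simp
  · intro k hk
    rw [coeff_normalFormCoeffs]
    split_ifs with h2
    · have hk' : ¬ (k 0 = 1 ∧ k 1 = 1) := by
        rintro ⟨h0, h1⟩
        apply hk
        ext i
        fin_cases i <;> simp [h0, h1]
      rw [coeff_I₁_pow_mul_I₃_pow _ _ _ _ _ _ (by omega), smul_zero]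
    · rw [zero_smul]

/-! ### Near identity symplectic maps -/

theorem coeff_eq_coeff_X {Φ : Fin 4 → MvPowerSeries (Fin 4) ℂ}
    (h : ∀ (i : Fin 4) (m : Fin 4 →₀ ℕ), m.degree < 2 →
      coeff m (Φ i) = coeff m (X i)) (i : Fin 4) (a b c d : ℕ) (hd : a + b + c + d < 2) :
    coeff (multiIndex a b c d) (Φ i) = coeff (multiIndex a b c d) (X i) := by
  refine h i _ ?_
  rw [Finsupp.degree_eq_sum, Fin.sum_univ_four]
  exact hd

/-- The bracket relations of a symplectic map: the entries of the matrix identity, as Lagrange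
brackets. -/
theorem bracket_of_symplectic {Φ : Fin 4 → MvPowerSeries (Fin 4) ℂ}
    (h : (jacobian Φ).transpose * symplJ * jacobian Φ = symplJ) (i j : Fin 4) :
    pderiv ℂ i (Φ 0) * pderiv ℂ j (Φ 2) + pderiv ℂ i (Φ 1) * pderiv ℂ j (Φ 3)
      - pderiv ℂ i (Φ 2) * pderiv ℂ j (Φ 0) - pderiv ℂ i (Φ 3) * pderiv ℂ j (Φ 1)
      = symplJ i j := by
  have := congrFun (congrFun h i) j
  rw [← this]
  simp [Matrix.mul_apply, Fin.sum_univ_four, jacobian, symplJ]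
  ring

theorem subst_hamiltonian {Φ : Fin 4 → MvPowerSeries (Fin 4) ℂ} (hs : HasSubst Φ) (η : ℂ)
    (f : MvPowerSeries (Fin 4) ℂ) :
    subst Φ (hamiltonian η f) = -(Φ 1 * Φ 2 - Φ 0 * Φ 3)
      + C (1 / 2 : ℂ) * (Φ 0 ^ 2 + Φ 1 ^ 2)
      + C η * (C (1 / 2 : ℂ) * (Φ 2 ^ 2 + Φ 3 ^ 2)) ^ 2 + subst Φ f := by
  have hC : ∀ r : ℂ, substAlgHom hs (C r) = C r := fun r => by
    have := (substAlgHom (R := ℂ) (S := ℂ) hs).commutes r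
    exact this
  rw [← substAlgHom_apply hs, ← substAlgHom_apply hs]
  simp only [hamiltonian, I₁, I₂, I₃, map_add, map_sub, map_neg, map_mul, map_pow, hC,
    substAlgHom_X]

theorem coeff_I₁_I₂_of_degree (a b c d : ℕ) (h : 2 < a + b + c + d) :
    coeff (multiIndex a b c d) I₁ = 0 ∧ coeff (multiIndex a b c d) I₂ = 0 := by
  classical
  have hX : ∀ i j : Fin 4,
      coeff (multiIndex a b c d) (X i * X j : MvPowerSeries (Fin 4) ℂ) = 0 := by
    intro i j
    have hm : (X i * X j : MvPowerSeries (Fin 4) ℂ)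
        = monomial (Finsupp.single i 1 + Finsupp.single j 1) 1 := by
      rw [X_def, X_def, monomial_mul_monomial, mul_one]
    rw [hm, coeff_monomial_ne]
    intro he
    have := congrArg Finsupp.degree he
    rw [map_add, Finsupp.degree_single, Finsupp.degree_single, Finsupp.degree_eq_sum,
      Fin.sum_univ_four] at this
    simp only [multiIndex_apply_zero, multiIndex_apply_one, multiIndex_apply_two,
      multiIndex_apply_three] at this
    omega
  constructor
  · rw [I₁, map_sub, hX, hX, sub_zero]
  · rw [I₂, coeff_C_mul, pow_two, pow_two, map_add, hX, hX, add_zero, mul_zero]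

/-- The coefficients of order at most one of a near identity change of coordinates. -/
structure NearId (Φ : Fin 4 → MvPowerSeries (Fin 4) ℂ) : Prop where
  c0 : ∀ i, coeff (multiIndex 0 0 0 0) (Φ i) = 0
  c1 : ∀ i, coeff (multiIndex 1 0 0 0) (Φ i) = if i = 0 then 1 else 0
  c2 : ∀ i, coeff (multiIndex 0 1 0 0) (Φ i) = if i = 1 then 1 else 0
  c3 : ∀ i, coeff (multiIndex 0 0 1 0) (Φ i) = if i = 2 then 1 else 0
  c4 : ∀ i, coeff (multiIndex 0 0 0 1) (Φ i) = if i = 3 then 1 else 0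

theorem IsNormalization.nearId {H : MvPowerSeries (Fin 4) ℂ}
    {Φ : Fin 4 → MvPowerSeries (Fin 4) ℂ} {A : ℕ → ℕ → ℂ} (h : IsNormalization H Φ A) :
    NearId Φ := by
  have hid := coeff_eq_coeff_X h.near_id
  constructor <;> intro i <;> rw [hid i _ _ _ _ (by omega), coeff_multiIndex_X] <;>
    fin_cases i <;> simp

theorem IsNormalization.hasSubst {H : MvPowerSeries (Fin 4) ℂ}
    {Φ : Fin 4 → MvPowerSeries (Fin 4) ℂ} {A : ℕ → ℕ → ℂ} (h : IsNormalization H Φ A) :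
    HasSubst Φ := by
  apply hasSubst_of_constantCoeff_zero
  intro i
  have := h.near_id i 0 (by simp)
  simpa using this

theorem NearId.le_order {Φ : Fin 4 → MvPowerSeries (Fin 4) ℂ} (h : NearId Φ) (i : Fin 4) :
    ((1 : ℕ) : ℕ∞) ≤ weightedOrder (fun _ => 1) (Φ i) := by
  refine nat_le_order fun m hm => ?_
  have : m = multiIndex 0 0 0 0 := by
    rw [Finsupp.degree_eq_sum, Fin.sum_univ_four] at hm
    rw [eq_multiIndex m]
    congr 1 <;> omega
  rw [this, h.c0]

theorem NearId.le_weightedOrder {Φ : Fin 4 → MvPowerSeries (Fin 4) ℂ} (h : NearId Φ) (i : Fin 4) :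
    (wt i : ℕ∞) ≤ weightedOrder wt (Φ i) := by
  rw [le_weightedOrder_iff]
  intro m hm
  rw [wdeg_eq] at hm
  rw [eq_multiIndex m]
  have hi : wt i ≤ 2 := by fin_cases i <;> simp [wt]
  have m0 : m 0 = 0 := by omega
  have m1 : m 1 = 0 := by omega
  rcases Nat.eq_zero_or_pos (m 2 + m 3) with h23 | h23
  · rw [m0, m1, show m 2 = 0 by omega, show m 3 = 0 by omega, h.c0]
  · have hi2 : wt i = 2 := by omega
    have hi' : i = 0 ∨ i = 1 := by fin_cases i <;> simp_all [wt]
    obtain ⟨e2, e3⟩ | ⟨e2, e3⟩ : (m 2 = 1 ∧ m 3 = 0) ∨ (m 2 = 0 ∧ m 3 = 1) := by omega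
    · rw [m0, m1, e2, e3, h.c3]
      rcases hi' with rfl | rfl <;> simp
    · rw [m0, m1, e2, e3, h.c4]
      rcases hi' with rfl | rfl <;> simp

/-- The fourth order term `(I₃ ∘ Φ)²` does not contribute at the orders that matter. -/
theorem NearId.coeff_sq {Φ : Fin 4 → MvPowerSeries (Fin 4) ℂ} (h : NearId Φ) (a b c d : ℕ)
    (hd : a + b + c + d = 3 ∨ multiIndex a b c d ∈ ({multiIndex 0 1 3 0, multiIndex 0 1 1 2,
      multiIndex 1 0 2 1, multiIndex 1 0 0 3} : Set (Fin 4 →₀ ℕ))) :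
    coeff (multiIndex a b c d) ((C (1 / 2 : ℂ) * (Φ 2 ^ 2 + Φ 3 ^ 2)) ^ 2) = 0 := by
  obtain ⟨h0, h1, h2, h3, h4⟩ := h
  have hJ : ((2 : ℕ) : ℕ∞) ≤ weightedOrder (fun _ => 1) (C (1 / 2 : ℂ) * (Φ 2 ^ 2 + Φ 3 ^ 2)) :=
    le_weightedOrder_C_mul _ (le_weightedOrder_add'
      (le_weightedOrder_pow' (NearId.le_order ⟨h0, h1, h2, h3, h4⟩ 2) 2)
      (le_weightedOrder_pow' (NearId.le_order ⟨h0, h1, h2, h3, h4⟩ 3) 2))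
  have hJ1 : ∀ i j k l, i + j + k + l < 2 →
      coeff (multiIndex i j k l) (C (1 / 2 : ℂ) * (Φ 2 ^ 2 + Φ 3 ^ 2)) = 0 := by
    intro i j k l hlt
    refine coeff_of_lt_order (lt_of_lt_of_le ?_ hJ)
    rw [Finsupp.degree_eq_sum, Fin.sum_univ_four]
    exact_mod_cast hlt
  rcases hd with hd | hd
  · refine coeff_of_lt_order (lt_of_lt_of_le ?_ (le_weightedOrder_pow' hJ 2))
    rw [Finsupp.degree_eq_sum, Fin.sum_univ_four]
    have : a + b + c + d < 2 * 2 := by omega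
    exact_mod_cast this
  · have hqp : ∀ i j k l, i + j = 1 → k + l = 1 →
        coeff (multiIndex i j k l) (C (1 / 2 : ℂ) * (Φ 2 ^ 2 + Φ 3 ^ 2)) = 0 := by
      intro i j k l hij hkl
      have hi : (i = 1 ∧ j = 0) ∨ (i = 0 ∧ j = 1) := by omega
      have hk : (k = 1 ∧ l = 0) ∨ (k = 0 ∧ l = 1) := by omega
      rcases hi with ⟨rfl, rfl⟩ | ⟨rfl, rfl⟩ <;> rcases hk with ⟨rfl, rfl⟩ | ⟨rfl, rfl⟩ <;>
        simp [coeff_C_mul, pow_two, coeff_multiIndex_mul, Finset.sum_range_succ, h0, h1, h2, h3, h4]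
    generalize C (1 / 2 : ℂ) * (Φ 2 ^ 2 + Φ 3 ^ 2) = J at hJ1 hqp
    rcases hd with hd | hd | hd | hd <;> rw [hd] <;>
      simp [pow_two, coeff_multiIndex_mul, Finset.sum_range_succ, hJ1, hqp]

/-- The normal form equation in degree `3`, below weighted degree `5`. -/
theorem IsNormalization.coeff_three {η : ℂ} {f : MvPowerSeries (Fin 4) ℂ} (hf : WeightGE 5 f)
    {Φ : Fin 4 → MvPowerSeries (Fin 4) ℂ} {A : ℕ → ℕ → ℂ}
    (h : IsNormalization (hamiltonian η f) Φ A) (a b c d : ℕ) (hd : a + b + c + d = 3)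
    (hw : 2 * a + 2 * b + c + d < 5) :
    coeff (multiIndex a b c d) (Φ 0 * Φ 3 - Φ 1 * Φ 2)
      + 1 / 2 * coeff (multiIndex a b c d) (Φ 0 * Φ 0 + Φ 1 * Φ 1) = 0 := by
  have hn := h.nearId
  have e := congrArg (coeff (multiIndex a b c d)) h.normal
  rw [subst_hamiltonian h.hasSubst, normalForm_eq] at e
  simp only [map_add, map_sub, map_neg, coeff_C_mul, hn.coeff_sq a b c d (Or.inl hd),
    coeff_normalFormTail_of_degree_lt A a b c d (by omega),
    (coeff_I₁_I₂_of_degree a b c d (by omega)).1, (coeff_I₁_I₂_of_degree a b c d (by omega)).2,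
    coeff_subst_eq_zero h.hasSubst hn.le_weightedOrder hf (multiIndex a b c d)
      (by rw [wdeg_eq]; exact hw)] at e ⊢
  rw [pow_two, pow_two] at e
  linear_combination e

/-- The terms of `Φ 0` and `Φ 1` that are quadratic in `p` vanish: they are determined by the
cubic terms of the normal form equation and the bracket relations. -/
theorem IsNormalization.coeff_pp {η : ℂ} {f : MvPowerSeries (Fin 4) ℂ} (hf : WeightGE 5 f)
    {Φ : Fin 4 → MvPowerSeries (Fin 4) ℂ} {A : ℕ → ℕ → ℂ}
    (h : IsNormalization (hamiltonian η f) Φ A) (i : Fin 4) (hi : i = 0 ∨ i = 1) :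
    coeff (multiIndex 0 0 2 0) (Φ i) = 0 ∧ coeff (multiIndex 0 0 1 1) (Φ i) = 0 ∧
      coeff (multiIndex 0 0 0 2) (Φ i) = 0 := by
  obtain ⟨h0, h1, h2, h3, h4⟩ := h.nearId
  have hbr := bracket_of_symplectic h.symplectic 2 3
  have e30 := h.coeff_three hf 0 0 3 0 rfl (by norm_num)
  have e21 := h.coeff_three hf 0 0 2 1 rfl (by norm_num)
  have e12 := h.coeff_three hf 0 0 1 2 rfl (by norm_num)
  have e03 := h.coeff_three hf 0 0 0 3 rfl (by norm_num)
  have b1 := congrArg (coeff (multiIndex 0 0 1 0)) hbr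
  have b2 := congrArg (coeff (multiIndex 0 0 0 1)) hbr
  simp [symplJ, coeff_multiIndex_mul, Finset.sum_range_succ, coeff_pderiv_two, coeff_pderiv_three,
    h0, h3, h4] at e30 e21 e12 e03 b1 b2
  rcases hi with rfl | rfl <;> refine ⟨?_, ?_, ?_⟩ <;> grind

theorem coeff_one_of_pos (a b c d : ℕ) (h : 0 < a + b + c + d) :
    coeff (multiIndex a b c d) (1 : MvPowerSeries (Fin 4) ℂ) = 0 := by
  classical
  rw [coeff_one, if_neg]
  intro he
  have h0 := DFunLike.congr_fun he 0
  have h1 := DFunLike.congr_fun he 1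
  have h2 := DFunLike.congr_fun he 2
  have h3 := DFunLike.congr_fun he 3
  simp at h0 h1 h2 h3
  omega

/-- The terms of weighted degree `3` in `Φ 0`, `Φ 1` that are bilinear in `q`, `p` vanish, as do the
terms of `Φ 2`, `Φ 3` that are quadratic in `p`. -/
theorem IsNormalization.coeff_qp {η : ℂ} {f : MvPowerSeries (Fin 4) ℂ} (hf : WeightGE 5 f)
    {Φ : Fin 4 → MvPowerSeries (Fin 4) ℂ} {A : ℕ → ℕ → ℂ}
    (h : IsNormalization (hamiltonian η f) Φ A) :
    (∀ i, i = 0 ∨ i = 1 →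
      coeff (multiIndex 1 0 1 0) (Φ i) = 0 ∧ coeff (multiIndex 1 0 0 1) (Φ i) = 0 ∧
      coeff (multiIndex 0 1 1 0) (Φ i) = 0 ∧ coeff (multiIndex 0 1 0 1) (Φ i) = 0) ∧
    ∀ i, i = 2 ∨ i = 3 →
      coeff (multiIndex 0 0 2 0) (Φ i) = 0 ∧ coeff (multiIndex 0 0 1 1) (Φ i) = 0 ∧
      coeff (multiIndex 0 0 0 2) (Φ i) = 0 := by
  obtain ⟨h0, h1, h2, h3, h4⟩ := h.nearId
  obtain ⟨p1, p2, p3⟩ := h.coeff_pp hf 0 (Or.inl rfl)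
  obtain ⟨r1, r2, r3⟩ := h.coeff_pp hf 1 (Or.inr rfl)
  have o1 := coeff_one_of_pos 0 0 1 0 (by norm_num)
  have o2 := coeff_one_of_pos 0 0 0 1 (by norm_num)
  have e1 := h.coeff_three hf 1 0 2 0 rfl (by norm_num)
  have e2 := h.coeff_three hf 1 0 1 1 rfl (by norm_num)
  have e3 := h.coeff_three hf 1 0 0 2 rfl (by norm_num)
  have e4 := h.coeff_three hf 0 1 2 0 rfl (by norm_num)
  have e5 := h.coeff_three hf 0 1 1 1 rfl (by norm_num)
  have e6 := h.coeff_three hf 0 1 0 2 rfl (by norm_num)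
  have hbr := bracket_of_symplectic h.symplectic
  have b1 := congrArg (coeff (multiIndex 0 0 1 0)) (hbr 0 2)
  have b2 := congrArg (coeff (multiIndex 0 0 0 1)) (hbr 0 2)
  have b3 := congrArg (coeff (multiIndex 0 0 1 0)) (hbr 0 3)
  have b4 := congrArg (coeff (multiIndex 0 0 0 1)) (hbr 0 3)
  have b5 := congrArg (coeff (multiIndex 0 0 1 0)) (hbr 1 2)
  have b6 := congrArg (coeff (multiIndex 0 0 0 1)) (hbr 1 2)
  have b7 := congrArg (coeff (multiIndex 0 0 1 0)) (hbr 1 3)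
  have b8 := congrArg (coeff (multiIndex 0 0 0 1)) (hbr 1 3)
  have c1 := congrArg (coeff (multiIndex 1 0 0 0)) (hbr 2 3)
  have c2 := congrArg (coeff (multiIndex 0 1 0 0)) (hbr 2 3)
  simp [symplJ, coeff_multiIndex_mul, Finset.sum_range_succ, coeff_pderiv_zero, coeff_pderiv_one,
    coeff_pderiv_two, coeff_pderiv_three, h0, h1, h2, h3, h4, p1, p2, p3, r1, r2, r3, o1, o2]
    at e1 e2 e3 e4 e5 e6 b1 b2 b3 b4 b5 b6 b7 b8 c1 c2
  clear h0 h1 h2 h3 h4 hbr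
  -- The sixteen equations form a homogeneous linear system with trivial kernel.
  constructor
  · rintro i (rfl | rfl) <;> refine ⟨?_, ?_, ?_, ?_⟩ <;> grind
  · rintro i (rfl | rfl) <;> refine ⟨?_, ?_, ?_⟩ <;> grind

/-- A normalization agrees with the identity in lowest weighted order. -/
theorem IsNormalization.agreeAt {η : ℂ} {f : MvPowerSeries (Fin 4) ℂ} (hf : WeightGE 5 f)
    {Φ : Fin 4 → MvPowerSeries (Fin 4) ℂ} {A : ℕ → ℕ → ℂ}
    (h : IsNormalization (hamiltonian η f) Φ A) (i : Fin 4) : AgreeAt (wt i) (Φ i) (X i) := by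
  refine ⟨h.nearId.le_weightedOrder i, le_weightedOrder_X wt i, ?_⟩
  rw [le_weightedOrder_iff]
  intro m hm
  rw [map_sub, sub_eq_zero]
  rw [wdeg_eq] at hm
  have hi : wt i ≤ 2 := by fin_cases i <;> simp [wt]
  rcases Nat.lt_or_ge (m 0 + m 1 + m 2 + m 3) 2 with hd | hd
  · rw [eq_multiIndex m]
    exact coeff_eq_coeff_X h.near_id i _ _ _ _ hd
  · have m0 : m 0 = 0 := by omega
    have m1 : m 1 = 0 := by omega
    have hi2 : wt i = 2 := by omega
    have hi' : i = 0 ∨ i = 1 := by fin_cases i <;> simp_all [wt]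
    obtain ⟨p1, p2, p3⟩ := h.coeff_pp hf i hi'
    have h23 : (m 2 = 2 ∧ m 3 = 0) ∨ (m 2 = 1 ∧ m 3 = 1) ∨ (m 2 = 0 ∧ m 3 = 2) := by omega
    rw [eq_multiIndex m, m0, m1]
    rcases h23 with ⟨e2, e3⟩ | ⟨e2, e3⟩ | ⟨e2, e3⟩ <;> rw [e2, e3, coeff_multiIndex_X] <;>
      rcases hi' with rfl | rfl <;> simp [p1, p2, p3]

/-! ### The normal form coefficient -/

/-- The normal form equation in weighted degree `5`. -/
theorem IsNormalization.coeff_five {η : ℂ} {f : MvPowerSeries (Fin 4) ℂ} (hf : WeightGE 5 f)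
    {Φ : Fin 4 → MvPowerSeries (Fin 4) ℂ} {A : ℕ → ℕ → ℂ}
    (h : IsNormalization (hamiltonian η f) Φ A) (a b c d : ℕ) (hab : a + b = 1) (hcd : c + d = 3)
    (hd : multiIndex a b c d ∈ ({multiIndex 0 1 3 0, multiIndex 0 1 1 2,
      multiIndex 1 0 2 1, multiIndex 1 0 0 3} : Set (Fin 4 →₀ ℕ))) :
    coeff (multiIndex a b c d) (Φ 0 * Φ 3 - Φ 1 * Φ 2)
      + 1 / 2 * coeff (multiIndex a b c d) (Φ 0 * Φ 0 + Φ 1 * Φ 1)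
      + coeff (multiIndex a b c d) f = A 1 1 * coeff (multiIndex a b c d) (I₁ * I₃) := by
  have e := congrArg (coeff (multiIndex a b c d)) h.normal
  rw [subst_hamiltonian h.hasSubst, normalForm_eq] at e
  simp only [map_add, map_sub, map_neg, coeff_C_mul, h.nearId.coeff_sq a b c d (Or.inr hd),
    coeff_normalFormTail A a b c d hab hcd,
    (coeff_I₁_I₂_of_degree a b c d (by omega)).1, (coeff_I₁_I₂_of_degree a b c d (by omega)).2,
    coeff_subst_eq_coeff h.hasSubst (h.agreeAt hf) hf (multiIndex a b c d)
      (by rw [wdeg_eq]; simp only [multiIndex_apply_zero, multiIndex_apply_one,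
        multiIndex_apply_two, multiIndex_apply_three]; omega)] at e ⊢
  rw [pow_two, pow_two] at e
  linear_combination e

theorem coeff_I₁_mul_I₃ :
    coeff (multiIndex 0 1 3 0) (I₁ * I₃) = 1 / 2 ∧ coeff (multiIndex 0 1 1 2) (I₁ * I₃) = 1 / 2 ∧
    coeff (multiIndex 1 0 2 1) (I₁ * I₃) = -1 / 2 ∧
    coeff (multiIndex 1 0 0 3) (I₁ * I₃) = -1 / 2 := by
  have e : I₁ * I₃ = C (1 / 2 : ℂ) * (monomial (multiIndex 0 1 3 0) 1
      + monomial (multiIndex 0 1 1 2) 1 - monomial (multiIndex 1 0 2 1) 1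
      - monomial (multiIndex 1 0 0 3) 1) := by
    have hm : ∀ a b c d, (monomial (multiIndex a b c d) (1 : ℂ))
        = X 0 ^ a * X 1 ^ b * X 2 ^ c * X 3 ^ d := by
      intro a b c d
      rw [monomial_one_eq, Finsupp.prod_fintype _ _ (fun i => pow_zero _), Fin.prod_univ_four]
      simp
    rw [hm, hm, hm, hm, I₁, I₃]
    ring
  have hne : ∀ {a b c d a' b' c' d' : ℕ}, b ≠ b' ∨ c ≠ c' →
      multiIndex a b c d ≠ multiIndex a' b' c' d' := by
    rintro a b c d a' b' c' d' h he
    have h1 := DFunLike.congr_fun he 1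
    have h2 := DFunLike.congr_fun he 2
    simp at h1 h2
    omega
  classical
  rw [e]
  simp only [coeff_C_mul, map_add, map_sub, coeff_monomial, if_true]
  refine ⟨?_, ?_, ?_, ?_⟩ <;> simp [hne] <;> norm_num

set_option maxHeartbeats 3000000 in
/-- The coefficient `a₁₁` of the normal form. The contributions of `Φ` to the four coefficients that
define `coeffI₁I₃` cancel by the bracket relations. -/
theorem IsNormalization.coeff_one_one {η : ℂ} {f : MvPowerSeries (Fin 4) ℂ} (hf : WeightGE 5 f)
    {Φ : Fin 4 → MvPowerSeries (Fin 4) ℂ} {A : ℕ → ℕ → ℂ}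
    (h : IsNormalization (hamiltonian η f) Φ A) : A 1 1 = coeffI₁I₃ f := by
  obtain ⟨h0, h1, h2, h3, h4⟩ := h.nearId
  obtain ⟨p1, p2, p3⟩ := h.coeff_pp hf 0 (Or.inl rfl)
  obtain ⟨r1, r2, r3⟩ := h.coeff_pp hf 1 (Or.inr rfl)
  obtain ⟨hq, hp⟩ := h.coeff_qp hf
  obtain ⟨s1, s2, s3, s4⟩ := hq 0 (Or.inl rfl)
  obtain ⟨t1, t2, t3, t4⟩ := hq 1 (Or.inr rfl)
  obtain ⟨u1, u2, u3⟩ := hp 2 (Or.inl rfl)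
  obtain ⟨v1, v2, v3⟩ := hp 3 (Or.inr rfl)
  obtain ⟨k1, k2, k3, k4⟩ := coeff_I₁_mul_I₃
  have o1 := coeff_one_of_pos 0 0 2 0 (by norm_num)
  have o3 := coeff_one_of_pos 0 0 0 2 (by norm_num)
  have e1 := h.coeff_five hf 0 1 3 0 rfl rfl (by simp)
  have e2 := h.coeff_five hf 0 1 1 2 rfl rfl (by simp)
  have e3 := h.coeff_five hf 1 0 2 1 rfl rfl (by simp)
  have e4 := h.coeff_five hf 1 0 0 3 rfl rfl (by simp)
  rw [k1] at e1
  rw [k2] at e2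
  rw [k3] at e3
  rw [k4] at e4
  have hbr := bracket_of_symplectic h.symplectic
  have b1 := congrArg (coeff (multiIndex 0 0 2 0)) (hbr 0 2)
  have b2 := congrArg (coeff (multiIndex 0 0 0 2)) (hbr 0 2)
  have b3 := congrArg (coeff (multiIndex 0 0 1 1)) (hbr 0 3)
  have b4 := congrArg (coeff (multiIndex 0 0 1 1)) (hbr 1 2)
  have b5 := congrArg (coeff (multiIndex 0 0 2 0)) (hbr 1 3)
  have b6 := congrArg (coeff (multiIndex 0 0 0 2)) (hbr 1 3)
  have b7 := congrArg (coeff (multiIndex 0 0 2 0)) (hbr 2 3)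
  have b8 := congrArg (coeff (multiIndex 0 0 0 2)) (hbr 2 3)
  simp [coeff_multiIndex_mul, Finset.sum_range_succ,
    h0, h1, h2, h3, h4, p1, p2, p3, r1, r2, r3,
    s1, s2, s3, s4, t1, t2, t3, t4, u1, u2, u3, v1, v2, v3]
    at e1 e2 e3 e4
  simp [symplJ, coeff_multiIndex_mul, Finset.sum_range_succ, coeff_pderiv_zero, coeff_pderiv_one,
    coeff_pderiv_two, coeff_pderiv_three, h1, h2, h3, h4, p1, p2, p3, r1, r2, r3,
    u1, u2, u3, v1, v2, v3, o1, o3]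
    at b1 b2 b3 b4
  simp [symplJ, coeff_multiIndex_mul, Finset.sum_range_succ, coeff_pderiv_one,
    coeff_pderiv_two, coeff_pderiv_three, h2, h3, h4, p2, p3, r2, r3,
    u2, u3, v2, v3, o1, o3]
    at b5 b6 b7 b8
  rw [coeffI₁I₃]
  linear_combination (-3 * e1 - e2 + e3 + 3 * e4) / 4 - b1 / 4 - 3 / 4 * b2 + b3 / 4 + b4 / 4
    - 3 / 4 * b5 - b6 / 4 + b7 / 4 + b8 / 4

end NormalForm

end

end FormalSeparatrix

open FormalSeparatrix in
theorem theorem2 (η : ℂ) (hη : η ≠ 0) (U : Set (Fin 4 → ℂ)) (hU : IsOpen U)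
    (h0 : (0 : Fin 4 → ℂ) ∈ U) (F : (Fin 4 → ℂ) → ℂ) (hF : AnalyticOnNhd ℂ F U)
    (hb : ∃ C : ℝ, ∀ z ∈ U, ‖F z‖ ≤ C)
    (hord : ∀ m : Fin 4 →₀ ℕ, MvPowerSeries.coeff m (taylorSeries F) ≠ 0 → 5 ≤ ∑ i, wt i * m i) :
    (∀ (Φ : Fin 4 → MvPowerSeries (Fin 4) ℂ) (a : ℕ → ℕ → ℂ),
      IsNormalization (hamiltonian η (taylorSeries F)) Φ a →
        a 1 1 = coeffI₁I₃ (taylorSeries F)) ∧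
    ∀ κ : ℂ, κ ^ 2 = -2 / η →
      ∃ G : Fin 4 → PowerSeries (ℂ → ℂ),
        HasTrigCoeffs G ∧
        IsFormalSolution (hamiltonian η (taylorSeries F)) (ofHat G) ∧
        ofHat G ≠ 0 ∧
        (∀ φ : ℂ,
          PowerSeries.coeff 0 (G 0) φ = κ * Complex.cos φ ∧
          PowerSeries.coeff 0 (G 1) φ = κ * Complex.sin φ ∧
          PowerSeries.coeff 0 (G 2) φ = κ * Complex.cos φ ∧
          PowerSeries.coeff 0 (G 3) φ = κ * Complex.sin φ) ∧
        (∀ φ : ℂ,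
          PowerSeries.coeff 1 (G 0) φ = κ / η * (coeffI₁I₃ (taylorSeries F) * Complex.sin φ
            + coeffQPI₃ (taylorSeries F) * Complex.cos φ) ∧
          PowerSeries.coeff 1 (G 1) φ = κ / η * (-coeffI₁I₃ (taylorSeries F) * Complex.cos φ
            + coeffQPI₃ (taylorSeries F) * Complex.sin φ) ∧
          PowerSeries.coeff 1 (G 2) φ = κ / η * (coeffI₁I₃ (taylorSeries F) * Complex.sin φ) ∧
          PowerSeries.coeff 1 (G 3) φ = κ / η * (-coeffI₁I₃ (taylorSeries F) * Complex.cos φ)) ∧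
        ∀ G' : Fin 4 → PowerSeries (ℂ → ℂ),
          HasTrigCoeffs G' →
          IsFormalSolution (hamiltonian η (taylorSeries F)) (ofHat G') →
          ofHat G' ≠ 0 →
          ∃ φ₀ τ₀ : ℂ, ∀ i, ofHat G' i = translate φ₀ τ₀ (ofHat G i) :=
  ⟨fun _ _ h => h.coeff_one_one hord, fun _ hκ => exists_formalSeparatrix hη hord hκ⟩
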